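/- \textbf{Setting.} Let $\omega_1,\omega_2\in\mathbb{C}$ be $\mathbb{R}$-linearly independent, $\Omega=\mathbb{Z}\omega_1\oplus\mathbb{Z}\omega_2$, $e(u)=\exp(2\pi\sqrt{-1}\,u)$, $$\sigma(u;\Omega)=u\prod_{\omega\in\Omega\setminus\{0\}}\Bigl(1-\frac{u}{\omega}\Bigr)e^{\frac{u}{\omega}+\frac{u^2}{2\omega^2}},\qquad [u]=e(\kappa u^2)\,\sigma(u;\Omega)$$ with a constant $\kappa\in\mathbb{C}$. For $\omega\in\Omega$ let $\epsilon_\omega=1$ if $\omega\in2\Omega$ and $\epsilon_\omega=-1$ otherwise, and let $\eta_\omega\in\mathbb{C}$ be the constant determined by $[u+\omega]=\epsilon_\omega\,e(\eta_\omega(u+\frac{\omega}{2}))\,[u]$ for all $u\in\mathbb{C}$. Put $\omega_0=0$, $\omega_3=-\omega_1-\omega_2$ and $\epsilon_r=\epsilon_{\omega_r}$, $\eta_r=\eta_{\omega_r}$ for $r=0,1,2,3$. Fix $\delta\in\mathbb{C}\setminus\{0\}$ with $\mathbb{Z}\delta\cap\Omega=\{0\}$. Write $[x\pm y]=[x+y][x-y]$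 and $[u]_k=[u][u+\delta]\cdots[u+(k-1)\delta]$. For $a=(a_0,\dots,a_7)\in\mathbb{C}^8$ and $c\in\mathbb{C}$ put $$A^+(x;a)=\frac{\prod_{p=0}^7[x+a_p]}{[2x][2x+\delta]},\qquad A^-(x;a)=\frac{\prod_{p=0}^7[x-a_p]}{[2x][2x-\delta]},$$ $$A^0(x;a|c)=\sum_{r=0}^3\epsilon_r\,e\Bigl(\bigl(\delta-\tfrac{\omega_r}{2}-\tfrac12\textstyle\sum_{p=0}^7a_p\bigr)\eta_r\Bigr)\frac{[x\pm c]\prod_{p=0}^7[\frac12(\omega_r-\delta)+a_p]}{2\,[\frac12(\omega_r-\delta)\pm x]\,[\frac12(\omega_r-\delta)\pm c]}.$$ For $z\in\mathbb{C}^m$ and $w\in\mathbb{C}^n$ define $$S_{m,n}(z,w;a|c)=\sum_{I_+\sqcup I_0\sqcup I_-=\{1,\dots,m\}}\ \prod_{i\in I_+}A^+(z_i;a)\prod_{i\in I_0}A^0(z_i;a|c)\prod_{i\in I_-}A^-(z_i;a)$$ $$\cdot\prod_{\{i,j\}\subset I_+}\frac{[z_i+z_j+2\delta]}{[z_i+z_j]}\prod_{\{i,j\}\subset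 I_-}\frac{[z_i+z_j-2\delta]}{[z_i+z_j]}\prod_{i\in I_+,\,j\in I_-}\frac{[z_i-z_j+2\delta]}{[z_i-z_j]}$$ $$\cdot\prod_{i\in I_+,\,j\in I_0}\frac{[z_i+\delta\pm z_j]}{[z_i\pm z_j]}\prod_{i\in I_-,\,j\in I_0}\frac{[z_i-\delta\pm z_j]}{[z_i\pm z_j]}\prod_{i\in I_+,\,1\le k\le n}\frac{[z_i\pm w_k]}{[z_i+\delta\pm w_k]}\prod_{i\in I_-,\,1\le k\le n}\frac{[z_i\pm w_k]}{[z_i-\delta\pm w_k]},$$ where the sum is over all ordered triples $(I_+,I_0,I_-)$ of pairwise disjoint sets with union $\{1,\dots,m\}$, and $\{i,j\}\subset I_\pm$ runs over two-element subsets. \textbf{Theorem.} Let $M\ge N\ge0$ be integers, and let $a=(a_0,\dots,a_7)\in\mathbb{C}^8$ satisfy $$\sum_{p=0}^7a_p=(4-2M+2N)\delta,\qquad a_7=a_0+\delta,\qquad 2a_0+\delta,\;2a_0-\delta\notin\Omega.$$ Put $b_0=\delta-a_7$, $b_7=\delta-a_0$ and $b_p=\delta-a_p$ for $p=1,\dots,6$.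 Then for all $z\in\mathbb{C}^M$ and $w\in\mathbb{C}^N$ at which no denominator vanishes, that is, such that $[2z_i]$, $[2z_i\pm\delta]$, $[2w_k]$, $[2w_k\pm\delta]$ are nonzero for all $i,k$, $[z_i\pm z_j]\ne0$ and $[w_k\pm w_l]\ne0$ for $i\neq j$, $k\ne l$, and $[z_i+\delta\pm w_k]\ne0$, $[z_i-\delta\pm w_k]\neq0$ for all $i,k$, $$S_{M,N}(z,w;a|a_0)=\prod_{p=1}^{6}[a_0+a_p]_{M-N}\;S_{N,M}(w,z;b|b_0).$$ -/

import Mathlib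

noncomputable section

namespace EllipticBC

/-- The exponential `e(u) = exp(2πi u)`. -/
def e (u : ℂ) : ℂ := Complex.exp (2 * Real.pi * Complex.I * u)

/-- The Weierstrass sigma function of the lattice `Ω = ℤω₁ ⊕ ℤω₂`, as the (unconditionally
convergent) Weierstrass product over the nonzero periods. -/
def sigma (L : PeriodPair) (u : ℂ) : ℂ :=
  u * ∏' ω : {ω : ℂ // ω ∈ L.lattice ∧ ω ≠ 0},
    (1 - u / (ω : ℂ)) * Complex.exp (u / (ω : ℂ) + u ^ 2 / (2 * (ω : ℂ) ^ 2))

/-- The function `[u] = e(κu²) σ(u; Ω)`. -/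
def br (L : PeriodPair) (κ u : ℂ) : ℂ := e (κ * u ^ 2) * sigma L u

/-- `[x ± y] = [x + y][x - y]`. -/
def brPM (L : PeriodPair) (κ x y : ℂ) : ℂ := br L κ (x + y) * br L κ (x - y)

/-- The shifted factorial `[u]_k = [u][u + δ] ⋯ [u + (k-1)δ]`. -/
def brPoch (L : PeriodPair) (κ δ u : ℂ) (k : ℕ) : ℂ :=
  ∏ i ∈ Finset.range k, br L κ (u + (i : ℂ) * δ)

open Classical in
/-- The sign `ε_ω`: `1` if `ω ∈ 2Ω`, and `-1` otherwise. -/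
def signChar (L : PeriodPair) (ω : ℂ) : ℂ :=
  if ∃ l ∈ L.lattice, ω = 2 * l then 1 else -1

/-- The number `η_ω`, for a period `ω`: the unique `η` for which the quasi-periodicity
`[u + ω] = ε_ω e(η (u + ω/2)) [u]` holds for all `u`. -/
def quasiPeriod (L : PeriodPair) (κ ω : ℂ) : ℂ :=
  Classical.epsilon fun η : ℂ =>
    ∀ u : ℂ, br L κ (u + ω) = signChar L ω * e (η * (u + ω / 2)) * br L κ u

/-- The periods `ω_0 = 0`, `ω_1`, `ω_2`, `ω_3 = -ω_1 - ω_2`. -/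
def om (L : PeriodPair) : Fin 4 → ℂ := ![0, L.ω₁, L.ω₂, -L.ω₁ - L.ω₂]

/-- The coefficient `A⁺(x; a)`. -/
def Aplus (L : PeriodPair) (κ δ : ℂ) (a : Fin 8 → ℂ) (x : ℂ) : ℂ :=
  (∏ p, br L κ (x + a p)) / (br L κ (2 * x) * br L κ (2 * x + δ))

/-- The coefficient `A⁻(x; a)`. -/
def Aminus (L : PeriodPair) (κ δ : ℂ) (a : Fin 8 → ℂ) (x : ℂ) : ℂ :=
  (∏ p, br L κ (x - a p)) / (br L κ (2 * x) * br L κ (2 * x - δ))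

/-- The term `A⁰_r(x; a | c)`. -/
def AzeroTerm (L : PeriodPair) (κ δ : ℂ) (a : Fin 8 → ℂ) (r : Fin 4) (c x : ℂ) : ℂ :=
  signChar L (om L r) *
      e ((δ - om L r / 2 - (1 / 2) * ∑ p, a p) * quasiPeriod L κ (om L r)) *
    ((brPM L κ x c * ∏ p, br L κ ((1 / 2) * (om L r - δ) + a p)) /
      (2 * brPM L κ ((1 / 2) * (om L r - δ)) x * brPM L κ ((1 / 2) * (om L r - δ)) c))

/-- The coefficient `A⁰(x; a | c) = ∑_r A⁰_r(x; a | c_r)`, with `c = (c_0, c_1, c_2, c_3)`. -/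
def Azero (L : PeriodPair) (κ δ : ℂ) (a : Fin 8 → ℂ) (c : Fin 4 → ℂ) (x : ℂ) : ℂ :=
  ∑ r, AzeroTerm L κ δ a r (c r) x

/-- The summand attached to a splitting of `{1, …, m}` into three disjoint sets `P = I₊`,
`Z = I₀`, `Q = I₋`. -/
def splitTerm (L : PeriodPair) (κ δ : ℂ) (a : Fin 8 → ℂ) (c : Fin 4 → ℂ) {m n : ℕ}
    (z : Fin m → ℂ) (w : Fin n → ℂ) (P Z Q : Finset (Fin m)) : ℂ :=
  (∏ i ∈ P, Aplus L κ δ a (z i)) * (∏ i ∈ Z, Azero L κ δ a c (z i)) *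
    (∏ i ∈ Q, Aminus L κ δ a (z i)) *
    (∏ i ∈ P, ∏ j ∈ P with i < j, br L κ (z i + z j + 2 * δ) / br L κ (z i + z j)) *
    (∏ i ∈ Q, ∏ j ∈ Q with i < j, br L κ (z i + z j - 2 * δ) / br L κ (z i + z j)) *
    (∏ i ∈ P, ∏ j ∈ Q, br L κ (z i - z j + 2 * δ) / br L κ (z i - z j)) *
    (∏ i ∈ P, ∏ j ∈ Z, brPM L κ (z i + δ) (z j) / brPM L κ (z i) (z j)) *
    (∏ i ∈ Q, ∏ j ∈ Z, brPM L κ (z i - δ) (z j) / brPM L κ (z i) (z j)) *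
    (∏ i ∈ P, ∏ k, brPM L κ (z i) (w k) / brPM L κ (z i + δ) (w k)) *
    (∏ i ∈ Q, ∏ k, brPM L κ (z i) (w k) / brPM L κ (z i - δ) (w k))

/-- The sum of `splitTerm` over all splittings of `{1, …, m}` into `I₊`, `I₀`, `I₋`. A splitting
is given by its sign vector `s`, with `I₊ = {s = 1}`, `I₀ = {s = 0}`, `I₋ = {s = -1}`. -/
def splitSum (L : PeriodPair) (κ δ : ℂ) (a : Fin 8 → ℂ) (c : Fin 4 → ℂ) {m n : ℕ}
    (z : Fin m → ℂ) (w : Fin n → ℂ) : ℂ :=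
  ∑ s : Fin m → SignType,
    splitTerm L κ δ a c z w
      (Finset.univ.filter fun i => s i = 1)
      (Finset.univ.filter fun i => s i = 0)
      (Finset.univ.filter fun i => s i = -1)

/-- The dual parameters `b_0 = δ - a_7`, `b_p = δ - a_p` for `1 ≤ p ≤ 6`, `b_7 = δ - a_0`. -/
def dualParam (δ : ℂ) (a : Fin 8 → ℂ) : Fin 8 → ℂ :=
  ![δ - a 7, δ - a 1, δ - a 2, δ - a 3, δ - a 4, δ - a 5, δ - a 6, δ - a 0]

/-- The denominators that involve only one family of variables `z` are nonzero. -/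
def Generic (L : PeriodPair) (κ δ : ℂ) {m : ℕ} (z : Fin m → ℂ) : Prop :=
  (∀ i, br L κ (2 * z i) ≠ 0 ∧ br L κ (2 * z i + δ) ≠ 0 ∧ br L κ (2 * z i - δ) ≠ 0) ∧
    ∀ i j, i ≠ j → brPM L κ (z i) (z j) ≠ 0

end EllipticBC

end

/-! Fix everything except one variable x of the family z and compare the two sides as functions of
x. Both are even. The right side is elliptic in x because every cross factor is. The left side is
elliptic because the balancing condition on the sum of the a_p makes the multipliers of all summands
trivial. An elliptic function without poles is constant, so the proof shows that the difference of
the two sides has only removable singularities and vanishes at one point.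

The left side could have poles in four places. At 2x in Ω the residue vanishes by evenness and
periodicity (`HasRes.eq_zero_of_even`). At x = (ω_r - δ)/2 the shift by δ is a reflection modulo Ω,
and the residues of the A⁺ and A⁰ terms cancel (`hasRes_splitSum_half_period`). At x = z_j the
residue is a sum of antisymmetric times symmetric terms (`hasRes_splitSum_diagonal`). At x = w_k - δ
and its images there is a true pole, also present on the right. Each residue is an explicit factor
times a splitting sum without x and w_k (`hasRes_splitSum_cross`), so the two residues agree by the
identity for one variable fewer in each family (`hasRes_duality_cross`).

The constant is found at x = a_0. There A⁻ and A⁰ vanish, the latter because c = a_0, and the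
relation a_7 = a_0 + δ cancels the denominator of A⁺. The interactions of x with all other variables
then amount to replacing a_0, a_7 by a_0 + δ, a_7 + δ (`coef_mul_pairF`, `coef_mul_crossF`). What
remains is the identity with x removed (`dualityDiff_param_zero`), so induction on the total number
of variables closes the argument. When the families are equally large, the reduced identity has more
w than z and is read backwards, with the dual parameters.

Residues and evaluation need more nonvanishing than the theorem assumes. The identity is therefore
proved for generic a and w and extended by continuity along a line (`duality_succ`). -/

open Filter Topology

namespace EllipticBC

noncomputable section

section

/-! ### The Weierstrass sigma function -/

/-- The primary factor of the Weierstrass product at the period `l`; it is `1` for `l = 0`. -/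
def primaryFactor (l u : ℂ) : ℂ :=
  (1 - u / l) * Complex.exp (u / l + u ^ 2 / (2 * l ^ 2))

lemma primaryFactor_zero_left (u : ℂ) : primaryFactor 0 u = 1 := by simp [primaryFactor]

lemma primaryFactor_zero_right (l : ℂ) : primaryFactor l 0 = 1 := by simp [primaryFactor]

lemma primaryFactor_neg (l u : ℂ) : primaryFactor l (-u) = primaryFactor (-l) u := by
  simp [primaryFactor, neg_div, div_neg]

lemma differentiable_primaryFactor (l : ℂ) : Differentiable ℂ (primaryFactor l) := by
  unfold primaryFactor
  fun_prop

lemma primaryFactor_ne_zero {l u : ℂ} (h : l = 0 ∨ u ≠ l) : primaryFactor l u ≠ 0 := by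
  rcases eq_or_ne l 0 with rfl | hl
  · simp [primaryFactor_zero_left]
  · have hu : u ≠ l := by tauto
    refine mul_ne_zero ?_ (Complex.exp_ne_zero _)
    rw [sub_ne_zero, ne_comm, ne_eq, div_eq_one_iff_eq hl]
    exact hu

/-- The derivative of (1 - t) exp(t + t²/2) collapses to -t² exp(t + t²/2), so the mean value
inequality gives a bound cubic in t = u/l. This decay makes the Weierstrass product converge over a
lattice of rank two. -/
lemma norm_primaryFactor_sub_one_le {l u : ℂ} (h : ‖u‖ ≤ ‖l‖) :
    ‖primaryFactor l u - 1‖ ≤ Real.exp 2 * ‖u‖ ^ 3 * ‖l‖ ^ (-3 : ℝ) := by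
  rcases eq_or_ne l 0 with rfl | hl
  · simp only [primaryFactor_zero_left, sub_self, norm_zero]
    positivity
  have hl' : 0 < ‖l‖ := norm_pos_iff.mpr hl
  set g : ℂ → ℂ := fun t => (1 - t) * Complex.exp (t + t ^ 2 / 2) with hg
  set t : ℂ := u / l with ht
  have hgt : primaryFactor l u = g t := by
    simp only [primaryFactor, hg, ht]
    congr 2
    field_simp
  have ht1 : ‖t‖ ≤ 1 := by
    rw [ht, norm_div]
    exact div_le_one_of_le₀ h hl'.le
  have hder : ∀ s ∈ Metric.closedBall (0 : ℂ) ‖t‖,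
      HasDerivWithinAt g (-s ^ 2 * Complex.exp (s + s ^ 2 / 2)) (Metric.closedBall 0 ‖t‖) s := by
    intro s _
    have h1 : HasDerivAt (fun s : ℂ => s + s ^ 2 / 2) (1 + s) s := by
      have := (hasDerivAt_id s).add (((hasDerivAt_id s).pow 2).div_const 2)
      convert! this using 1
      simp
    have h2 := ((hasDerivAt_const s (1 : ℂ)).sub (hasDerivAt_id s)).mul h1.cexp
    refine HasDerivAt.hasDerivWithinAt ?_
    convert! h2 using 1
    simp
    ring
  have hbd : ∀ s ∈ Metric.closedBall (0 : ℂ) ‖t‖,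
      ‖-s ^ 2 * Complex.exp (s + s ^ 2 / 2)‖ ≤ ‖t‖ ^ 2 * Real.exp 2 := by
    intro s hs
    have hs' : ‖s‖ ≤ ‖t‖ := by simpa using hs
    rw [norm_mul, norm_neg, norm_pow, Complex.norm_exp]
    gcongr
    -- On the unit disc ‖s + s²/2‖ ≤ 3/2, which is below the exponent 2.
    refine (Complex.re_le_norm _).trans ((norm_add_le _ _).trans ?_)
    rw [norm_div, norm_pow]
    have : ‖s‖ ≤ 1 := hs'.trans ht1
    have h0 := norm_nonneg s
    simp only [Complex.norm_ofNat]
    nlinarith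
  have := (convex_closedBall (0 : ℂ) ‖t‖).norm_image_sub_le_of_norm_hasDerivWithin_le hder hbd
    (Metric.mem_closedBall_self (norm_nonneg t)) (show t ∈ _ by simp)
  have hg0 : g 0 = 1 := by simp [hg]
  rw [hgt, ← hg0]
  refine this.trans (le_of_eq ?_)
  have h3 : ‖l‖ ^ (-3 : ℝ) = (‖l‖ ^ 3)⁻¹ := by
    rw [Real.rpow_neg hl'.le]
    norm_cast
  rw [h3, ht, sub_zero, norm_div]
  field_simp

variable (L : PeriodPair)

/-- The product of the primary factors over all periods, that is, `σ(u) / u`. -/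
def sigmaProd (u : ℂ) : ℂ := ∏' l : L.lattice, primaryFactor l u

/-- The index 0 can be added to the product because division by zero makes its factor 1. The product
then runs over the lattice itself. -/
lemma sigma_eq (u : ℂ) : sigma L u = u * sigmaProd L u := by
  unfold sigma sigmaProd
  congr 1
  let i : {ω : ℂ // ω ∈ L.lattice ∧ ω ≠ 0} → L.lattice := fun ω => ⟨ω.1, ω.2.1⟩
  have hi : Function.Injective i := fun a b h => Subtype.ext (congrArg (fun x : L.lattice => x.1) h)
  refine Function.Injective.tprod_eq (f := fun l : L.lattice => primaryFactor l u) hi ?_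
  intro l hl
  refine ⟨⟨l.1, l.2, ?_⟩, rfl⟩
  intro h0
  exact hl (by simp [h0, primaryFactor_zero_left])

lemma summable_norm_lattice : Summable fun l : L.lattice => ‖(l : ℂ)‖ ^ (-3 : ℝ) :=
  ZLattice.summable_norm_rpow _ _ (by simp; norm_num)

lemma eventually_le_norm_lattice (r : ℝ) : ∀ᶠ l : L.lattice in cofinite, r ≤ ‖(l : ℂ)‖ := by
  have : {l : L.lattice | ¬ r ≤ ‖(l : ℂ)‖} ⊆ Metric.closedBall (0 : L.lattice) r := by
    intro l hl
    simp only [Set.mem_ofPred_eq, not_le] at hl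
    simpa using hl.le
  exact (isCompact_iff_finite.mp (isCompact_closedBall (0 : L.lattice) r)).subset this

lemma multipliableLocallyUniformlyOn_primaryFactor (r : ℝ) :
    MultipliableLocallyUniformlyOn (fun (l : L.lattice) u => primaryFactor l u)
      (Metric.ball 0 r) := by
  have := Summable.multipliableLocallyUniformlyOn_one_add
    (f := fun (l : L.lattice) u => primaryFactor l u - 1) (K := Metric.ball (0 : ℂ) r)
    (u := fun l : L.lattice => Real.exp 2 * r ^ 3 * ‖(l : ℂ)‖ ^ (-3 : ℝ))
    Metric.isOpen_ball ((summable_norm_lattice L).mul_left _) ?_ ?_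
  · simpa using this
  · filter_upwards [eventually_le_norm_lattice L r] with l hl u hu
    have hu' : ‖u‖ < r := by simpa using hu
    refine (norm_primaryFactor_sub_one_le (hu'.le.trans hl)).trans ?_
    gcongr
  · intro l
    exact ((differentiable_primaryFactor l).continuous.sub continuous_const).continuousOn

lemma differentiable_sigmaProd : Differentiable ℂ (sigmaProd L) := by
  intro u
  have hmem : u ∈ Metric.ball (0 : ℂ) (‖u‖ + 1) := by simp
  have h := (multipliableLocallyUniformlyOn_primaryFactor L (‖u‖ + 1)).hasProdLocallyUniformlyOn
  refine (h.differentiableOn (.of_forall fun s => ?_) Metric.isOpen_ball).differentiableAt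
    (Metric.isOpen_ball.mem_nhds hmem)
  exact .fun_finsetProd fun i _ => (differentiable_primaryFactor _).differentiableOn

lemma sigmaProd_zero : sigmaProd L 0 = 1 := by simp [sigmaProd, primaryFactor_zero_right]

lemma sigmaProd_neg (u : ℂ) : sigmaProd L (-u) = sigmaProd L u := by
  unfold sigmaProd
  rw [← (Equiv.neg L.lattice).tprod_eq]
  simp [primaryFactor_neg]

lemma summable_norm_primaryFactor_sub_one (u : ℂ) :
    Summable fun l : L.lattice => ‖primaryFactor l u - 1‖ := by
  refine Summable.of_norm_bounded_eventually
    (g := fun l : L.lattice => Real.exp 2 * ‖u‖ ^ 3 * ‖(l : ℂ)‖ ^ (-3 : ℝ))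
    ((summable_norm_lattice L).mul_left _) ?_
  filter_upwards [eventually_le_norm_lattice L ‖u‖] with l hl
  simpa using norm_primaryFactor_sub_one_le hl

lemma sigmaProd_ne_zero {u : ℂ} (h : u = 0 ∨ u ∉ L.lattice) : sigmaProd L u ≠ 0 := by
  have := tprod_one_add_ne_zero_of_summable
    (f := fun l : L.lattice => primaryFactor l u - 1) ?_
    (summable_norm_primaryFactor_sub_one L u)
  · simpa [sigmaProd] using this
  · intro l
    rw [add_sub_cancel]
    apply primaryFactor_ne_zero
    rcases h with rfl | h
    · exact (eq_or_ne (l : ℂ) 0).imp_right Ne.symm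
    · exact Or.inr fun hl => h (hl ▸ l.2)

lemma sigmaProd_eq_zero {u : ℂ} (hu : u ∈ L.lattice) (h0 : u ≠ 0) : sigmaProd L u = 0 := by
  refine tprod_of_exists_eq_zero ⟨⟨u, hu⟩, ?_⟩
  simp [primaryFactor, h0]

lemma differentiable_sigma : Differentiable ℂ (sigma L) := by
  have : sigma L = fun u => u * sigmaProd L u := funext (sigma_eq L)
  rw [this]
  exact differentiable_id.mul (differentiable_sigmaProd L)

lemma sigma_neg (u : ℂ) : sigma L (-u) = -sigma L u := by
  simp [sigma_eq, sigmaProd_neg]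

lemma sigma_eq_zero_iff {u : ℂ} : sigma L u = 0 ↔ u ∈ L.lattice := by
  rw [sigma_eq, mul_eq_zero]
  constructor
  · rintro (rfl | h)
    · exact zero_mem _
    · by_contra hu
      exact sigmaProd_ne_zero L (Or.inr hu) h
  · intro hu
    rcases eq_or_ne u 0 with rfl | h0
    · exact Or.inl rfl
    · exact Or.inr (sigmaProd_eq_zero L hu h0)

/-! ### The logarithmic derivative of σ, and quasi-periodicity -/

/-- The logarithmic derivative of the primary factor. -/
def primaryZeta (l u : ℂ) : ℂ := u ^ 2 / (l ^ 2 * (u - l))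

lemma logDeriv_primaryFactor {l u : ℂ} (h : l = 0 ∨ u ≠ l) :
    logDeriv (primaryFactor l) u = primaryZeta l u := by
  rcases eq_or_ne l 0 with rfl | hl
  · have : primaryFactor 0 = fun _ => 1 := funext primaryFactor_zero_left
    simp [this, primaryZeta]
  have hu : u - l ≠ 0 := sub_ne_zero.mpr (by tauto)
  have h1 : HasDerivAt (fun u : ℂ => u / l + u ^ 2 / (2 * l ^ 2)) (1 / l + u / l ^ 2) u := by
    have := ((hasDerivAt_id u).div_const l).add (((hasDerivAt_id u).pow 2).div_const (2 * l ^ 2))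
    convert! this using 1
    simp
    field_simp
  have h2 : HasDerivAt (fun u : ℂ => 1 - u / l) (-(1 / l)) u := by
    simpa using ((hasDerivAt_id u).div_const l).const_sub 1
  have h3 := (h2.mul h1.cexp).deriv
  have h4 : (fun u : ℂ => 1 - u / l) * (fun u => Complex.exp (u / l + u ^ 2 / (2 * l ^ 2))) =
    primaryFactor l := rfl
  rw [h4] at h3
  rw [logDeriv_apply, h3, primaryFactor, primaryZeta]
  have hE := Complex.exp_ne_zero (u / l + u ^ 2 / (2 * l ^ 2))
  have hu' : l - u ≠ 0 := by rw [← neg_sub]; exact neg_ne_zero.mpr hu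
  rw [div_eq_div_iff]
  · field_simp
    ring
  · refine mul_ne_zero ?_ hE
    rw [one_sub_div hl]
    exact div_ne_zero hu' hl
  · positivity

lemma norm_primaryZeta_le {r : ℝ} (hr : 0 < r) {l u : ℂ} (hu : ‖u‖ < r) (hl : 2 * r ≤ ‖l‖) :
    ‖primaryZeta l u‖ ≤ 2 * r ^ 2 * ‖l‖ ^ (-3 : ℝ) := by
  have hl' : 0 < ‖l‖ := by linarith
  have h3 : ‖l‖ ^ (-3 : ℝ) = (‖l‖ ^ 3)⁻¹ := by
    rw [Real.rpow_neg hl'.le]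
    norm_cast
  have h4 : ‖l‖ / 2 ≤ ‖u - l‖ := by
    rw [norm_sub_rev]
    exact .trans (by linarith) (norm_sub_norm_le l u)
  rw [primaryZeta, norm_div, norm_mul, norm_pow, norm_pow, h3]
  calc ‖u‖ ^ 2 / (‖l‖ ^ 2 * ‖u - l‖) ≤ r ^ 2 / (‖l‖ ^ 2 * (‖l‖ / 2)) := by gcongr
    _ = _ := by field_simp

lemma hasSumLocallyUniformly_primaryZeta :
    HasSumLocallyUniformly (fun (l : L.lattice) u => primaryZeta l u)
      (fun u => ∑' l : L.lattice, primaryZeta l u) := by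
  refine L.hasSumLocallyUniformly_aux (u := fun r l => 2 * r ^ 2 * ‖(l : ℂ)‖ ^ (-3 : ℝ)) _
    (fun _ _ => (summable_norm_lattice L).mul_left _) fun r hr =>
    Filter.eventually_atTop.mpr ⟨2 * r, ?_⟩
  rintro _ h s hs l rfl
  exact norm_primaryZeta_le hr hs h

lemma hasDerivAt_primaryZeta {l u : ℂ} (hu : u ≠ l) :
    HasDerivAt (primaryZeta l) (-(if l = 0 then 0 else (1 / (u - l) ^ 2 - 1 / l ^ 2))) u := by
  split_ifs with hl
  · subst hl
    have : primaryZeta 0 = fun _ => 0 := by ext; simp [primaryZeta]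
    rw [this]
    simpa using hasDerivAt_const u (0 : ℂ)
  have hu' : u - l ≠ 0 := sub_ne_zero.mpr hu
  have h1 := ((hasDerivAt_id u).pow 2).div (((hasDerivAt_id u).sub_const l).const_mul (l ^ 2))
    (mul_ne_zero (pow_ne_zero 2 hl) hu')
  convert! h1 using 1
  simp
  field_simp
  ring

-- Termwise differentiation is allowed off the lattice by locally uniform convergence. The term 1/u²
-- missing from -℘ comes from the factor u of σ.
open PeriodPair in
lemma hasDerivAt_tsum_primaryZeta {u : ℂ} (hu : u ∉ L.lattice) :
    HasDerivAt (fun u => ∑' l : L.lattice, primaryZeta l u)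
      (-weierstrassPExcept L 0 u) u := by
  have hdiff : ∀ (l : L.lattice) (v : ℂ), v ∈ (L.lattice : Set ℂ)ᶜ → HasDerivAt (primaryZeta l)
      (-(if (l : ℂ) = 0 then 0 else (1 / (v - l) ^ 2 - 1 / (l : ℂ) ^ 2))) v := by
    intro l v hv
    exact hasDerivAt_primaryZeta fun h => hv (h ▸ l.2)
  have hopen := L.isClosed_lattice.isOpen_compl
  have hsum := ((hasSumLocallyUniformly_primaryZeta L).tendstoLocallyUniformlyOn
    (s := (L.lattice : Set ℂ)ᶜ))
  have hdo : ∀ s : Finset L.lattice, DifferentiableOn ℂ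
      (fun u => ∑ l ∈ s, primaryZeta l u) (L.lattice : Set ℂ)ᶜ := fun s =>
    .fun_sum fun l _ v hv => (hdiff l v hv).differentiableAt.differentiableWithinAt
  have h1 := (hsum.differentiableOn (.of_forall hdo) hopen).differentiableAt (hopen.mem_nhds hu)
  convert! h1.hasDerivAt using 1
  have h2 := (hsum.deriv (.of_forall hdo) hopen).tendsto_at hu
  have h3 : Tendsto (fun s : Finset L.lattice => ∑ l ∈ s, (-(if (l : ℂ) = 0 then 0 else
      (1 / (u - l) ^ 2 - 1 / (l : ℂ) ^ 2)))) atTop (𝓝 (-weierstrassPExcept L 0 u)) :=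
    (L.hasSum_weierstrassPExcept 0 u).neg
  refine tendsto_nhds_unique h3 (h2.congr fun s => ?_)
  simp only [Function.comp_apply]
  rw [deriv_fun_sum fun l _ => (hdiff l u hu).differentiableAt]
  exact Finset.sum_congr rfl fun l _ => (hdiff l u hu).deriv

lemma logDeriv_sigma {u : ℂ} (hu : u ∉ L.lattice) :
    logDeriv (sigma L) u = 1 / u + ∑' l : L.lattice, primaryZeta l u := by
  have hu0 : u ≠ 0 := by
    rintro rfl
    exact hu (zero_mem _)
  have hfun : sigma L = fun u => id u * sigmaProd L u := funext (sigma_eq L)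
  have hne : ∀ l : L.lattice, (l : ℂ) = 0 ∨ u ≠ l := fun l => Or.inr fun h => hu (h ▸ l.2)
  rw [hfun, logDeriv_mul u (by simpa) (sigmaProd_ne_zero L (Or.inr hu)) differentiableAt_id
    (differentiable_sigmaProd L u), logDeriv_id]
  congr 1
  have hmem : u ∈ Metric.ball (0 : ℂ) (‖u‖ + 1) := by simp
  have hsm : Summable fun l : L.lattice => primaryZeta l u :=
    ((hasSumLocallyUniformly_primaryZeta L).hasSum (x := u)).summable
  have := logDeriv_tprod_eq_tsum Metric.isOpen_ball hmem
    (f := fun (l : L.lattice) u => primaryFactor l u)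
    (fun l => primaryFactor_ne_zero (hne l))
    (fun l => (differentiable_primaryFactor l).differentiableOn)
    (hsm.congr fun l => (logDeriv_primaryFactor (hne l)).symm)
    (multipliableLocallyUniformlyOn_primaryFactor L _)
    (sigmaProd_ne_zero L (Or.inr hu))
  refine this.trans (tsum_congr fun l => logDeriv_primaryFactor (hne l))

-- This is ζ' = -℘, the link through which the known periodicity of ℘ reaches σ.
open PeriodPair in
lemma hasDerivAt_logDeriv_sigma {u : ℂ} (hu : u ∉ L.lattice) :
    HasDerivAt (logDeriv (sigma L)) (-weierstrassP L u) u := by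
  have hu0 : u ≠ 0 := by
    rintro rfl
    exact hu (zero_mem _)
  have h1 : HasDerivAt (fun u : ℂ => 1 / u + ∑' l : L.lattice, primaryZeta l u)
      (-weierstrassP L u) u := by
    have := (hasDerivAt_inv hu0).add (hasDerivAt_tsum_primaryZeta L hu)
    rw [← L.weierstrassPExcept_add 0 u]
    convert! this using 1
    · ext; simp
    · simp
  refine h1.congr_of_eventuallyEq ?_
  filter_upwards [L.isClosed_lattice.isOpen_compl.mem_nhds hu] with v hv
  exact logDeriv_sigma L hv

lemma add_mem_lattice_iff {u l : ℂ} (hl : l ∈ L.lattice) : u + l ∈ L.lattice ↔ u ∈ L.lattice :=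
  Submodule.add_mem_iff_left _ hl

lemma isPreconnected_compl_lattice : IsPreconnected (L.lattice : Set ℂ)ᶜ :=
  (Set.Countable.isConnected_compl_of_one_lt_rank (by simp)
    (countable_of_Lindelof_of_discrete (X := L.lattice))).isPreconnected

lemma dense_compl_lattice : Dense (L.lattice : Set ℂ)ᶜ :=
  Set.Countable.dense_compl ℝ (countable_of_Lindelof_of_discrete (X := L.lattice))

/-- The sigma function is quasi-periodic. -/
lemma exists_sigma_add {l : ℂ} (hl : l ∈ L.lattice) :
    ∃ c C : ℂ, ∀ u, sigma L (u + l) = C * Complex.exp (c * u) * sigma L u := by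
  have hopen := L.isClosed_lattice.isOpen_compl
  have hshift : ∀ u ∈ (L.lattice : Set ℂ)ᶜ, u + l ∉ L.lattice := fun u hu =>
    (add_mem_lattice_iff L hl).not.mpr hu
  -- Since ℘ is periodic, ζ(u + l) - ζ(u) has zero derivative. The complement of the lattice is
  -- connected, so the difference is a constant c.
  have hZ : ∀ u ∈ (L.lattice : Set ℂ)ᶜ,
      HasDerivAt (fun u => logDeriv (sigma L) (u + l) - logDeriv (sigma L) u) 0 u := by
    intro u hu
    have h1 := (hasDerivAt_logDeriv_sigma L (hshift u hu)).comp_add_const u l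
    have h2 := h1.sub (hasDerivAt_logDeriv_sigma L hu)
    convert! h2 using 1
    have := L.weierstrassP_add_coe u ⟨l, hl⟩
    simp only at this
    rw [this]
    ring
  obtain ⟨c, hc⟩ := hopen.exists_is_const_of_deriv_eq_zero (isPreconnected_compl_lattice L)
    (fun u hu => (hZ u hu).differentiableAt.differentiableWithinAt)
    (fun u hu => (hZ u hu).deriv)
  -- Second integration: the logarithmic derivative of σ(u + l)/σ(u) is c, so dividing by exp(cu)
  -- leaves a constant C.
  have hW : ∀ u ∈ (L.lattice : Set ℂ)ᶜ,
      HasDerivAt (fun u => sigma L (u + l) / sigma L u * Complex.exp (-c * u)) 0 u := by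
    intro u hu
    have hs0 : sigma L u ≠ 0 := (sigma_eq_zero_iff L).not.mpr hu
    have hs1 : sigma L (u + l) ≠ 0 := (sigma_eq_zero_iff L).not.mpr (hshift u hu)
    have h1 := (differentiable_sigma L (u + l)).hasDerivAt.comp_add_const u l
    have h2 := (differentiable_sigma L u).hasDerivAt
    have h3 := ((hasDerivAt_id u).const_mul (-c)).cexp
    convert! (h1.div h2 hs0).mul h3 using 1
    have h4 := hc u hu
    simp only [logDeriv_apply] at h4
    have h5 : deriv (sigma L) (u + l) =
        (c + deriv (sigma L) u / sigma L u) * sigma L (u + l) := by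
      rw [← h4]
      field_simp
      ring
    rw [h5]
    simp
    field_simp
    ring
  obtain ⟨C, hC⟩ := hopen.exists_is_const_of_deriv_eq_zero (isPreconnected_compl_lattice L)
    (fun u hu => (hW u hu).differentiableAt.differentiableWithinAt)
    (fun u hu => (hW u hu).deriv)
  refine ⟨c, C, fun u => ?_⟩
  have hcont := (differentiable_sigma L).continuous
  refine congrFun (Continuous.ext_on (dense_compl_lattice L)
    (f := fun u => sigma L (u + l)) (g := fun u => C * Complex.exp (c * u) * sigma L u)
    (by fun_prop) (by fun_prop) ?_) u
  intro v hv
  have hs0 : sigma L v ≠ 0 := (sigma_eq_zero_iff L).not.mpr hv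
  simp only
  rw [← hC v hv, mul_assoc (_ / _), ← Complex.exp_add]
  simp
  field_simp

/-! ### The function `br` -/

lemma e_add (u v : ℂ) : e (u + v) = e u * e v := by
  simp [e, mul_add, Complex.exp_add]

lemma e_zero : e 0 = 1 := by simp [e]

lemma e_ne_zero (u : ℂ) : e u ≠ 0 := Complex.exp_ne_zero _

lemma e_neg (u : ℂ) : e (-u) = (e u)⁻¹ := by
  simp [e, Complex.exp_neg]

lemma differentiable_e : Differentiable ℂ e := by
  unfold e
  fun_prop

variable (κ : ℂ)

lemma differentiable_br : Differentiable ℂ (br L κ) := by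
  have h1 := differentiable_sigma L
  have h2 := differentiable_e
  unfold br
  fun_prop

lemma continuous_br : Continuous (br L κ) := (differentiable_br L κ).continuous

lemma br_neg (u : ℂ) : br L κ (-u) = -br L κ u := by
  simp [br, sigma_neg]

lemma br_eq_zero_iff {u : ℂ} : br L κ u = 0 ↔ u ∈ L.lattice := by
  simp [br, e_ne_zero, sigma_eq_zero_iff]

lemma br_zero : br L κ 0 = 0 := (br_eq_zero_iff L κ).mpr (zero_mem _)

lemma br_sub_comm (u v : ℂ) : br L κ (u - v) = -br L κ (v - u) := by
  rw [← br_neg, neg_sub]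

lemma tendsto_br_div_zero : Tendsto (fun t => br L κ t / t) (𝓝[≠] 0) (𝓝 1) := by
  have h : Tendsto (fun t => e (κ * t ^ 2) * sigmaProd L t) (𝓝[≠] 0) (𝓝 1) := by
    have hc : Continuous fun t => e (κ * t ^ 2) * sigmaProd L t := by
      have h1 := (differentiable_sigmaProd L).continuous
      have h2 := differentiable_e.continuous
      fun_prop
    have := (hc.tendsto 0).mono_left (nhdsWithin_le_nhds (s := {0}ᶜ))
    simpa [e_zero, sigmaProd_zero] using this
  refine h.congr' ?_
  filter_upwards [self_mem_nhdsWithin] with t ht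
  have ht : t ≠ 0 := ht
  rw [br, sigma_eq]
  field_simp

lemma exists_br_add {l : ℂ} (hl : l ∈ L.lattice) :
    ∃ η C : ℂ, ∀ u, br L κ (u + l) = C * e (η * (u + l / 2)) * br L κ u := by
  obtain ⟨c, C, h⟩ := exists_sigma_add L hl
  -- The summand 2κl comes from expanding κ(u + l)²; the other rewrites exp(cu) in terms of `e`. The
  -- constant below recentres the exponent at u + l/2.
  set η : ℂ := 2 * κ * l + c / (2 * Real.pi * Complex.I) with hη
  refine ⟨η, C * e (κ * l ^ 2 - η * (l / 2)), fun u => ?_⟩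
  have hpi : (2 * Real.pi * Complex.I : ℂ) ≠ 0 := Complex.two_pi_I_ne_zero
  have h1 : Complex.exp (c * u) = e (c / (2 * Real.pi * Complex.I) * u) := by
    unfold e
    congr 1
    field_simp
  have h2 : e (κ * (u + l) ^ 2) * e (c / (2 * Real.pi * Complex.I) * u) =
      e (κ * l ^ 2 - η * (l / 2)) * e (η * (u + l / 2)) * e (κ * u ^ 2) := by
    rw [← e_add, ← e_add, ← e_add, hη]
    congr 1
    ring
  rw [br, br, h, h1]
  linear_combination C * sigma L u * h2

lemma signChar_sq (ω : ℂ) : signChar L ω * signChar L ω = 1 := by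
  unfold signChar
  split_ifs <;> norm_num

lemma signChar_ne_zero (ω : ℂ) : signChar L ω ≠ 0 := by
  intro h
  simpa [h] using signChar_sq L ω

/-- Oddness of [u] determines the multiplicative constant left open by `exists_br_add`. -/
lemma exists_quasiPeriod {ω : ℂ} (hω : ω ∈ L.lattice) :
    ∃ η : ℂ, ∀ u, br L κ (u + ω) = signChar L ω * e (η * (u + ω / 2)) * br L κ u := by
  by_cases h : ∃ l ∈ L.lattice, ω = 2 * l
  · obtain ⟨l, hl, rfl⟩ := h
    obtain ⟨η, C, hC⟩ := exists_br_add L κ hl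
    -- For ω = 2l, translate by l twice. Applying the relation for l at u - l and at -u and using
    -- oddness gives C² = 1.
    have hsq : C * C = 1 := by
      obtain ⟨u, hu⟩ := (dense_compl_lattice L).nonempty
      have hb : br L κ u ≠ 0 := (br_eq_zero_iff L κ).not.mpr hu
      have h1 := hC (u - l)
      have h2 := hC (-u)
      have h3 : br L κ (-u + l) = -br L κ (u - l) := by rw [← br_neg]; congr 1; ring
      rw [h3, br_neg] at h2
      rw [sub_add_cancel] at h1
      have h5 : e (η * (u - l + l / 2)) * e (η * (-u + l / 2)) = 1 := by
        rw [← e_add, ← e_zero]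
        congr 1
        ring
      refine mul_right_cancel₀ hb ?_
      linear_combination -h1 + C * e (η * (u - l + l / 2)) * h2 - C * C * br L κ u * h5
    refine ⟨2 * η, fun u => ?_⟩
    have h1 : signChar L (2 * l) = 1 := if_pos ⟨l, hl, rfl⟩
    have h2 : e (η * (u + l + l / 2)) * e (η * (u + l / 2)) = e (2 * η * (u + 2 * l / 2)) := by
      rw [← e_add]
      congr 1
      ring
    rw [h1, two_mul l, ← add_assoc, hC, hC, ← two_mul l]
    linear_combination C * C * br L κ u * h2 + e (2 * η * (u + 2 * l / 2)) * br L κ u * hsq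
  · obtain ⟨η, C, hC⟩ := exists_br_add L κ hω
    refine ⟨η, fun u => ?_⟩
    have h1 : signChar L ω = -1 := if_neg h
    have hb : br L κ (ω / 2) ≠ 0 := by
      rw [ne_eq, br_eq_zero_iff]
      exact fun hm => h ⟨ω / 2, hm, by ring⟩
    -- At u = -ω/2 the exponential is 1, so oddness gives [ω/2] = -C[ω/2], and [ω/2] ≠ 0 because ω/2
    -- is not a period.
    have h2 := hC (-(ω / 2))
    have h3 : -(ω / 2) + ω = ω / 2 := by ring
    rw [h3, neg_add_cancel, mul_zero, e_zero, br_neg] at h2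
    have hCm : C = -1 := by
      refine mul_right_cancel₀ hb ?_
      linear_combination h2
    rw [h1, hC u, hCm]

/-- As `quasiPeriod` is a choice, existence of a suitable η is all that is needed. -/
lemma br_add_period {ω : ℂ} (hω : ω ∈ L.lattice) (u : ℂ) :
    br L κ (u + ω) =
      signChar L ω * e (quasiPeriod L κ ω * (u + ω / 2)) * br L κ u :=
  Classical.epsilon_spec (exists_quasiPeriod L κ hω) u

/-! ### Elliptic functions without poles -/

/-- A meromorphic function without poles that has the periods `L` is constant, up to its values
at the points where it is not continuous. -/
lemma exists_const_of_elliptic {f : ℂ → ℂ} (hf : Meromorphic f)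
    (hper : ∀ ω ∈ L.lattice, ∀ x, f (x + ω) = f x)
    (hres : ∀ x₀, Tendsto (fun x => (x - x₀) * f x) (𝓝[≠] x₀) (𝓝 0)) :
    ∃ c, ∀ x, ContinuousAt f x → f x = c := by
  have hfU : MeromorphicOn f Set.univ := fun x _ => hf x
  set g := toMeromorphicNFOn f Set.univ with hg
  have hgf : ∀ x, f =ᶠ[𝓝[≠] x] g := fun x =>
    (hfU.toMeromorphicNFOn_eq_self_on_nhdsNE (by trivial)).symm
  have hgan : ∀ x, AnalyticAt ℂ g x := by
    intro x₀
    have hNF : MeromorphicNFAt g x₀ := meromorphicNFOn_toMeromorphicNFOn f Set.univ (by trivial)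
    -- A function in normal form is analytic where its order is nonnegative. The limit `hres` says
    -- that (x - x₀)f has positive order, so f has order at least 0.
    rw [← hNF.meromorphicOrderAt_nonneg_iff_analyticAt, ← meromorphicOrderAt_congr (hgf x₀)]
    have hid : MeromorphicAt (fun x : ℂ => x - x₀) x₀ := by fun_prop
    have hpos := (tendsto_zero_iff_meromorphicOrderAt_pos (hid.mul (hf x₀))).mp (hres x₀)
    rw [meromorphicOrderAt_mul hid (hf x₀)] at hpos
    have h1 : meromorphicOrderAt (fun x : ℂ => x - x₀) x₀ = 1 := meromorphicOrderAt_id_sub_const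
    rw [h1] at hpos
    cases h : meromorphicOrderAt f x₀ with
    | top => exact le_top
    | coe n =>
      rw [h] at hpos
      have : (0 : ℤ) < 1 + n := by exact_mod_cast hpos
      have h' : (0 : ℤ) ≤ n := by linarith
      exact_mod_cast h'
  have hgd : Differentiable ℂ g := fun x => (hgan x).differentiableAt
  have hgper : ∀ z w, w ∈ L.lattice → g (z + w) = g z := by
    intro z w hw
    have h1 : Tendsto (fun x => g (x + w)) (𝓝[≠] z) (𝓝 (g (z + w))) :=
      ((hgd.continuous.comp (continuous_add_const w)).tendsto z).mono_left nhdsWithin_le_nhds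
    have h2 : Tendsto g (𝓝[≠] z) (𝓝 (g z)) := (hgd.continuous.tendsto z).mono_left
      nhdsWithin_le_nhds
    refine tendsto_nhds_unique h1 (h2.congr' ?_)
    have hmap : Tendsto (fun x => x + w) (𝓝[≠] z) (𝓝[≠] (z + w)) :=
      tendsto_nhdsWithin_of_tendsto_nhds_of_eventually_within _
        (((continuous_add_const w).tendsto z).mono_left nhdsWithin_le_nhds)
        (by filter_upwards [self_mem_nhdsWithin] with x hx; simpa using hx)
    filter_upwards [hgf z, hmap.eventually (hgf (z + w))] with x hx hx'
    rw [← hx, ← hx', hper w hw]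
  -- A continuous periodic function has compact range, so Liouville's theorem applies to g.
  have hb := (IsZLattice.isCompact_range_of_periodic L.lattice g hgd.continuous hgper).isBounded
  refine ⟨g 0, fun x hx => ?_⟩
  rw [← hgd.apply_eq_apply_of_bounded hb x 0]
  have h1 : Tendsto f (𝓝[≠] x) (𝓝 (f x)) := hx.tendsto.mono_left nhdsWithin_le_nhds
  have h2 : Tendsto g (𝓝[≠] x) (𝓝 (g x)) := (hgd.continuous.tendsto x).mono_left
    nhdsWithin_le_nhds
  exact tendsto_nhds_unique (h1.congr' (hgf x)) h2

end

section

/-! ### Splitting sums as pairwise weighted sums over sign vectors -/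

section Definitions

variable (L : PeriodPair) (κ δ : ℂ)

/-- The single-variable coefficient attached to a sign. -/
def coef (a : Fin 8 → ℂ) (c : ℂ) : SignType → ℂ → ℂ
  | .pos, x => Aplus L κ δ a x
  | .zero, x => Azero L κ δ a (fun _ => c) x
  | .neg, x => Aminus L κ δ a x

/-- The interaction of two variables of the same family, with given signs. -/
def pairF : SignType → SignType → ℂ → ℂ → ℂ
  | .pos, .pos, x, y => br L κ (x + y + 2 * δ) / br L κ (x + y)
  | .pos, .neg, x, y => br L κ (x - y + 2 * δ) / br L κ (x - y)
  | .neg, .pos, x, y => br L κ (y - x + 2 * δ) / br L κ (y - x)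
  | .neg, .neg, x, y => br L κ (x + y - 2 * δ) / br L κ (x + y)
  | .pos, .zero, x, y => brPM L κ (x + δ) y / brPM L κ x y
  | .neg, .zero, x, y => brPM L κ (x - δ) y / brPM L κ x y
  | .zero, .pos, x, y => brPM L κ (y + δ) x / brPM L κ y x
  | .zero, .neg, x, y => brPM L κ (y - δ) x / brPM L κ y x
  | .zero, .zero, _, _ => 1

/-- The interaction of two variables of different families. -/
def crossF : SignType → ℂ → ℂ → ℂ
  | .pos, x, w => brPM L κ x w / brPM L κ (x + δ) w
  | .neg, x, w => brPM L κ x w / brPM L κ (x - δ) w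
  | .zero, _, _ => 1

/-- The sum over sign vectors of single-variable weights `A` times pairwise interactions. -/
def pairSum {m : ℕ} (z : Fin m → ℂ) (A : Fin m → SignType → ℂ) : ℂ :=
  ∑ s : Fin m → SignType, (∏ i, A i (s i)) *
    ∏ i, ∏ j ∈ Finset.Ioi i, pairF L κ δ (s i) (s j) (z i) (z j)

/-- The single-variable weight: the coefficient and the interactions with the other family. -/
def weight (a : Fin 8 → ℂ) (c : ℂ) {n : ℕ} (w : Fin n → ℂ) (x : ℂ) (t : SignType) : ℂ :=
  coef L κ δ a c t x * ∏ k, crossF L κ δ t x (w k)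

end Definitions

section Combinatorics

/-- Converts products over I₊ × I₋, I₊ × I₀ and I₋ × I₀ to products over i < j, collecting both
orders of each pair. -/
lemma prod_prod_eq_prod_Ioi {m : ℕ} (h : Fin m → Fin m → ℂ) (h1 : ∀ i, h i i = 1) :
    ∏ i, ∏ j, h i j = ∏ i, ∏ j ∈ Finset.Ioi i, h i j * h j i := by
  have := Finset.prod_prod_Ioi_mul_eq_prod_prod_off_diag (fun i j => h j i)
  rw [this]
  refine Finset.prod_congr rfl fun i _ => ?_
  rw [← Finset.prod_compl_mul_prod {i}]
  simp [h1]

lemma prod_prod_Ioi_comp_perm {m : ℕ} (σ : Equiv.Perm (Fin m)) (F : Fin m → Fin m → ℂ)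
    (hF : ∀ i j, F i j = F j i) :
    ∏ i, ∏ j ∈ Finset.Ioi i, F (σ i) (σ j) = ∏ i, ∏ j ∈ Finset.Ioi i, F i j := by
  have key : ∀ G : Fin m → Fin m → ℂ, ∏ i, ∏ j ∈ Finset.Ioi i, G i j =
      ∏ p : Fin m × Fin m with p.1 < p.2, G p.1 p.2 := by
    intro G
    rw [Finset.prod_filter, ← Finset.univ_product_univ, Finset.prod_product]
    refine Finset.prod_congr rfl fun i _ => ?_
    rw [← Finset.prod_filter]
    congr 1
    ext j
    simp
  rw [key, key]
  -- The bijection on pairs i < j applies σ and sorts the result; symmetry of F makes the sorting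
  -- harmless.
  refine Finset.prod_nbij' (fun p => if σ p.1 < σ p.2 then (σ p.1, σ p.2) else (σ p.2, σ p.1))
    (fun p => if σ.symm p.1 < σ.symm p.2 then (σ.symm p.1, σ.symm p.2)
      else (σ.symm p.2, σ.symm p.1)) ?_ ?_ ?_ ?_ ?_
  · rintro ⟨i, j⟩ h
    have hne : σ i ≠ σ j := σ.injective.ne (by simpa using (by simpa using h : i < j).ne)
    by_cases hlt : σ i < σ j
    · simp [hlt]
    · simpa [hlt] using lt_of_le_of_ne (not_lt.mp hlt) hne.symm
  · rintro ⟨i, j⟩ h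
    have hne : σ.symm i ≠ σ.symm j :=
      σ.symm.injective.ne (by simpa using (by simpa using h : i < j).ne)
    by_cases hlt : σ.symm i < σ.symm j
    · simp [hlt]
    · simpa [hlt] using lt_of_le_of_ne (not_lt.mp hlt) hne.symm
  · rintro ⟨i, j⟩ h
    have h : i < j := by simpa using h
    by_cases hlt : σ i < σ j <;> simp [hlt, h, h.not_gt]
  · rintro ⟨i, j⟩ h
    have h : i < j := by simpa using h
    by_cases hlt : σ.symm i < σ.symm j <;> simp [hlt, h, h.not_gt]
  · rintro ⟨i, j⟩ h
    by_cases hlt : σ i < σ j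
    · simp [hlt]
    · simpa [hlt] using hF _ _

end Combinatorics

variable (L : PeriodPair) (κ δ : ℂ)

lemma pairF_comm (s t : SignType) (x y : ℂ) :
    pairF L κ δ s t x y = pairF L κ δ t s y x := by
  cases s <;> cases t <;> simp [pairF, add_comm x y]

/-- Membership in I₊, I₀, I₋ becomes a case distinction on signs. The sum is then a partition
function with one-variable weights and symmetric pair interactions, so later arguments concern one
variable or one pair at a time. -/
lemma splitTerm_eq (a : Fin 8 → ℂ) (c : ℂ) {m n : ℕ} (z : Fin m → ℂ) (w : Fin n → ℂ)
    (s : Fin m → SignType) :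
    splitTerm L κ δ a (fun _ => c) z w
      (Finset.univ.filter fun i => s i = 1)
      (Finset.univ.filter fun i => s i = 0)
      (Finset.univ.filter fun i => s i = -1) =
    (∏ i, weight L κ δ a c w (z i) (s i)) *
      ∏ i, ∏ j ∈ Finset.Ioi i, pairF L κ δ (s i) (s j) (z i) (z j) := by
  have hsplit : ∀ (q : SignType) (F : Fin m → ℂ),
      ∏ i ∈ Finset.univ.filter (fun i => s i = q), F i = ∏ i, if s i = q then F i else 1 :=
    fun q F => Finset.prod_filter _ _
  have hlt : ∀ (q : SignType) (F : Fin m → Fin m → ℂ),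
      ∏ i ∈ Finset.univ.filter (fun i => s i = q),
        ∏ j ∈ (Finset.univ.filter (fun i => s i = q)).filter (fun j => i < j), F i j =
      ∏ i, ∏ j ∈ Finset.Ioi i, if s i = q ∧ s j = q then F i j else 1 := by
    intro q F
    rw [hsplit]
    refine Finset.prod_congr rfl fun i _ => ?_
    split_ifs with h
    · simp only [h, true_and]
      rw [← Finset.prod_filter]
      refine Finset.prod_congr ?_ fun _ _ => rfl
      ext j
      simp [and_comm]
    · simp [h]
  have hall : ∀ (q r : SignType) (F : Fin m → Fin m → ℂ), q ≠ r →
      ∏ i ∈ Finset.univ.filter (fun i => s i = q),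
        ∏ j ∈ Finset.univ.filter (fun i => s i = r), F i j =
      ∏ i, ∏ j ∈ Finset.Ioi i, (if s i = q ∧ s j = r then F i j else 1) *
        (if s j = q ∧ s i = r then F j i else 1) := by
    intro q r F hqr
    rw [hsplit, ← prod_prod_eq_prod_Ioi (fun i j => if s i = q ∧ s j = r then F i j else 1)
      (fun i => if_neg fun h => hqr (h.1.symm.trans h.2))]
    refine Finset.prod_congr rfl fun i _ => ?_
    split_ifs with h
    · simp [h, Finset.prod_filter]
    · simp [h]
  unfold splitTerm
  rw [hlt, hlt, hall 1 (-1) _ (by decide), hall 1 0 _ (by decide), hall (-1) 0 _ (by decide),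
    hsplit, hsplit, hsplit, hsplit, hsplit]
  have h1 : ∏ i, weight L κ δ a c w (z i) (s i) =
      (∏ i, if s i = 1 then Aplus L κ δ a (z i) else 1) *
      (∏ i, if s i = 0 then Azero L κ δ a (fun _ => c) (z i) else 1) *
      (∏ i, if s i = -1 then Aminus L κ δ a (z i) else 1) *
      (∏ i, if s i = 1 then ∏ k, brPM L κ (z i) (w k) / brPM L κ (z i + δ) (w k) else 1) *
      (∏ i, if s i = -1 then ∏ k, brPM L κ (z i) (w k) / brPM L κ (z i - δ) (w k) else 1) := by
    simp only [← Finset.prod_mul_distrib]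
    refine Finset.prod_congr rfl fun i _ => ?_
    unfold weight
    cases s i <;> simp [coef, crossF]
  have h2 : ∏ i, ∏ j ∈ Finset.Ioi i, pairF L κ δ (s i) (s j) (z i) (z j) =
      (∏ i, ∏ j ∈ Finset.Ioi i, if s i = 1 ∧ s j = 1 then
        br L κ (z i + z j + 2 * δ) / br L κ (z i + z j) else 1) *
      (∏ i, ∏ j ∈ Finset.Ioi i, if s i = -1 ∧ s j = -1 then
        br L κ (z i + z j - 2 * δ) / br L κ (z i + z j) else 1) *
      (∏ i, ∏ j ∈ Finset.Ioi i, (if s i = 1 ∧ s j = -1 then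
        br L κ (z i - z j + 2 * δ) / br L κ (z i - z j) else 1) *
        (if s j = 1 ∧ s i = -1 then
        br L κ (z j - z i + 2 * δ) / br L κ (z j - z i) else 1)) *
      (∏ i, ∏ j ∈ Finset.Ioi i, (if s i = 1 ∧ s j = 0 then
        brPM L κ (z i + δ) (z j) / brPM L κ (z i) (z j) else 1) *
        (if s j = 1 ∧ s i = 0 then
        brPM L κ (z j + δ) (z i) / brPM L κ (z j) (z i) else 1)) *
      (∏ i, ∏ j ∈ Finset.Ioi i, (if s i = -1 ∧ s j = 0 then
        brPM L κ (z i - δ) (z j) / brPM L κ (z i) (z j) else 1) *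
        (if s j = -1 ∧ s i = 0 then
        brPM L κ (z j - δ) (z i) / brPM L κ (z j) (z i) else 1)) := by
    simp only [← Finset.prod_mul_distrib]
    refine Finset.prod_congr rfl fun i _ => Finset.prod_congr rfl fun j _ => ?_
    cases s i <;> cases s j <;> simp [pairF]
  rw [h1, h2]
  ring

lemma splitSum_eq_pairSum (a : Fin 8 → ℂ) (c : ℂ) {m n : ℕ} (z : Fin m → ℂ) (w : Fin n → ℂ) :
    splitSum L κ δ a (fun _ => c) z w =
      pairSum L κ δ z fun i => weight L κ δ a c w (z i) :=
  Finset.sum_congr rfl fun s _ => splitTerm_eq L κ δ a c z w s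

lemma pairSum_comp_perm {m : ℕ} (σ : Equiv.Perm (Fin m)) (z : Fin m → ℂ)
    (A : Fin m → SignType → ℂ) :
    pairSum L κ δ (z ∘ σ) (A ∘ σ) = pairSum L κ δ z A := by
  unfold pairSum
  rw [← (Equiv.arrowCongr σ.symm (Equiv.refl SignType)).sum_comp]
  refine Finset.sum_congr rfl fun s _ => ?_
  simp only [Equiv.arrowCongr_apply, Function.comp_apply, Equiv.symm_symm, Equiv.coe_refl, id_eq]
  rw [Equiv.prod_comp σ (fun i => A i (s i)),
    prod_prod_Ioi_comp_perm σ (fun i j => pairF L κ δ (s i) (s j) (z i) (z j))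
      (fun i j => pairF_comm L κ δ _ _ _ _)]

/-- Once the sign of the first variable is fixed, each of its interactions involves a single
remaining variable and is absorbed into that variable's weight. -/
lemma pairSum_succ {m : ℕ} (z : Fin (m + 1) → ℂ) (A : Fin (m + 1) → SignType → ℂ) :
    pairSum L κ δ z A = ∑ t, A 0 t * pairSum L κ δ (fun i => z i.succ)
      (fun i t' => A i.succ t' * pairF L κ δ t t' (z 0) (z i.succ)) := by
  unfold pairSum
  rw [← (Fin.consEquiv fun _ => SignType).sum_comp, Fintype.sum_prod_type]
  refine Finset.sum_congr rfl fun t _ => ?_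
  rw [Finset.mul_sum]
  refine Finset.sum_congr rfl fun s _ => ?_
  simp only [Fin.consEquiv_apply, Fin.prod_univ_succ, Fin.cons_zero, Fin.cons_succ,
    Fin.Ioi_zero_eq_map, Fin.Ioi_succ, Finset.prod_map, Fin.coe_succEmb, Finset.prod_mul_distrib]
  ring

lemma pairSum_const_mul {m : ℕ} (z : Fin m → ℂ) (φ : Fin m → ℂ) (A : Fin m → SignType → ℂ) :
    pairSum L κ δ z (fun i t => φ i * A i t) = (∏ i, φ i) * pairSum L κ δ z A := by
  simp only [pairSum, Finset.prod_mul_distrib, Finset.mul_sum, mul_assoc]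

lemma splitSum_zero (a : Fin 8 → ℂ) (c : ℂ) {n : ℕ} (z : Fin 0 → ℂ) (w : Fin n → ℂ) :
    splitSum L κ δ a (fun _ => c) z w = 1 := by
  simp [splitSum_eq_pairSum, pairSum]

lemma splitSum_comp_perm (a : Fin 8 → ℂ) (c : ℂ) {m n : ℕ} (σ : Equiv.Perm (Fin m))
    (z : Fin m → ℂ) (w : Fin n → ℂ) :
    splitSum L κ δ a (fun _ => c) (z ∘ σ) w = splitSum L κ δ a (fun _ => c) z w := by
  rw [splitSum_eq_pairSum, splitSum_eq_pairSum, ← pairSum_comp_perm L κ δ σ z]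
  rfl

lemma weight_comp_perm (a : Fin 8 → ℂ) (c : ℂ) {n : ℕ} (σ : Equiv.Perm (Fin n))
    (w : Fin n → ℂ) (x : ℂ) (t : SignType) :
    weight L κ δ a c (w ∘ σ) x t = weight L κ δ a c w x t := by
  unfold weight
  rw [← Equiv.prod_comp σ fun k => crossF L κ δ t x (w k)]
  rfl

lemma splitSum_comp_perm_right (a : Fin 8 → ℂ) (c : ℂ) {m n : ℕ} (σ : Equiv.Perm (Fin n))
    (z : Fin m → ℂ) (w : Fin n → ℂ) :
    splitSum L κ δ a (fun _ => c) z (w ∘ σ) = splitSum L κ δ a (fun _ => c) z w := by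
  simp only [splitSum_eq_pairSum, pairSum, weight_comp_perm]

lemma splitSum_succ (a : Fin 8 → ℂ) (c : ℂ) {m n : ℕ} (x : ℂ) (z : Fin m → ℂ) (w : Fin n → ℂ) :
    splitSum L κ δ a (fun _ => c) (Fin.cons x z : Fin (m + 1) → ℂ) w =
      ∑ t, weight L κ δ a c w x t * pairSum L κ δ z
        (fun i t' => weight L κ δ a c w (z i) t' * pairF L κ δ t t' x (z i)) := by
  rw [splitSum_eq_pairSum, pairSum_succ]
  simp only [Fin.cons_zero, Fin.cons_succ]

lemma weight_cons (a : Fin 8 → ℂ) (c : ℂ) {n : ℕ} (x : ℂ) (w : Fin n → ℂ) (y : ℂ)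
    (t : SignType) :
    weight L κ δ a c (Fin.cons x w : Fin (n + 1) → ℂ) y t =
      weight L κ δ a c w y t * crossF L κ δ t y x := by
  simp only [weight, Fin.prod_univ_succ, Fin.cons_zero, Fin.cons_succ]
  ring

/-! ### Symmetries of the building blocks -/

lemma brPM_neg_left (x y : ℂ) : brPM L κ (-x) y = brPM L κ x y := by
  have h1 : -x + y = -(x - y) := by ring
  have h2 : -x - y = -(x + y) := by ring
  simp only [brPM, h1, h2, br_neg]
  ring

lemma brPM_neg_right (x y : ℂ) : brPM L κ x (-y) = brPM L κ x y := by
  simp only [brPM, sub_neg_eq_add, ← sub_eq_add_neg]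
  ring

lemma brPM_swap (x y : ℂ) : brPM L κ x y = -brPM L κ y x := by
  simp only [brPM]
  rw [br_sub_comm L κ x y, add_comm x y]
  ring

lemma Aminus_eq (a : Fin 8 → ℂ) (x : ℂ) : Aminus L κ δ a x = Aplus L κ δ a (-x) := by
  unfold Aminus Aplus
  have h1 : ∏ p, br L κ (-x + a p) = ∏ p, br L κ (x - a p) := by
    have : ∀ p, br L κ (-x + a p) = -br L κ (x - a p) := fun p => by
      rw [← br_neg]; congr 1; ring
    simp only [this, Finset.prod_neg]
    norm_num
  have h2 : br L κ (2 * -x) = -br L κ (2 * x) := by rw [← br_neg]; congr 1; ring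
  have h3 : br L κ (2 * -x + δ) = -br L κ (2 * x - δ) := by rw [← br_neg]; congr 1; ring
  rw [h1, h2, h3, neg_mul_neg]

lemma Azero_neg (a : Fin 8 → ℂ) (c : Fin 4 → ℂ) (x : ℂ) :
    Azero L κ δ a c (-x) = Azero L κ δ a c x := by
  simp only [Azero, AzeroTerm, brPM_neg_left, brPM_neg_right]

lemma coef_neg (a : Fin 8 → ℂ) (c : ℂ) (t : SignType) (x : ℂ) :
    coef L κ δ a c (-t) x = coef L κ δ a c t (-x) := by
  cases t
  · exact (Azero_neg L κ δ a _ x).symm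
  · change Aplus _ _ _ _ _ = Aminus _ _ _ _ _
    rw [Aminus_eq, neg_neg]
  · exact Aminus_eq L κ δ a x

/-- The sign of x records the shift x ± δ. Reflection exchanges the two shifts, up to brackets that
are odd in numerator and denominator alike. -/
lemma pairF_neg_left (t t' : SignType) (x y : ℂ) :
    pairF L κ δ (-t) t' x y = pairF L κ δ t t' (-x) y := by
  have hd : ∀ u v u' v' : ℂ, u = -u' → v = -v' → br L κ u / br L κ v = br L κ u' / br L κ v' := by
    rintro u v u' v' rfl rfl
    rw [br_neg, br_neg, neg_div_neg_eq]
  have hp : ∀ x' : ℂ, x' = -x + δ → brPM L κ (x - δ) y = brPM L κ x' y := by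
    rintro x' rfl
    rw [← brPM_neg_left]
    congr 1
    ring
  have hm : ∀ x' : ℂ, x' = -x - δ → brPM L κ (x + δ) y = brPM L κ x' y := by
    rintro x' rfl
    rw [← brPM_neg_left]
    congr 1
    ring
  cases t <;> cases t' <;> simp only [pairF, brPM_neg_left, brPM_neg_right, hp _ rfl, hm _ rfl] <;>
  first
  | rfl
  | (congr 1 <;> congr 1 <;> ring1)
  | (apply hd <;> ring1)

lemma crossF_neg_left (t : SignType) (x w : ℂ) :
    crossF L κ δ (-t) x w = crossF L κ δ t (-x) w := by
  have hp : brPM L κ (x - δ) w = brPM L κ (-x + δ) w := by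
    rw [← brPM_neg_left]
    congr 1
    ring
  have hm : brPM L κ (x + δ) w = brPM L κ (-x - δ) w := by
    rw [← brPM_neg_left]
    congr 1
    ring
  cases t
  · rfl
  · change crossF L κ δ .pos _ _ = _
    simp only [crossF, brPM_neg_left, hm]
  · change crossF L κ δ .neg _ _ = _
    simp only [crossF, brPM_neg_left, hp]

lemma crossF_neg_right (t : SignType) (x w : ℂ) :
    crossF L κ δ t x (-w) = crossF L κ δ t x w := by
  cases t <;> simp only [crossF, brPM_neg_right]

lemma weight_neg (a : Fin 8 → ℂ) (c : ℂ) {n : ℕ} (w : Fin n → ℂ) (x : ℂ) (t : SignType) :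
    weight L κ δ a c w x (-t) = weight L κ δ a c w (-x) t := by
  simp only [weight, coef_neg, crossF_neg_left]

/-- Reindex the sum over the sign of x by negation. -/
lemma splitSum_cons_neg (a : Fin 8 → ℂ) (c : ℂ) {m n : ℕ} (x : ℂ) (z : Fin m → ℂ)
    (w : Fin n → ℂ) :
    splitSum L κ δ a (fun _ => c) (Fin.cons (-x) z : Fin (m + 1) → ℂ) w =
      splitSum L κ δ a (fun _ => c) (Fin.cons x z : Fin (m + 1) → ℂ) w := by
  rw [splitSum_succ, splitSum_succ, ← Equiv.sum_comp (Equiv.neg SignType)]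
  simp only [Equiv.neg_apply, weight_neg, pairF_neg_left, neg_neg]

lemma splitSum_cons_neg_right (a : Fin 8 → ℂ) (c : ℂ) {m n : ℕ} (x : ℂ) (z : Fin m → ℂ)
    (w : Fin n → ℂ) :
    splitSum L κ δ a (fun _ => c) z (Fin.cons (-x) w : Fin (n + 1) → ℂ) =
      splitSum L κ δ a (fun _ => c) z (Fin.cons x w : Fin (n + 1) → ℂ) := by
  rw [splitSum_eq_pairSum, splitSum_eq_pairSum]
  congr 1
  funext i t
  rw [weight_cons, weight_cons, crossF_neg_right]

end

section

variable (L : PeriodPair) (κ δ : ℂ)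

/-! ### Periodicity -/

lemma e_sum {ι : Type*} (s : Finset ι) (f : ι → ℂ) : e (∑ i ∈ s, f i) = ∏ i ∈ s, e (f i) := by
  simp only [e, Finset.mul_sum, Complex.exp_sum]

lemma brPM_add_period_left {ω : ℂ} (hω : ω ∈ L.lattice) (x y : ℂ) :
    brPM L κ (x + ω) y = e (quasiPeriod L κ ω * (2 * x + ω)) * brPM L κ x y := by
  have h1 : x + ω + y = x + y + ω := by ring
  have h2 : x + ω - y = x - y + ω := by ring
  have h3 : e (quasiPeriod L κ ω * (2 * x + ω)) = e (quasiPeriod L κ ω * (x + y + ω / 2)) *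
      e (quasiPeriod L κ ω * (x - y + ω / 2)) := by
    rw [← e_add]
    congr 1
    ring
  rw [brPM, h1, h2, br_add_period L κ hω, br_add_period L κ hω, h3, brPM]
  linear_combination e (quasiPeriod L κ ω * (x + y + ω / 2)) *
      e (quasiPeriod L κ ω * (x - y + ω / 2)) * br L κ (x + y) * br L κ (x - y) * signChar_sq L ω

lemma brPM_add_period_right {ω : ℂ} (hω : ω ∈ L.lattice) (x y : ℂ) :
    brPM L κ x (y + ω) = e (quasiPeriod L κ ω * (2 * y + ω)) * brPM L κ x y := by
  rw [brPM_swap, brPM_add_period_left L κ hω, brPM_swap L κ x y]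
  ring

lemma br_add_two_period {ω : ℂ} (hω : ω ∈ L.lattice) (u : ℂ) :
    br L κ (u + 2 * ω) = e (quasiPeriod L κ ω * (2 * u + 2 * ω)) * br L κ u := by
  have h1 : u + 2 * ω = u + ω + ω := by ring
  have h3 : e (quasiPeriod L κ ω * (2 * u + 2 * ω)) = e (quasiPeriod L κ ω * (u + ω + ω / 2)) *
      e (quasiPeriod L κ ω * (u + ω / 2)) := by
    rw [← e_add]
    congr 1
    ring
  rw [h1, br_add_period L κ hω, br_add_period L κ hω, h3]
  linear_combination e (quasiPeriod L κ ω * (u + ω + ω / 2)) *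
      e (quasiPeriod L κ ω * (u + ω / 2)) * br L κ u * signChar_sq L ω

/-- Eight brackets in x balance two brackets in 2x, each counting fourfold, so the dependence of the
multiplier on x cancels. -/
lemma Aplus_add_period {ω : ℂ} (hω : ω ∈ L.lattice) (a : Fin 8 → ℂ) (x : ℂ) :
    Aplus L κ δ a (x + ω) =
      e (quasiPeriod L κ ω * (∑ p, a p - 2 * δ)) * Aplus L κ δ a x := by
  set η := quasiPeriod L κ ω with hη
  have h1 : ∏ p, br L κ (x + ω + a p) =
      e (η * (8 * x + ∑ p, a p + 4 * ω)) * ∏ p, br L κ (x + a p) := by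
    have h2 : ∀ p, br L κ (x + ω + a p) =
        signChar L ω * e (η * (x + a p + ω / 2)) * br L κ (x + a p) := fun p => by
      rw [← br_add_period L κ hω]
      congr 1
      ring
    have h3 : η * (8 * x + ∑ p, a p + 4 * ω) = ∑ p, η * (x + a p + ω / 2) := by
      rw [← Finset.mul_sum, Finset.sum_add_distrib, Finset.sum_add_distrib]
      simp only [Finset.sum_const, Finset.card_univ, Fintype.card_fin, nsmul_eq_mul]
      push_cast
      ring
    simp only [h2, Finset.prod_mul_distrib]
    rw [h3, e_sum]
    have h4 : ∏ _p : Fin 8, signChar L ω = 1 := by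
      rw [Finset.prod_const]
      have : signChar L ω ^ 8 = (signChar L ω * signChar L ω) ^ 4 := by ring
      simp [this, signChar_sq]
    rw [h4, one_mul]
  have h5 : 2 * (x + ω) = 2 * x + 2 * ω := by ring
  have h6 : 2 * (x + ω) + δ = 2 * x + δ + 2 * ω := by ring
  have h7 : e (η * (8 * x + ∑ p, a p + 4 * ω)) = e (η * (∑ p, a p - 2 * δ)) *
      e (η * (2 * (2 * x) + 2 * ω)) * e (η * (2 * (2 * x + δ) + 2 * ω)) := by
    rw [← e_add, ← e_add]
    congr 1
    ring
  rw [Aplus, h1, h6, h5, br_add_two_period L κ hω, br_add_two_period L κ hω, h7, Aplus]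
  have h8 := e_ne_zero (η * (2 * (2 * x) + 2 * ω))
  have h9 := e_ne_zero (η * (2 * (2 * x + δ) + 2 * ω))
  generalize e (η * (2 * (2 * x) + 2 * ω)) = q at h8 ⊢
  generalize e (η * (2 * (2 * x + δ) + 2 * ω)) = q' at h9 ⊢
  field_simp

lemma Azero_add_period {ω : ℂ} (hω : ω ∈ L.lattice) (a : Fin 8 → ℂ) (c : Fin 4 → ℂ) (x : ℂ) :
    Azero L κ δ a c (x + ω) = Azero L κ δ a c x := by
  refine Finset.sum_congr rfl fun r _ => ?_
  unfold AzeroTerm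
  rw [brPM_add_period_left L κ hω, brPM_add_period_right L κ hω]
  have := e_ne_zero (quasiPeriod L κ ω * (2 * x + ω))
  congr 1
  field_simp

/-- If `G` is multiplied by `e(q)` under `x ↦ x + ω`, then `x ↦ G(-x)` is multiplied by `e(-q)`. -/
lemma reflect_add_period {G : ℂ → ℂ} {q ω : ℂ} (h : ∀ x, G (x + ω) = e q * G x) (x : ℂ) :
    G (-(x + ω)) = e (-q) * G (-x) := by
  have h1 := h (-(x + ω))
  have h2 : -(x + ω) + ω = -x := by ring
  rw [h2] at h1
  rw [h1, e_neg, inv_mul_cancel_left₀ (e_ne_zero q)]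

lemma coef_add_period {ω : ℂ} (hω : ω ∈ L.lattice) (a : Fin 8 → ℂ) (c : ℂ) (t : SignType) (x : ℂ) :
    coef L κ δ a c t (x + ω) =
      e ((t : ℂ) * (quasiPeriod L κ ω * (∑ p, a p - 2 * δ))) * coef L κ δ a c t x := by
  have hpos : ∀ x, coef L κ δ a c .pos (x + ω) =
      e (quasiPeriod L κ ω * (∑ p, a p - 2 * δ)) * coef L κ δ a c .pos x :=
    fun x => Aplus_add_period L κ δ hω a x
  cases t
  · change Azero _ _ _ _ _ _ = e (((0 : SignType) : ℂ) * _) * Azero _ _ _ _ _ _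
    rw [Azero_add_period L κ δ hω]
    simp [e_zero]
  · change coef L κ δ a c (-.pos) _ = _ * coef L κ δ a c (-.pos) _
    rw [coef_neg, coef_neg, reflect_add_period hpos]
    simp
  · rw [hpos]
    simp

lemma crossF_add_period {ω : ℂ} (hω : ω ∈ L.lattice) (t : SignType) (x w : ℂ) :
    crossF L κ δ t (x + ω) w =
      e ((t : ℂ) * (quasiPeriod L κ ω * (-2 * δ))) * crossF L κ δ t x w := by
  have hpos : ∀ x, crossF L κ δ .pos (x + ω) w =
      e (quasiPeriod L κ ω * (-2 * δ)) * crossF L κ δ .pos x w := by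
    intro x
    have h1 : x + ω + δ = x + δ + ω := by ring
    have h2 : e (quasiPeriod L κ ω * (2 * x + ω)) = e (quasiPeriod L κ ω * (-2 * δ)) *
        e (quasiPeriod L κ ω * (2 * (x + δ) + ω)) := by
      rw [← e_add]
      congr 1
      ring
    simp only [crossF]
    rw [h1, brPM_add_period_left L κ hω, brPM_add_period_left L κ hω, h2]
    have := e_ne_zero (quasiPeriod L κ ω * (2 * (x + δ) + ω))
    field_simp
  cases t
  · simp [crossF, e_zero]
  · change crossF L κ δ (-.pos) _ _ = _ * crossF L κ δ (-.pos) _ _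
    rw [crossF_neg_left, crossF_neg_left,
      reflect_add_period (G := fun x => crossF L κ δ .pos x w) hpos]
    simp
  · rw [hpos]
    simp

lemma crossF_add_period_right {ω : ℂ} (hω : ω ∈ L.lattice) (t : SignType) (x w : ℂ) :
    crossF L κ δ t x (w + ω) = crossF L κ δ t x w := by
  have := e_ne_zero (quasiPeriod L κ ω * (2 * w + ω))
  cases t <;> simp only [crossF, brPM_add_period_right L κ hω] <;> field_simp

lemma pairF_add_period {ω : ℂ} (hω : ω ∈ L.lattice) (t t' : SignType) (x y : ℂ) :
    pairF L κ δ t t' (x + ω) y =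
      e ((t : ℂ) * (quasiPeriod L κ ω * (2 * δ))) * pairF L κ δ t t' x y := by
  have hq : ∀ u u' : ℂ, u' = u + ω →
      br L κ (u' + 2 * δ) / br L κ u' = e (quasiPeriod L κ ω * (2 * δ)) *
        (br L κ (u + 2 * δ) / br L κ u) := by
    rintro u _ rfl
    have h1 : u + ω + 2 * δ = u + 2 * δ + ω := by ring
    have h2 : e (quasiPeriod L κ ω * (u + 2 * δ + ω / 2)) = e (quasiPeriod L κ ω * (2 * δ)) *
        e (quasiPeriod L κ ω * (u + ω / 2)) := by
      rw [← e_add]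
      congr 1
      ring
    rw [h1, br_add_period L κ hω, br_add_period L κ hω, h2]
    have h3 := e_ne_zero (quasiPeriod L κ ω * (u + ω / 2))
    have h4 := signChar_ne_zero L ω
    generalize e (quasiPeriod L κ ω * (u + ω / 2)) = q at h3 ⊢
    field_simp
  have hpos : ∀ x, pairF L κ δ .pos t' (x + ω) y =
      e (quasiPeriod L κ ω * (2 * δ)) * pairF L κ δ .pos t' x y := by
    intro x
    cases t'
    · have h1 : x + ω + δ = x + δ + ω := by ring
      have h2 : e (quasiPeriod L κ ω * (2 * (x + δ) + ω)) = e (quasiPeriod L κ ω * (2 * δ)) *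
          e (quasiPeriod L κ ω * (2 * x + ω)) := by
        rw [← e_add]
        congr 1
        ring
      simp only [pairF]
      rw [h1, brPM_add_period_left L κ hω, brPM_add_period_left L κ hω, h2]
      have := e_ne_zero (quasiPeriod L κ ω * (2 * x + ω))
      field_simp
    · exact hq _ _ (by ring)
    · exact hq _ _ (by ring)
  cases t
  · have := e_ne_zero (quasiPeriod L κ ω * (2 * x + ω))
    cases t' <;> simp only [pairF, brPM_add_period_right L κ hω] <;>
      simp only [SignType.zero_eq_zero, SignType.coe_zero, zero_mul, e_zero, one_mul] <;> field_simp
  · change pairF L κ δ (-.pos) _ _ _ = _ * pairF L κ δ (-.pos) _ _ _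
    rw [pairF_neg_left, pairF_neg_left,
      reflect_add_period (G := fun x => pairF L κ δ .pos t' x y) hpos]
    simp
  · rw [hpos]
    simp

/-- In units of tη, for the sign t of x, the coefficient contributes Σa - 2δ, each of the n cross
factors -2δ and each of the m pair factors 2δ. The balancing condition says exactly that the total
is 0. -/
lemma splitSum_cons_add_period {ω : ℂ} (hω : ω ∈ L.lattice) (a : Fin 8 → ℂ) (c : ℂ) {m n : ℕ}
    (hbal : ∑ p, a p = (4 - 2 * ((m + 1 : ℕ) : ℂ) + 2 * (n : ℂ)) * δ)
    (x : ℂ) (z : Fin m → ℂ) (w : Fin n → ℂ) :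
    splitSum L κ δ a (fun _ => c) (Fin.cons (x + ω) z : Fin (m + 1) → ℂ) w =
      splitSum L κ δ a (fun _ => c) (Fin.cons x z : Fin (m + 1) → ℂ) w := by
  set η := quasiPeriod L κ ω with hη
  rw [splitSum_succ, splitSum_succ]
  refine Finset.sum_congr rfl fun t _ => ?_
  have h1 : weight L κ δ a c w (x + ω) t =
      e (-((t : ℂ) * (η * (2 * δ)) * m)) * weight L κ δ a c w x t := by
    simp only [weight, coef_add_period L κ δ hω, crossF_add_period L κ δ hω,
      Finset.prod_mul_distrib, ← e_sum, ← hη]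
    rw [mul_mul_mul_comm, ← e_add]
    congr 2
    rw [hbal]
    simp
    ring
  have h2 : pairSum L κ δ z
      (fun i t' => weight L κ δ a c w (z i) t' * pairF L κ δ t t' (x + ω) (z i)) =
      e ((t : ℂ) * (η * (2 * δ)) * m) * pairSum L κ δ z
      (fun i t' => weight L κ δ a c w (z i) t' * pairF L κ δ t t' x (z i)) := by
    have h3 : e ((t : ℂ) * (η * (2 * δ)) * m) = ∏ _i : Fin m, e ((t : ℂ) * (η * (2 * δ))) := by
      rw [← e_sum]
      simp [mul_comm]
    rw [h3, ← pairSum_const_mul]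
    congr 1
    funext i t'
    rw [pairF_add_period L κ δ hω]
    ring
  rw [h1, h2, e_neg]
  have h3 := e_ne_zero ((t : ℂ) * (η * (2 * δ)) * m)
  generalize e ((t : ℂ) * (η * (2 * δ)) * m) = q at h3 ⊢
  field_simp

/-- No balancing is needed here: every cross factor is already elliptic in its second argument. -/
lemma splitSum_cons_add_period_right {ω : ℂ} (hω : ω ∈ L.lattice) (a : Fin 8 → ℂ) (c : ℂ)
    {m n : ℕ} (x : ℂ) (z : Fin m → ℂ) (w : Fin n → ℂ) :
    splitSum L κ δ a (fun _ => c) z (Fin.cons (x + ω) w : Fin (n + 1) → ℂ) =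
      splitSum L κ δ a (fun _ => c) z (Fin.cons x w : Fin (n + 1) → ℂ) := by
  rw [splitSum_eq_pairSum, splitSum_eq_pairSum]
  congr 1
  funext i t
  rw [weight_cons, weight_cons, crossF_add_period_right L κ δ hω]

/-! ### Nonvanishing conditions -/

/-- None of `[2x]`, `[2x + δ]`, `[2x - δ]` vanishes. -/
def Regular (x : ℂ) : Prop :=
  br L κ (2 * x) ≠ 0 ∧ br L κ (2 * x + δ) ≠ 0 ∧ br L κ (2 * x - δ) ≠ 0

/-- Neither `[x + δ ± w]` nor `[x - δ ± w]` vanishes. -/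
def CrossRegular (x w : ℂ) : Prop :=
  brPM L κ (x + δ) w ≠ 0 ∧ brPM L κ (x - δ) w ≠ 0

variable {L κ δ}

lemma br_ne_zero_iff {u : ℂ} : br L κ u ≠ 0 ↔ u ∉ L.lattice := (br_eq_zero_iff L κ).not

lemma brPM_ne_zero_iff {x y : ℂ} :
    brPM L κ x y ≠ 0 ↔ x + y ∉ L.lattice ∧ x - y ∉ L.lattice := by
  rw [brPM, mul_ne_zero_iff, br_ne_zero_iff, br_ne_zero_iff]

lemma brPM_ne_zero_comm {x y : ℂ} : brPM L κ x y ≠ 0 ↔ brPM L κ y x ≠ 0 := by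
  rw [brPM_swap, neg_ne_zero]

lemma CrossRegular.symm {x w : ℂ} (h : CrossRegular L κ δ x w) : CrossRegular L κ δ w x := by
  obtain ⟨h1, h2⟩ := h
  rw [brPM_ne_zero_iff] at h1 h2
  rw [CrossRegular, brPM_ne_zero_iff, brPM_ne_zero_iff]
  refine ⟨⟨fun h => h1.1 ?_, fun h => h2.2 ?_⟩, ⟨fun h => h2.1 ?_, fun h => h1.2 ?_⟩⟩
  · convert! h using 1; ring
  · convert! neg_mem h using 1; ring
  · convert! h using 1; ring
  · convert! neg_mem h using 1; ring

lemma Regular.neg {x : ℂ} (h : Regular L κ δ x) : Regular L κ δ (-x) := by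
  obtain ⟨h1, h2, h3⟩ := h
  rw [br_ne_zero_iff] at h1 h2 h3
  rw [Regular, br_ne_zero_iff, br_ne_zero_iff, br_ne_zero_iff]
  refine ⟨fun h => h1 ?_, fun h => h3 ?_, fun h => h2 ?_⟩
  all_goals
    convert! neg_mem h using 1
    ring

lemma om_mem (r : Fin 4) : om L r ∈ L.lattice := by
  have h1 := L.ω₁_mem_lattice
  have h2 := L.ω₂_mem_lattice
  fin_cases r
  · exact zero_mem _
  · exact h1
  · exact h2
  · exact sub_mem (neg_mem h1) h2

lemma two_mul_mem {u : ℂ} (h : u ∈ L.lattice) : 2 * u ∈ L.lattice := by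
  rw [two_mul]
  exact add_mem h h

lemma brPM_half_ne_zero {x : ℂ} (h1 : br L κ (2 * x + δ) ≠ 0) (h2 : br L κ (2 * x - δ) ≠ 0)
    (r : Fin 4) : brPM L κ ((1 / 2) * (om L r - δ)) x ≠ 0 := by
  rw [br_ne_zero_iff] at h1 h2
  rw [brPM_ne_zero_iff]
  refine ⟨fun h => h2 ?_, fun h => h1 ?_⟩
  · convert! sub_mem (two_mul_mem h) (om_mem r) using 1
    ring
  · convert! sub_mem (om_mem r) (two_mul_mem h) using 1
    ring

/-! ### Continuity -/

section Continuity

variable {X : Type*} [TopologicalSpace X] {p : X}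

lemma continuousAt_br {f : X → ℂ} (hf : ContinuousAt f p) :
    ContinuousAt (fun q => br L κ (f q)) p :=
  (continuous_br L κ).continuousAt.comp' hf

lemma continuousAt_brPM {f g : X → ℂ} (hf : ContinuousAt f p) (hg : ContinuousAt g p) :
    ContinuousAt (fun q => brPM L κ (f q) (g q)) p :=
  (continuousAt_br (hf.add hg)).mul (continuousAt_br (hf.sub hg))

lemma continuousAt_AzeroTerm {a : X → Fin 8 → ℂ} {c x : X → ℂ} (ha : ContinuousAt a p)
    (hc : ContinuousAt c p) (hx : ContinuousAt x p) (r : Fin 4)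
    (h : brPM L κ ((1 / 2) * (om L r - δ)) (x p) ≠ 0)
    (h' : brPM L κ ((1 / 2) * (om L r - δ)) (c p) ≠ 0) :
    ContinuousAt (fun q => AzeroTerm L κ δ (a q) r (c q) (x q)) p := by
  have ha' : ∀ i, ContinuousAt (fun q => a q i) p := fun i => continuousAt_pi.mp ha i
  unfold AzeroTerm
  refine ContinuousAt.mul (ContinuousAt.mul continuousAt_const ?_) (ContinuousAt.div₀ ?_ ?_ ?_)
  · refine (differentiable_e.continuous).continuousAt.comp' (ContinuousAt.mul ?_ continuousAt_const)
    exact continuousAt_const.sub (continuousAt_const.mul (tendsto_finsetSum _ fun i _ => ha' i))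
  · exact (continuousAt_brPM hx hc).mul
      (tendsto_finsetProd _ fun i _ => continuousAt_br (continuousAt_const.add (ha' i)))
  · exact (continuousAt_const.mul (continuousAt_brPM continuousAt_const hx)).mul
      (continuousAt_brPM continuousAt_const hc)
  · exact mul_ne_zero (mul_ne_zero two_ne_zero h) h'

lemma continuousAt_Aplus {a : X → Fin 8 → ℂ} {x : X → ℂ} (ha : ContinuousAt a p)
    (hx : ContinuousAt x p) (h : br L κ (2 * x p) ≠ 0) (h' : br L κ (2 * x p + δ) ≠ 0) :
    ContinuousAt (fun q => Aplus L κ δ (a q) (x q)) p := by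
  have ha' : ∀ i, ContinuousAt (fun q => a q i) p := fun i => continuousAt_pi.mp ha i
  refine ContinuousAt.div₀ ?_ ?_ (mul_ne_zero h h')
  · exact tendsto_finsetProd _ fun i _ => continuousAt_br (hx.add (ha' i))
  · exact (continuousAt_br (continuousAt_const.mul hx)).mul
      (continuousAt_br ((continuousAt_const.mul hx).add continuousAt_const))

lemma continuousAt_coef {a : X → Fin 8 → ℂ} {c x : X → ℂ} (ha : ContinuousAt a p)
    (hc : ContinuousAt c p) (hx : ContinuousAt x p) (h : Regular L κ δ (x p))
    (hc1 : br L κ (2 * c p + δ) ≠ 0) (hc2 : br L κ (2 * c p - δ) ≠ 0) (t : SignType) :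
    ContinuousAt (fun q => coef L κ δ (a q) (c q) t (x q)) p := by
  cases t
  · change ContinuousAt (fun q => ∑ r, AzeroTerm L κ δ (a q) r (c q) (x q)) p
    exact tendsto_finsetSum _ fun r _ => continuousAt_AzeroTerm ha hc hx r
      (brPM_half_ne_zero h.2.1 h.2.2 r) (brPM_half_ne_zero hc1 hc2 r)
  · simp only [coef, Aminus_eq]
    exact continuousAt_Aplus ha hx.neg h.neg.1 h.neg.2.1
  · exact continuousAt_Aplus ha hx h.1 h.2.1

lemma continuousAt_crossF {x w : X → ℂ} (hx : ContinuousAt x p) (hw : ContinuousAt w p)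
    (h : CrossRegular L κ δ (x p) (w p)) (t : SignType) :
    ContinuousAt (fun q => crossF L κ δ t (x q) (w q)) p := by
  cases t
  · exact continuousAt_const
  · exact (continuousAt_brPM hx hw).div₀ (continuousAt_brPM (hx.sub continuousAt_const) hw) h.2
  · exact (continuousAt_brPM hx hw).div₀ (continuousAt_brPM (hx.add continuousAt_const) hw) h.1

lemma continuousAt_weight {a : X → Fin 8 → ℂ} {c x : X → ℂ} {n : ℕ} {w : X → Fin n → ℂ}
    (ha : ContinuousAt a p) (hc : ContinuousAt c p) (hx : ContinuousAt x p)
    (hw : ContinuousAt w p) (h : Regular L κ δ (x p))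
    (hc1 : br L κ (2 * c p + δ) ≠ 0) (hc2 : br L κ (2 * c p - δ) ≠ 0)
    (hxw : ∀ k, CrossRegular L κ δ (x p) (w p k)) (t : SignType) :
    ContinuousAt (fun q => weight L κ δ (a q) (c q) (w q) (x q) t) p :=
  (continuousAt_coef ha hc hx h hc1 hc2 t).mul
    (tendsto_finsetProd _ fun k _ => continuousAt_crossF hx (continuousAt_pi.mp hw k) (hxw k) t)

lemma continuousAt_pairF {x y : X → ℂ} (hx : ContinuousAt x p) (hy : ContinuousAt y p)
    (h : brPM L κ (x p) (y p) ≠ 0) (t t' : SignType) :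
    ContinuousAt (fun q => pairF L κ δ t t' (x q) (y q)) p := by
  have h1 := (mul_ne_zero_iff.mp h).1
  have h2 := (mul_ne_zero_iff.mp h).2
  have h3 := brPM_ne_zero_comm.mp h
  have h4 := (mul_ne_zero_iff.mp h3).2
  have hc : ∀ u : ℂ, ContinuousAt (fun _ : X => u) p := fun _ => continuousAt_const
  cases t <;> cases t'
  · exact continuousAt_const
  · exact (continuousAt_brPM (hy.sub (hc _)) hx).div₀ (continuousAt_brPM hy hx) h3
  · exact (continuousAt_brPM (hy.add (hc _)) hx).div₀ (continuousAt_brPM hy hx) h3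
  · exact (continuousAt_brPM (hx.sub (hc _)) hy).div₀ (continuousAt_brPM hx hy) h
  · exact (continuousAt_br ((hx.add hy).sub (hc _))).div₀ (continuousAt_br (hx.add hy)) h1
  · exact (continuousAt_br ((hy.sub hx).add (hc _))).div₀ (continuousAt_br (hy.sub hx)) h4
  · exact (continuousAt_brPM (hx.add (hc _)) hy).div₀ (continuousAt_brPM hx hy) h
  · exact (continuousAt_br ((hx.sub hy).add (hc _))).div₀ (continuousAt_br (hx.sub hy)) h2
  · exact (continuousAt_br ((hx.add hy).add (hc _))).div₀ (continuousAt_br (hx.add hy)) h1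

lemma continuousAt_pairSum {m : ℕ} {z : X → Fin m → ℂ} {A : X → Fin m → SignType → ℂ}
    (hz : ContinuousAt z p) (hA : ∀ i t, ContinuousAt (fun q => A q i t) p)
    (h : ∀ i j, i ≠ j → brPM L κ (z p i) (z p j) ≠ 0) :
    ContinuousAt (fun q => pairSum L κ δ (z q) (A q)) p := by
  have hz' := continuousAt_pi.mp hz
  refine tendsto_finsetSum _ fun s _ => Tendsto.mul (tendsto_finsetProd _ fun i _ => hA i _)
    (tendsto_finsetProd _ fun i _ => tendsto_finsetProd _ fun j hj => ?_)
  exact continuousAt_pairF (hz' i) (hz' j) (h i j (Finset.mem_Ioi.mp hj).ne) _ _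

/-- All data may vary at once, which serves both the study in one variable and the final
perturbation of a, c and w. -/
lemma continuousAt_splitSum {a : X → Fin 8 → ℂ} {c : X → ℂ} {m n : ℕ} {z : X → Fin m → ℂ}
    {w : X → Fin n → ℂ} (ha : ContinuousAt a p) (hc : ContinuousAt c p) (hz : ContinuousAt z p)
    (hw : ContinuousAt w p) (h : Generic L κ δ (z p))
    (hc1 : br L κ (2 * c p + δ) ≠ 0) (hc2 : br L κ (2 * c p - δ) ≠ 0)
    (hzw : ∀ i k, CrossRegular L κ δ (z p i) (w p k)) :
    ContinuousAt (fun q => splitSum L κ δ (a q) (fun _ => c q) (z q) (w q)) p := by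
  simp only [splitSum_eq_pairSum]
  exact continuousAt_pairSum hz (fun i t => continuousAt_weight ha hc (continuousAt_pi.mp hz i) hw
    (h.1 i) hc1 hc2 (hzw i) t) h.2

end Continuity

/-! ### Meromorphy -/

section Meromorphy

lemma meromorphic_br {f : ℂ → ℂ} (hf : Differentiable ℂ f) :
    Meromorphic fun x => br L κ (f x) := fun x =>
  (((differentiable_br L κ).comp hf).analyticAt x).meromorphicAt

lemma meromorphic_brPM {f g : ℂ → ℂ} (hf : Differentiable ℂ f) (hg : Differentiable ℂ g) :
    Meromorphic fun x => brPM L κ (f x) (g x) :=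
  (meromorphic_br (hf.add hg)).mul (meromorphic_br (hf.sub hg))

lemma meromorphic_prod {ι : Type*} {s : Finset ι} {f : ι → ℂ → ℂ} (h : ∀ i, Meromorphic (f i)) :
    Meromorphic fun x => ∏ i ∈ s, f i x := fun x =>
  MeromorphicAt.fun_prod fun i _ => h i x

lemma meromorphic_sum {ι : Type*} {s : Finset ι} {f : ι → ℂ → ℂ} (h : ∀ i, Meromorphic (f i)) :
    Meromorphic fun x => ∑ i ∈ s, f i x := fun x =>
  MeromorphicAt.fun_sum fun i _ => h i x

lemma meromorphic_const (c : ℂ) : Meromorphic fun _ : ℂ => c := fun x => MeromorphicAt.const c x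

lemma meromorphic_Aplus (a : Fin 8 → ℂ) {f : ℂ → ℂ} (hf : Differentiable ℂ f) :
    Meromorphic fun x => Aplus L κ δ a (f x) := by
  refine Meromorphic.div (meromorphic_prod fun i => meromorphic_br (hf.add_const _)) ?_
  exact (meromorphic_br (hf.const_mul 2)).mul (meromorphic_br ((hf.const_mul 2).add_const _))

lemma meromorphic_coef (a : Fin 8 → ℂ) (c : ℂ) (t : SignType) :
    Meromorphic (coef L κ δ a c t) := by
  cases t
  · refine meromorphic_sum fun r => ?_
    refine (meromorphic_const _).mul (Meromorphic.div ?_ ?_)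
    · exact (meromorphic_brPM differentiable_id (differentiable_const c)).mul (meromorphic_const _)
    · exact ((meromorphic_const 2).mul
        (meromorphic_brPM (differentiable_const _) differentiable_id)).mul (meromorphic_const _)
  · have := meromorphic_Aplus (L := L) (κ := κ) (δ := δ) a (differentiable_id (𝕜 := ℂ)).neg
    convert! this using 1
    funext x
    exact Aminus_eq L κ δ a x
  · exact meromorphic_Aplus a differentiable_id

lemma meromorphic_crossF (t : SignType) {f g : ℂ → ℂ} (hf : Differentiable ℂ f)
    (hg : Differentiable ℂ g) : Meromorphic fun x => crossF L κ δ t (f x) (g x) := by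
  cases t
  · exact meromorphic_const 1
  · exact (meromorphic_brPM hf hg).div (meromorphic_brPM (hf.sub_const δ) hg)
  · exact (meromorphic_brPM hf hg).div (meromorphic_brPM (hf.add_const δ) hg)

lemma meromorphic_pairF (t t' : SignType) (y : ℂ) :
    Meromorphic fun x => pairF L κ δ t t' x y := by
  have hx : Differentiable ℂ fun x : ℂ => x := differentiable_id
  have hc : ∀ u : ℂ, Differentiable ℂ fun _ : ℂ => u := fun u => differentiable_const u
  cases t <;> cases t'
  · exact meromorphic_const 1
  · exact (meromorphic_brPM (hc _) hx).div (meromorphic_brPM (hc _) hx)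
  · exact (meromorphic_brPM (hc _) hx).div (meromorphic_brPM (hc _) hx)
  · exact (meromorphic_brPM (hx.sub (hc _)) (hc _)).div (meromorphic_brPM hx (hc _))
  · exact (meromorphic_br ((hx.add (hc _)).sub (hc _))).div (meromorphic_br (hx.add (hc _)))
  · exact (meromorphic_br (((hc _).sub hx).add (hc _))).div (meromorphic_br ((hc _).sub hx))
  · exact (meromorphic_brPM (hx.add (hc _)) (hc _)).div (meromorphic_brPM hx (hc _))
  · exact (meromorphic_br ((hx.sub (hc _)).add (hc _))).div (meromorphic_br (hx.sub (hc _)))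
  · exact (meromorphic_br ((hx.add (hc _)).add (hc _))).div (meromorphic_br (hx.add (hc _)))

lemma meromorphic_pairSum {m : ℕ} (z : Fin m → ℂ) {A : ℂ → Fin m → SignType → ℂ}
    (hA : ∀ i t, Meromorphic fun x => A x i t) :
    Meromorphic fun x => pairSum L κ δ z (A x) :=
  meromorphic_sum fun _ => (meromorphic_prod fun i => hA i _).mul (meromorphic_const _)

lemma meromorphic_splitSum_cons (a : Fin 8 → ℂ) (c : ℂ) {m n : ℕ} (z : Fin m → ℂ)
    (w : Fin n → ℂ) : Meromorphic fun x =>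
      splitSum L κ δ a (fun _ => c) (Fin.cons x z : Fin (m + 1) → ℂ) w := by
  simp only [splitSum_succ]
  refine meromorphic_sum fun t => Meromorphic.mul ?_ (meromorphic_pairSum z fun i t' => ?_)
  · exact (meromorphic_coef a c t).mul
      (meromorphic_prod fun k => meromorphic_crossF t differentiable_id (differentiable_const _))
  · exact (meromorphic_const _).mul (meromorphic_pairF t t' _)

lemma meromorphic_splitSum_cons_right (a : Fin 8 → ℂ) (c : ℂ) {m n : ℕ} (z : Fin m → ℂ)
    (w : Fin n → ℂ) : Meromorphic fun x =>
      splitSum L κ δ a (fun _ => c) z (Fin.cons x w : Fin (n + 1) → ℂ) := by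
  simp only [splitSum_eq_pairSum]
  refine meromorphic_pairSum z fun i t => ?_
  simp only [weight_cons]
  exact (meromorphic_const _).mul
    (meromorphic_crossF t (differentiable_const _) differentiable_id)

end Meromorphy

end

/-! ### Residues at simple poles -/

/-- `f` has at most a simple pole at `x₀`, with residue `l`. -/
def HasRes (f : ℂ → ℂ) (x₀ l : ℂ) : Prop :=
  Tendsto (fun x => (x - x₀) * f x) (𝓝[≠] x₀) (𝓝 l)

section Residues

variable {f g : ℂ → ℂ} {x₀ l l' : ℂ}

lemma HasRes.mul_continuousAt (hf : HasRes f x₀ l) (hg : ContinuousAt g x₀) :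
    HasRes (fun x => f x * g x) x₀ (l * g x₀) := by
  have := Tendsto.mul hf (hg.tendsto.mono_left nhdsWithin_le_nhds)
  exact this.congr fun x => by ring

lemma HasRes.of_eq_mul {F : ℂ → ℂ} (hf : HasRes f x₀ l) (hg : ContinuousAt g x₀)
    (hF : ∀ x, F x = f x * g x) (hl : l' = l * g x₀) : HasRes F x₀ l' := by
  rw [hl, funext hF]
  exact hf.mul_continuousAt hg

lemma hasRes_of_continuousAt (hf : ContinuousAt f x₀) : HasRes f x₀ 0 := by
  have h : Tendsto (fun x => (x - x₀) * f x) (𝓝 x₀) (𝓝 ((x₀ - x₀) * f x₀)) :=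
    (continuousAt_id.sub continuousAt_const).mul hf
  rw [sub_self, zero_mul] at h
  exact h.mono_left nhdsWithin_le_nhds

lemma HasRes.sub (hf : HasRes f x₀ l) (hg : HasRes g x₀ l') :
    HasRes (fun x => f x - g x) x₀ (l - l') :=
  (Tendsto.sub hf hg).congr fun x => by ring

lemma HasRes.add (hf : HasRes f x₀ l) (hg : HasRes g x₀ l') :
    HasRes (fun x => f x + g x) x₀ (l + l') :=
  (Tendsto.add hf hg).congr fun x => by ring

lemma HasRes.const_mul (c : ℂ) (hf : HasRes f x₀ l) :
    HasRes (fun x => c * f x) x₀ (c * l) :=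
  (Tendsto.const_mul c hf).congr fun x => by ring

lemma HasRes.sum {ι : Type*} {s : Finset ι} {f : ι → ℂ → ℂ} {l : ι → ℂ}
    (hf : ∀ i ∈ s, HasRes (f i) x₀ (l i)) :
    HasRes (fun x => ∑ i ∈ s, f i x) x₀ (∑ i ∈ s, l i) :=
  (tendsto_finsetSum s hf).congr fun x => by rw [Finset.mul_sum]

lemma HasRes.comp_neg (hf : HasRes f x₀ l) : HasRes (fun x => f (-x)) (-x₀) (-l) := by
  have hmap : Tendsto (fun x : ℂ => -x) (𝓝[≠] (-x₀)) (𝓝[≠] x₀) := by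
    refine tendsto_nhdsWithin_of_tendsto_nhds_of_eventually_within _ ?_ ?_
    · have := (continuous_neg (G := ℂ)).tendsto (-x₀)
      rw [neg_neg] at this
      exact this.mono_left nhdsWithin_le_nhds
    · filter_upwards [self_mem_nhdsWithin] with x hx h
      exact hx (by rw [← (h : -x = x₀), neg_neg]; rfl)
  exact (Tendsto.comp hf hmap).neg.congr fun x => by simp only [Function.comp_apply]; ring

lemma HasRes.comp_add (hf : HasRes f x₀ l) (c : ℂ) :
    HasRes (fun x => f (x + c)) (x₀ - c) l := by
  have hmap : Tendsto (fun x : ℂ => x + c) (𝓝[≠] (x₀ - c)) (𝓝[≠] x₀) := by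
    refine tendsto_nhdsWithin_of_tendsto_nhds_of_eventually_within _ ?_ ?_
    · have := (continuous_add_const c).tendsto (x₀ - c)
      rw [sub_add_cancel] at this
      exact this.mono_left nhdsWithin_le_nhds
    · filter_upwards [self_mem_nhdsWithin] with x hx h
      exact hx (by rw [← (h : x + c = x₀), add_sub_cancel_right]; rfl)
  exact (Tendsto.comp hf hmap).congr fun x => by simp only [Function.comp_apply]; ring

lemma HasRes.unique (hf : HasRes f x₀ l) (hf' : HasRes f x₀ l') : l = l' :=
  tendsto_nhds_unique hf hf'

/-- An even `ω`-periodic function has no simple pole at `ω / 2`. -/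
lemma HasRes.eq_zero_of_even {ω : ℂ} (hf : HasRes f x₀ l) (hx : 2 * x₀ = ω)
    (heven : ∀ x, f (-x) = f x) (hper : ∀ x, f (x + ω) = f x) : l = 0 := by
  -- The map x ↦ ω - x fixes x₀ and preserves f, but it reverses the sign of the residue.
  have h1 := hf.comp_neg.comp_add (-ω)
  have h2 : (fun x => f (-(x + -ω))) = f := by
    funext x
    rw [heven, ← hper, neg_add_cancel_right]
  have h3 : -x₀ - -ω = x₀ := by linear_combination -hx
  rw [h2, h3] at h1
  have := h1.unique hf
  linear_combination -(1 / 2 : ℂ) * this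

end Residues

/-! ### Poles of the reciprocal bracket -/

section PoleOfBr

variable {L : PeriodPair} {κ : ℂ}

/-- Quasi-periodicity moves the zero at ω to the origin, where [t]/t tends to 1. -/
lemma hasRes_inv_br {α β x₀ ω : ℂ} (hα : α ≠ 0) (hω : ω ∈ L.lattice) (h : α * x₀ + β = ω) :
    HasRes (fun x => (br L κ (α * x + β))⁻¹) x₀
      (α * (signChar L ω * e (quasiPeriod L κ ω * (ω / 2))))⁻¹ := by
  have hmap : Tendsto (fun x : ℂ => α * (x - x₀)) (𝓝[≠] x₀) (𝓝[≠] 0) := by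
    refine tendsto_nhdsWithin_of_tendsto_nhds_of_eventually_within _ ?_ ?_
    · have hc : Continuous fun x : ℂ => α * (x - x₀) := by fun_prop
      have := hc.tendsto x₀
      rw [sub_self, mul_zero] at this
      exact this.mono_left nhdsWithin_le_nhds
    · filter_upwards [self_mem_nhdsWithin] with x hx
      exact mul_ne_zero hα (sub_ne_zero.mpr hx)
  have h1 := ((tendsto_br_div_zero L κ).comp hmap).inv₀ one_ne_zero
  have h2 : Tendsto (fun x => (α * (signChar L ω *
      e (quasiPeriod L κ ω * (α * (x - x₀) + ω / 2))))⁻¹) (𝓝[≠] x₀)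
      (𝓝 (α * (signChar L ω * e (quasiPeriod L κ ω * (ω / 2))))⁻¹) := by
    have hne : α * (signChar L ω * e (quasiPeriod L κ ω * (α * (x₀ - x₀) + ω / 2))) ≠ 0 :=
      mul_ne_zero hα (mul_ne_zero (signChar_ne_zero L ω) (e_ne_zero _))
    have hc : ContinuousAt (fun x => (α * (signChar L ω *
      e (quasiPeriod L κ ω * (α * (x - x₀) + ω / 2))))⁻¹) x₀ := by
      refine ContinuousAt.inv₀ (Continuous.continuousAt ?_) hne
      have := differentiable_e.continuous
      fun_prop
    have := hc.tendsto.mono_left (nhdsWithin_le_nhds (s := {x₀}ᶜ))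
    simpa using this
  have h3 := h1.mul h2
  rw [inv_one, one_mul] at h3
  refine h3.congr fun x => ?_
  have h4 : α * x + β = α * (x - x₀) + ω := by linear_combination h
  simp only [Function.comp_apply]
  rw [h4, br_add_period L κ hω]
  have h5 := e_ne_zero (quasiPeriod L κ ω * (α * (x - x₀) + ω / 2))
  have h6 := signChar_ne_zero L ω
  generalize e (quasiPeriod L κ ω * (α * (x - x₀) + ω / 2)) = q at h5 ⊢
  simp only [inv_div, mul_inv]
  field_simp

lemma signChar_zero : signChar L 0 = 1 := if_pos ⟨0, zero_mem _, by simp⟩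

lemma hasRes_inv_br_zero {α β x₀ : ℂ} (hα : α ≠ 0) (h : α * x₀ + β = 0) :
    HasRes (fun x => (br L κ (α * x + β))⁻¹) x₀ α⁻¹ := by
  simpa [signChar_zero, e_zero] using hasRes_inv_br (L := L) (κ := κ) hα (zero_mem _) h

end PoleOfBr

variable {L : PeriodPair} {κ δ : ℂ}

/-! ### Half-period points -/

lemma om_eq (r : Fin 4) :
    om L r = ((![0, 1, 0, -1] r : ℤ) : ℂ) * L.ω₁ + ((![0, 0, 1, -1] r : ℤ) : ℂ) * L.ω₂ := by
  fin_cases r <;> simp [om]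
  ring

/-- The four periods ω_r lie in distinct classes modulo 2Ω, as the parities of their coordinates
show. -/
lemma half_om_sub_om_notMem {r r' : Fin 4} (h : r ≠ r') :
    (1 / 2) * (om L r - om L r') ∉ L.lattice := by
  intro hmem
  obtain ⟨m, n, hmn⟩ := PeriodPair.mem_lattice.mp hmem
  rw [om_eq, om_eq] at hmn
  set α : Fin 4 → ℤ := ![0, 1, 0, -1] with hα
  set β : Fin 4 → ℤ := ![0, 0, 1, -1] with hβ
  have h1 := LinearIndependent.pair_iff.mp L.indep
    (2 * m - (α r - α r')) (2 * n - (β r - β r')) (by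
      simp only [Complex.real_smul]
      push_cast
      linear_combination 2 * hmn)
  have h2 : 2 * m - (α r - α r') = 0 := by exact_mod_cast h1.1
  have h3 : 2 * n - (β r - β r') = 0 := by exact_mod_cast h1.2
  revert h h2 h3
  fin_cases r <;> fin_cases r' <;> simp [hα, hβ] <;> omega

/-- The ω_r represent every class modulo 2Ω, so the points (ω_r - δ)/2 are all zeros of [2x + δ] up
to periods. -/
lemma exists_half_period {x : ℂ} (h : 2 * x + δ ∈ L.lattice) :
    ∃ r, ∃ ω ∈ L.lattice, x = (1 / 2) * (om L r - δ) + ω := by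
  obtain ⟨m, n, hmn⟩ := PeriodPair.mem_lattice.mp h
  have key : ∀ (r : Fin 4) (m' n' : ℤ), m * L.ω₁ + n * L.ω₂ =
      om L r + 2 * (m' * L.ω₁ + n' * L.ω₂) →
      ∃ r, ∃ ω ∈ L.lattice, x = (1 / 2) * (om L r - δ) + ω := fun r m' n' he =>
    ⟨r, _, PeriodPair.mem_lattice.mpr ⟨m', n', rfl⟩, by linear_combination (he - hmn) / 2⟩
  rcases Int.even_or_odd' m with ⟨m', rfl | rfl⟩ <;> rcases Int.even_or_odd' n with ⟨n', rfl | rfl⟩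
  · exact key 0 m' n' (by simp [om]; ring)
  · exact key 2 m' n' (by simp [om]; ring)
  · exact key 1 m' n' (by simp [om]; ring)
  -- The shift by 1 compensates the minus signs in ω_3 = -ω_1 - ω_2.
  · exact key 3 (m' + 1) (n' + 1) (by simp [om]; ring)

/-! ### Residues of the building blocks -/

lemma continuousAt_Azero (a : Fin 8 → ℂ) {c x₀ : ℂ} (h1 : br L κ (2 * x₀ + δ) ≠ 0)
    (h2 : br L κ (2 * x₀ - δ) ≠ 0)
    (hc1 : br L κ (2 * c + δ) ≠ 0) (hc2 : br L κ (2 * c - δ) ≠ 0) :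
    ContinuousAt (fun x => Azero L κ δ a (fun _ => c) x) x₀ := by
  change ContinuousAt (fun x => ∑ r, AzeroTerm L κ δ a r c x) x₀
  exact tendsto_finsetSum _ fun r _ => continuousAt_AzeroTerm (a := fun _ => a) (c := fun _ => c)
    (x := fun x => x) continuousAt_const continuousAt_const continuousAt_id r
    (brPM_half_ne_zero h1 h2 r) (brPM_half_ne_zero hc1 hc2 r)

lemma continuousAt_prod_br (a : Fin 8 → ℂ) (x₀ : ℂ) :
    ContinuousAt (fun x => ∏ p, br L κ (x + a p)) x₀ :=
  tendsto_finsetProd _ fun _ _ => continuousAt_br (continuousAt_id.add continuousAt_const)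

lemma continuousAt_br_two_mul_add (β x₀ : ℂ) :
    ContinuousAt (fun x => br L κ (2 * x + β)) x₀ :=
  continuousAt_br ((continuousAt_const.mul continuousAt_id).add continuousAt_const)

lemma exists_hasRes_coef (a : Fin 8 → ℂ) {c x₀ : ℂ} (h0 : 2 * x₀ ∈ L.lattice)
    (h1 : br L κ (2 * x₀ + δ) ≠ 0) (h2 : br L κ (2 * x₀ - δ) ≠ 0)
    (hc1 : br L κ (2 * c + δ) ≠ 0) (hc2 : br L κ (2 * c - δ) ≠ 0) (t : SignType) :
    ∃ l, HasRes (coef L κ δ a c t) x₀ l := by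
  have key : ∀ y, 2 * y ∈ L.lattice → br L κ (2 * y + δ) ≠ 0 →
      ∃ l, HasRes (Aplus L κ δ a) y l := by
    intro y hy hy1
    have h := hasRes_inv_br (κ := κ) (α := 2) (β := 0) (x₀ := y) two_ne_zero hy (by ring)
    refine ⟨_, h.of_eq_mul ((continuousAt_prod_br (L := L) (κ := κ) a y).div₀
      (continuousAt_br_two_mul_add δ y) hy1) (fun x => ?_) rfl⟩
    rw [Aplus, add_zero, div_mul_eq_div_div_swap, div_eq_mul_inv, mul_comm]
  cases t
  · exact ⟨0, hasRes_of_continuousAt (continuousAt_Azero a h1 h2 hc1 hc2)⟩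
  · obtain ⟨l, hl⟩ := key (-x₀) (by convert! neg_mem h0 using 1; ring) (by
      rw [br_ne_zero_iff] at h2 ⊢
      intro h
      apply h2
      convert! neg_mem h using 1
      ring)
    have := hl.comp_neg
    rw [neg_neg] at this
    refine ⟨-l, ?_⟩
    simp only [← Aminus_eq] at this
    exact this
  · exact key x₀ h0 h1

lemma hasRes_Aplus_half_period (a : Fin 8 → ℂ) (r : Fin 4)
    (h0 : br L κ (om L r - δ) ≠ 0) :
    HasRes (Aplus L κ δ a) ((1 / 2) * (om L r - δ))
      ((2 * (signChar L (om L r) * e (quasiPeriod L κ (om L r) * (om L r / 2))))⁻¹ *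
        ((∏ p, br L κ ((1 / 2) * (om L r - δ) + a p)) / br L κ (om L r - δ))) := by
  have h2 : 2 * ((1 / 2) * (om L r - δ)) + 0 = om L r - δ := by ring
  have h := hasRes_inv_br (κ := κ) (α := 2) (β := δ) (x₀ := (1 / 2) * (om L r - δ)) two_ne_zero
    (om_mem r) (by ring)
  refine h.of_eq_mul ((continuousAt_prod_br (L := L) (κ := κ) a _).div₀
      (continuousAt_br_two_mul_add 0 _) (by rwa [h2])) (fun x => ?_) (by rw [h2])
  rw [Aplus, add_zero, div_mul_eq_div_div, div_eq_mul_inv, mul_comm]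

/-- Only the r-th summand is singular here. At the pole x = h its factor [x ± c] cancels [h ± c], so
the residue does not depend on c. -/
lemma hasRes_Azero_half_period (a : Fin 8 → ℂ) (r : Fin 4) {c : ℂ}
    (hδ1 : δ ∉ L.lattice) (hδ2 : 2 * δ ∉ L.lattice)
    (hc1 : br L κ (2 * c + δ) ≠ 0) (hc2 : br L κ (2 * c - δ) ≠ 0) :
    HasRes (Azero L κ δ a fun _ => c) ((1 / 2) * (om L r - δ))
      (-(signChar L (om L r) *
        e ((δ - om L r / 2 - (1 / 2) * ∑ p, a p) * quasiPeriod L κ (om L r)) *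
        ((∏ p, br L κ ((1 / 2) * (om L r - δ) + a p)) / (2 * br L κ (om L r - δ))))) := by
  set h := (1 / 2) * (om L r - δ) with hh
  have hterm : HasRes (fun x => AzeroTerm L κ δ a r c x) h
      (-(signChar L (om L r) *
        e ((δ - om L r / 2 - (1 / 2) * ∑ p, a p) * quasiPeriod L κ (om L r)) *
        ((∏ p, br L κ (h + a p)) / (2 * br L κ (om L r - δ))))) := by
    have hne : br L κ (h + h) ≠ 0 := by
      rw [br_ne_zero_iff]
      intro hm
      apply hδ1
      convert! sub_mem (om_mem r) hm using 1
      rw [hh]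
      ring
    have hcne := brPM_half_ne_zero hc1 hc2 r
    rw [← hh] at hcne
    have hres := hasRes_inv_br_zero (L := L) (κ := κ) (α := -1) (β := h) (x₀ := h)
      (by norm_num) (by ring)
    refine hres.of_eq_mul (g := fun x => signChar L (om L r) *
        e ((δ - om L r / 2 - (1 / 2) * ∑ p, a p) * quasiPeriod L κ (om L r)) *
        (brPM L κ x c * (∏ p, br L κ (h + a p)) / (2 * br L κ (h + x) * brPM L κ h c)))
      (continuousAt_const.mul (ContinuousAt.div₀ ?_ ?_ ?_)) (fun x => ?_) ?_
    · exact (continuousAt_brPM continuousAt_id continuousAt_const).mul continuousAt_const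
    · exact (continuousAt_const.mul
        (continuousAt_br (continuousAt_const.add continuousAt_id))).mul continuousAt_const
    · exact mul_ne_zero (mul_ne_zero two_ne_zero hne) hcne
    · have h3 : -1 * x + h = h - x := by ring
      simp only [h3, AzeroTerm]
      rw [← hh]
      clear_value h
      simp only [brPM, div_eq_mul_inv, mul_inv]
      ring
    · have h2 : h + h = om L r - δ := by rw [hh]; ring
      simp only [h2]
      rw [h2] at hne
      generalize e ((δ - om L r / 2 - (1 / 2) * ∑ p, a p) * quasiPeriod L κ (om L r)) = q
      field_simp
  have hall : ∀ r' ∈ Finset.univ, HasRes (fun x => AzeroTerm L κ δ a r' c x) h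
      (if r' = r then (-(signChar L (om L r) *
        e ((δ - om L r / 2 - (1 / 2) * ∑ p, a p) * quasiPeriod L κ (om L r)) *
        ((∏ p, br L κ (h + a p)) / (2 * br L κ (om L r - δ))))) else 0) := by
    intro r' _
    split_ifs with hr
    · rw [hr]
      exact hterm
    · refine hasRes_of_continuousAt (continuousAt_AzeroTerm (a := fun _ => a) (c := fun _ => c)
        (x := fun x => x) continuousAt_const continuousAt_const continuousAt_id r' ?_
        (brPM_half_ne_zero hc1 hc2 r'))
      rw [brPM_ne_zero_iff]
      -- For r' ≠ r, the sum of the two points is a half-period minus δ, excluded by 2δ ∉ Ω. Their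
      -- difference is half of ω_r' - ω_r.
      refine ⟨fun hm => hδ2 ?_, fun hm => half_om_sub_om_notMem (L := L) hr ?_⟩
      · convert! sub_mem (add_mem (om_mem r) (om_mem r')) (two_mul_mem hm) using 1
        simp only [hh]
        ring
      · convert! hm using 1
        simp only [hh]
        ring
  have := HasRes.sum hall
  simp only [Finset.sum_ite_eq', Finset.mem_univ, if_true] at this
  exact this

/-- The residue of `pairF` at coinciding arguments. -/
def pairRes (L : PeriodPair) (κ δ y : ℂ) : SignType → SignType → ℂ
  | .pos, .neg => br L κ (2 * δ)
  | .neg, .pos => -br L κ (2 * δ)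
  | .pos, .zero => br L κ (2 * y + δ) * br L κ δ / br L κ (2 * y)
  | .zero, .pos => -(br L κ (2 * y + δ) * br L κ δ / br L κ (2 * y))
  | .neg, .zero => -(br L κ (2 * y - δ) * br L κ δ / br L κ (2 * y))
  | .zero, .neg => br L κ (2 * y - δ) * br L κ δ / br L κ (2 * y)
  | _, _ => 0

/-- The interaction is symmetric while x - y changes sign when the variables are exchanged. This
antisymmetry removes the poles on the diagonal. -/
lemma pairRes_swap (y : ℂ) (t t' : SignType) :
    pairRes L κ δ y t t' = -pairRes L κ δ y t' t := by
  cases t <;> cases t' <;> simp [pairRes]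

lemma hasRes_pairF {y : ℂ} (hy : br L κ (2 * y) ≠ 0) (t t' : SignType) :
    HasRes (fun x => pairF L κ δ t t' x y) y (pairRes L κ δ y t t') := by
  have hyy : br L κ (y + y) ≠ 0 := by rwa [← two_mul]
  have hx : ContinuousAt (fun x : ℂ => x) y := continuousAt_id
  have hc : ∀ u : ℂ, ContinuousAt (fun _ : ℂ => u) y := fun u => continuousAt_const
  have hp := hasRes_inv_br_zero (L := L) (κ := κ) (α := 1) (β := -y) (x₀ := y) (by norm_num)
    (by ring)
  have hm := hasRes_inv_br_zero (L := L) (κ := κ) (α := -1) (β := y) (x₀ := y) (by norm_num)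
    (by ring)
  have e1 : ∀ x : ℂ, 1 * x + -y = x - y := fun x => by ring
  have e2 : ∀ x : ℂ, -1 * x + y = y - x := fun x => by ring
  simp only [e1, e2, inv_neg, inv_one] at hp hm
  have d1 : y + δ - y = δ := by ring
  have d2 : y + δ + y = 2 * y + δ := by ring
  have d3 : y - δ + y = 2 * y - δ := by ring
  have d4 : y - δ - y = -δ := by ring
  cases t <;> cases t'
  · exact hasRes_of_continuousAt (hc 1)
  · refine hm.of_eq_mul (g := fun x => brPM L κ (y - δ) x / br L κ (y + x))
      ((continuousAt_brPM (hc _) hx).div₀ (continuousAt_br ((hc y).add hx)) hyy) (fun x => ?_) ?_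
    · simp only [pairF, brPM, div_eq_mul_inv, mul_inv]
      ring
    · simp only [pairRes, brPM, d3, d4, br_neg, two_mul]
      ring
  · refine hm.of_eq_mul (g := fun x => brPM L κ (y + δ) x / br L κ (y + x))
      ((continuousAt_brPM (hc _) hx).div₀ (continuousAt_br ((hc y).add hx)) hyy) (fun x => ?_) ?_
    · simp only [pairF, brPM, div_eq_mul_inv, mul_inv]
      ring
    · simp only [pairRes, brPM, d1, d2, two_mul]
      ring
  · refine hp.of_eq_mul (g := fun x => brPM L κ (x - δ) y / br L κ (x + y))
      ((continuousAt_brPM (hx.sub (hc δ)) (hc y)).div₀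
        (continuousAt_br (hx.add (hc y))) hyy) (fun x => ?_) ?_
    · simp only [pairF, brPM, div_eq_mul_inv, mul_inv]
      ring
    · simp only [pairRes, brPM, d3, d4, br_neg, two_mul]
      ring
  · exact hasRes_of_continuousAt ((continuousAt_br ((hx.add (hc y)).sub (hc (2 * δ)))).div₀
      (continuousAt_br (hx.add (hc y))) hyy)
  · refine hm.of_eq_mul (g := fun x => br L κ (y - x + 2 * δ))
      (continuousAt_br (((hc y).sub hx).add (hc (2 * δ)))) (fun x => ?_) ?_
    · simp only [pairF, div_eq_mul_inv]
      ring
    · simp [pairRes]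
  · refine hp.of_eq_mul (g := fun x => brPM L κ (x + δ) y / br L κ (x + y))
      ((continuousAt_brPM (hx.add (hc δ)) (hc y)).div₀
        (continuousAt_br (hx.add (hc y))) hyy) (fun x => ?_) ?_
    · simp only [pairF, brPM, div_eq_mul_inv, mul_inv]
      ring
    · simp only [pairRes, brPM, d1, d2, two_mul]
      ring
  · refine hp.of_eq_mul (g := fun x => br L κ (x - y + 2 * δ))
      (continuousAt_br ((hx.sub (hc y)).add (hc (2 * δ)))) (fun x => ?_) ?_
    · simp only [pairF, div_eq_mul_inv]
      ring
    · simp [pairRes]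
  · exact hasRes_of_continuousAt ((continuousAt_br ((hx.add (hc y)).add (hc (2 * δ)))).div₀
      (continuousAt_br (hx.add (hc y))) hyy)

/-! ### Splitting sums as functions of one variable -/

section OneVariable

variable {m n : ℕ} {z : Fin m → ℂ} {w : Fin n → ℂ} {x₀ : ℂ}

lemma generic_cons (h : Regular L κ δ x₀) (hx : ∀ j, brPM L κ x₀ (z j) ≠ 0)
    (hz : Generic L κ δ z) : Generic L κ δ (Fin.cons x₀ z : Fin (m + 1) → ℂ) := by
  refine ⟨fun i => Fin.cases h hz.1 i, fun i j => ?_⟩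
  refine Fin.cases ?_ (fun i => ?_) i <;> refine Fin.cases ?_ (fun j => ?_) j
  · intro h
    exact absurd rfl h
  · intro _
    simpa using hx j
  · intro _
    simpa using brPM_ne_zero_comm.mp (hx i)
  · intro hij
    simpa using hz.2 i j fun h => hij (by rw [h])

lemma generic_cons_iff : Generic L κ δ (Fin.cons x₀ z : Fin (m + 1) → ℂ) ↔
    Regular L κ δ x₀ ∧ (∀ j, brPM L κ x₀ (z j) ≠ 0) ∧ Generic L κ δ z := by
  refine ⟨fun h => ⟨h.1 0, fun j => h.2 0 j.succ (Fin.succ_ne_zero j).symm, fun i => h.1 i.succ,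
    fun i j hij => h.2 i.succ j.succ fun h => hij (Fin.succ_injective _ h)⟩,
    fun h => generic_cons h.1 h.2.1 h.2.2⟩

lemma continuousAt_cons {X : Type*} [TopologicalSpace X] {p : X} {f : X → ℂ}
    {g : X → Fin m → ℂ} (hf : ContinuousAt f p) (hg : ContinuousAt g p) :
    ContinuousAt (fun q => (Fin.cons (f q) (g q) : Fin (m + 1) → ℂ)) p := by
  refine continuousAt_pi.mpr fun i => ?_
  refine Fin.cases ?_ (fun i => ?_) i
  · simpa using hf
  · simpa using continuousAt_pi.mp hg i

lemma continuousAt_splitSum_cons (a : Fin 8 → ℂ) {c : ℂ} (h : Regular L κ δ x₀)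
    (hx : ∀ j, brPM L κ x₀ (z j) ≠ 0) (hxw : ∀ k, CrossRegular L κ δ x₀ (w k))
    (hz : Generic L κ δ z) (hzw : ∀ i k, CrossRegular L κ δ (z i) (w k))
    (hc1 : br L κ (2 * c + δ) ≠ 0) (hc2 : br L κ (2 * c - δ) ≠ 0) :
    ContinuousAt (fun x =>
      splitSum L κ δ a (fun _ => c) (Fin.cons x z : Fin (m + 1) → ℂ) w) x₀ :=
  continuousAt_splitSum (a := fun _ => a) (c := fun _ => c)
    (z := fun x => (Fin.cons x z : Fin (m + 1) → ℂ)) (w := fun _ => w) continuousAt_const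
    continuousAt_const (continuousAt_cons continuousAt_id continuousAt_const) continuousAt_const
    (generic_cons h hx hz) hc1 hc2 fun i k => Fin.cases (hxw k) (fun i => hzw i k) i

lemma continuousAt_splitSum_cons_right (a : Fin 8 → ℂ) {c : ℂ}
    (hxz : ∀ i, CrossRegular L κ δ (z i) x₀)
    (hz : Generic L κ δ z) (hzw : ∀ i k, CrossRegular L κ δ (z i) (w k))
    (hc1 : br L κ (2 * c + δ) ≠ 0) (hc2 : br L κ (2 * c - δ) ≠ 0) :
    ContinuousAt (fun x =>
      splitSum L κ δ a (fun _ => c) z (Fin.cons x w : Fin (n + 1) → ℂ)) x₀ :=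
  continuousAt_splitSum (a := fun _ => a) (c := fun _ => c) (z := fun _ => z)
    (w := fun x => (Fin.cons x w : Fin (n + 1) → ℂ)) continuousAt_const continuousAt_const
    continuousAt_const (continuousAt_cons continuousAt_id continuousAt_const)
    hz hc1 hc2 fun i k => Fin.cases (hxz i) (fun k => hzw i k) k

lemma continuousAt_pairSum_pairF {X : Type*} [TopologicalSpace X] {p : X} {x : X → ℂ}
    {A : X → Fin m → SignType → ℂ} (hx : ContinuousAt x p)
    (hxz : ∀ j, brPM L κ (x p) (z j) ≠ 0) (hz : Generic L κ δ z)
    (hA : ∀ i t, ContinuousAt (fun q => A q i t) p) (t : SignType) :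
    ContinuousAt (fun q => pairSum L κ δ z
      (fun i t' => A q i t' * pairF L κ δ t t' (x q) (z i))) p :=
  continuousAt_pairSum (z := fun _ => z) continuousAt_const
    (fun i t' => (hA i t').mul (continuousAt_pairF hx continuousAt_const (hxz i) t t')) hz.2

lemma continuousAt_pairSum_weight {a : Fin 8 → ℂ} {c : ℂ} (hx : ∀ j, brPM L κ x₀ (z j) ≠ 0)
    (hz : Generic L κ δ z) (t : SignType) :
    ContinuousAt (fun x => pairSum L κ δ z
      (fun i t' => weight L κ δ a c w (z i) t' * pairF L κ δ t t' x (z i))) x₀ :=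
  continuousAt_pairSum_pairF (p := x₀) (x := fun x => x)
    (A := fun _ i t' => weight L κ δ a c w (z i) t') continuousAt_id hx hz
    (fun _ _ => continuousAt_const) t

lemma continuousAt_prod_crossF (hxw : ∀ k, CrossRegular L κ δ x₀ (w k)) (t : SignType) :
    ContinuousAt (fun x => ∏ k, crossF L κ δ t x (w k)) x₀ := by
  have h : ∀ k, ContinuousAt (fun x => crossF L κ δ t x (w k)) x₀ := fun k =>
    continuousAt_crossF (p := x₀) (x := fun x => x) (w := fun _ => w k) continuousAt_id
      continuousAt_const (hxw k) t
  exact tendsto_finsetProd _ fun k _ => h k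

/-- Existence of the residue at a half-period. -/
lemma exists_hasRes_splitSum_half (a : Fin 8 → ℂ) {c : ℂ} (h0 : 2 * x₀ ∈ L.lattice)
    (h1 : br L κ (2 * x₀ + δ) ≠ 0) (h2 : br L κ (2 * x₀ - δ) ≠ 0)
    (hx : ∀ j, brPM L κ x₀ (z j) ≠ 0) (hxw : ∀ k, CrossRegular L κ δ x₀ (w k))
    (hz : Generic L κ δ z)
    (hc1 : br L κ (2 * c + δ) ≠ 0) (hc2 : br L κ (2 * c - δ) ≠ 0) :
    ∃ l, HasRes (fun x =>
      splitSum L κ δ a (fun _ => c) (Fin.cons x z : Fin (m + 1) → ℂ) w) x₀ l := by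
  choose l hl using exists_hasRes_coef (κ := κ) (δ := δ) a h0 h1 h2 hc1 hc2
  have hsum : (fun x => splitSum L κ δ a (fun _ => c) (Fin.cons x z : Fin (m + 1) → ℂ) w) =
      fun x => ∑ t, coef L κ δ a c t x * ((∏ k, crossF L κ δ t x (w k)) *
        pairSum L κ δ z fun i t' =>
          weight L κ δ a c w (z i) t' * pairF L κ δ t t' x (z i)) := by
    funext x
    rw [splitSum_succ]
    refine Finset.sum_congr rfl fun t _ => ?_
    rw [weight, mul_assoc]
  rw [hsum]
  exact ⟨_, HasRes.sum fun t _ => (hl t).mul_continuousAt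
    ((continuousAt_prod_crossF hxw t).mul (continuousAt_pairSum_weight hx hz t))⟩

/-- At h = (ω_r - δ)/2 the shift is a reflection, h + δ = -h + ω_r. Sign + at h therefore acts on
other variables like sign 0, up to a multiplier. -/
lemma pairF_half_period {r : Fin 4} {y : ℂ}
    (hy : brPM L κ ((1 / 2) * (om L r - δ)) y ≠ 0) (t : SignType) :
    pairF L κ δ .pos t ((1 / 2) * (om L r - δ)) y =
      e (quasiPeriod L κ (om L r) * δ) * pairF L κ δ .zero t ((1 / 2) * (om L r - δ)) y := by
  set h := (1 / 2) * (om L r - δ) with hh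
  set η := quasiPeriod L κ (om L r) with hη
  have hδ : h + δ = -h + om L r := by rw [hh]; ring
  have key : ∀ y, brPM L κ h y ≠ 0 → pairF L κ δ .pos .pos h y =
      e (η * δ) * pairF L κ δ .zero .pos h y := by
    intro y hy
    obtain ⟨hy1, hy2⟩ := mul_ne_zero_iff.mp hy
    have e1 : h + y + 2 * δ = y + δ - h + om L r := by linear_combination hδ
    have e2 : y + δ + h = y - h + om L r := by linear_combination hδ
    have e3 : e (η * (y + δ - h + om L r / 2)) = e (η * δ) * e (η * (y - h + om L r / 2)) := by
      rw [← e_add]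
      congr 1
      ring
    simp only [pairF, brPM]
    rw [e1, e2, br_add_period L κ (om_mem r), br_add_period L κ (om_mem r), ← hη, e3,
      add_comm y h]
    have hy3 : br L κ (y - h) ≠ 0 := by
      rw [br_sub_comm, neg_ne_zero]
      exact hy2
    have := e_ne_zero (η * (y - h + om L r / 2))
    generalize e (η * (y - h + om L r / 2)) = q
    generalize e (η * δ) = q'
    field_simp
  cases t
  · simp only [pairF]
    have h2 : η * (2 * -h + om L r) = η * δ := by rw [hh]; ring
    rw [hδ, brPM_add_period_left L κ (om_mem r), ← hη, brPM_neg_left, mul_div_assoc,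
      div_self hy, h2]
  · have hflip : ∀ s, pairF L κ δ s .neg h y = pairF L κ δ s .pos h (-y) := by
      intro s
      rw [pairF_comm, pairF_comm L κ δ s]
      exact pairF_neg_left L κ δ .pos s y h
    rw [hflip, hflip]
    exact key _ (by rwa [brPM_neg_right])
  · exact key y hy

/-- The poles of `A⁺` and `A⁰` at `(ω_r - δ) / 2` cancel. -/
lemma hasRes_splitSum_half_period (a : Fin 8 → ℂ) {c : ℂ} (r : Fin 4)
    (hδ1 : δ ∉ L.lattice) (hδ2 : 2 * δ ∉ L.lattice)
    (hbal : ∑ p, a p = (4 - 2 * ((m + 1 : ℕ) : ℂ) + 2 * (n : ℂ)) * δ)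
    (hx0 : x₀ = (1 / 2) * (om L r - δ))
    (hx : ∀ j, brPM L κ x₀ (z j) ≠ 0) (hxw : ∀ k, CrossRegular L κ δ x₀ (w k))
    (hz : Generic L κ δ z)
    (hc1 : br L κ (2 * c + δ) ≠ 0) (hc2 : br L κ (2 * c - δ) ≠ 0) :
    HasRes (fun x =>
      splitSum L κ δ a (fun _ => c) (Fin.cons x z : Fin (m + 1) → ℂ) w) x₀ 0 := by
  set η := quasiPeriod L κ (om L r) with hη
  set B : SignType → ℂ → ℂ := fun t x => pairSum L κ δ z
    (fun i t' => weight L κ δ a c w (z i) t' * pairF L κ δ t t' x (z i)) with hB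
  have hBc : ∀ t, ContinuousAt (B t) x₀ := fun t =>
    continuousAt_pairSum_weight hx hz t
  have hcross := continuousAt_prod_crossF (x₀ := x₀) hxw
  have hne : br L κ (om L r - δ) ≠ 0 := by
    rw [br_ne_zero_iff]
    intro h
    apply hδ1
    convert! sub_mem (om_mem r) h using 1
    ring
  have hpos := hasRes_Aplus_half_period a r hne
  have hzero := hasRes_Azero_half_period a r hδ1 hδ2 hc1 hc2
  rw [← hx0, ← hη] at hpos hzero
  have hneg : ContinuousAt (fun x => Aminus L κ δ a x) x₀ := by
    simp only [Aminus_eq]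
    refine continuousAt_Aplus continuousAt_const continuousAt_neg ?_ ?_
    · rw [mul_neg, br_neg, neg_ne_zero, hx0]
      convert! hne using 2
      ring
    · rw [br_ne_zero_iff]
      intro h
      apply hδ2
      convert! add_mem (om_mem r) h using 1
      rw [hx0]
      ring
  -- Each of the m remaining variables contributes one multiplier e(ηδ).
  have hB0 : B .pos x₀ = e (m * (η * δ)) * B .zero x₀ := by
    have h1 : e (m * (η * δ)) = ∏ _i : Fin m, e (η * δ) := by rw [← e_sum]; simp
    rw [h1]
    simp only [hB]
    rw [← pairSum_const_mul]
    congr 1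
    funext i t'
    have := pairF_half_period (L := L) (κ := κ) (δ := δ) (r := r) (y := z i)
      (by rw [← hx0]; exact hx i) t'
    rw [← hx0] at this
    rw [this]
    ring
  -- By the same reflection, each of the n cross factors contributes e(-ηδ).
  have hcr : ∏ k, crossF L κ δ .pos x₀ (w k) = e (-(n * (η * δ))) := by
    have h1 : -(n * (η * δ)) = ∑ _k : Fin n, -(η * δ) := by simp
    rw [h1, e_sum]
    refine Finset.prod_congr rfl fun k _ => ?_
    have h2 : x₀ + δ = -x₀ + om L r := by rw [hx0]; ring
    have h3 := (hxw k).1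
    have h4 : η * (2 * -x₀ + om L r) = η * δ := by rw [hx0]; ring
    simp only [crossF]
    rw [h2, brPM_add_period_left L κ (om_mem r), brPM_neg_left, mul_ne_zero_iff] at h3
    rw [h2, brPM_add_period_left L κ (om_mem r), brPM_neg_left, ← hη, h4, e_neg,
      div_mul_cancel_right₀ h3.2]
  set P := ∏ p, br L κ (x₀ + a p) with hP
  have hsum : (fun x => splitSum L κ δ a (fun _ => c) (Fin.cons x z : Fin (m + 1) → ℂ) w) =
      fun x => Aplus L κ δ a x * ((∏ k, crossF L κ δ .pos x (w k)) * B .pos x) +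
        Azero L κ δ a (fun _ => c) x * ((∏ k, crossF L κ δ .zero x (w k)) * B .zero x) +
        Aminus L κ δ a x * ((∏ k, crossF L κ δ .neg x (w k)) * B .neg x) := by
    funext x
    rw [splitSum_succ]
    have huniv : (Finset.univ : Finset SignType) = {.pos, .zero, .neg} := by decide
    rw [huniv, Finset.sum_insert (by decide), Finset.sum_insert (by decide),
      Finset.sum_singleton]
    simp only [weight, coef, hB]
    ring
  rw [hsum]
  have hres := ((hpos.mul_continuousAt ((hcross .pos).mul (hBc .pos))).add
    (hzero.mul_continuousAt ((hcross .zero).mul (hBc .zero)))).add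
    (hasRes_of_continuousAt (hneg.mul ((hcross .neg).mul (hBc .neg))))
  convert! hres using 1
  have hc0 : ∏ k, crossF L κ δ .zero x₀ (w k) = 1 := Finset.prod_eq_one fun k _ => rfl
  simp only [Pi.mul_apply]
  rw [hcr, hB0, hc0]
  have hε := signChar_sq L (om L r)
  have hε0 := signChar_ne_zero L (om L r)
  -- By the balancing condition, the exponential in A⁰ is exactly the one that cancels the A⁺
  -- residue.
  have hexp : e ((δ - om L r / 2 - 1 / 2 * ∑ p, a p) * η) * e (η * (om L r / 2)) =
      e (-(n * (η * δ))) * e (m * (η * δ)) := by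
    rw [← e_add, ← e_add, hbal]
    congr 1
    push_cast
    ring
  have hq := e_ne_zero (η * (om L r / 2))
  generalize e (-(n * (η * δ))) = q1 at *
  generalize e (m * (η * δ)) = q2 at *
  generalize e (η * (om L r / 2)) = q3 at *
  generalize e ((δ - om L r / 2 - 1 / 2 * ∑ p, a p) * η) = q4 at *
  field_simp
  linear_combination (B .zero x₀ * P) * (hexp + q4 * q3 * hε)

end OneVariable

/-- The poles of the splitting sum at coinciding variables cancel. -/
lemma hasRes_splitSum_diagonal (a : Fin 8 → ℂ) {c y : ℂ} {m n : ℕ} {z : Fin m → ℂ}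
    {w : Fin n → ℂ} (hz : Generic L κ δ (Fin.cons y z : Fin (m + 1) → ℂ))
    (hyw : ∀ k, CrossRegular L κ δ y (w k))
    (hc1 : br L κ (2 * c + δ) ≠ 0) (hc2 : br L κ (2 * c - δ) ≠ 0) :
    HasRes (fun x => splitSum L κ δ a (fun _ => c)
      (Fin.cons x (Fin.cons y z : Fin (m + 1) → ℂ) : Fin (m + 1 + 1) → ℂ) w) y 0 := by
  obtain ⟨hy, hyz, hz'⟩ := generic_cons_iff.mp hz
  set T : SignType → SignType → ℂ → ℂ := fun t t' x => pairSum L κ δ z fun i t'' =>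
    weight L κ δ a c w (z i) t'' * pairF L κ δ t t'' x (z i) * pairF L κ δ t' t'' y (z i) with hT
  have hTc : ∀ t t', ContinuousAt (T t t') y := fun t t' =>
    continuousAt_pairSum_pairF (A := fun x i t'' => weight L κ δ a c w (z i) t'' *
      pairF L κ δ t t'' x (z i)) continuousAt_const hyz hz' (fun i t'' =>
      continuousAt_const.mul (continuousAt_pairF continuousAt_id continuousAt_const (hyz i) _ _)) t'
  have hTs : ∀ t t', T t t' y = T t' t y := fun t t' => by
    simp only [hT]
    congr 1
    funext i t''
    ring
  have hw : ∀ t, ContinuousAt (fun x => weight L κ δ a c w x t) y := fun t =>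
    continuousAt_weight (a := fun _ => a) (c := fun _ => c) (x := fun x => x) (w := fun _ => w)
      continuousAt_const continuousAt_const continuousAt_id continuousAt_const hy hc1 hc2 hyw t
  have hsum : (fun x => splitSum L κ δ a (fun _ => c)
      (Fin.cons x (Fin.cons y z : Fin (m + 1) → ℂ) : Fin (m + 1 + 1) → ℂ) w) = fun x =>
      ∑ t, ∑ t', pairF L κ δ t t' x y *
        (weight L κ δ a c w x t * weight L κ δ a c w y t' * T t t' x) := by
    funext x
    rw [splitSum_succ]
    refine Finset.sum_congr rfl fun t _ => ?_
    rw [pairSum_succ, Finset.mul_sum]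
    refine Finset.sum_congr rfl fun t' _ => ?_
    simp only [Fin.cons_zero, Fin.cons_succ, hT]
    ring
  rw [hsum]
  have hres : HasRes (fun x => ∑ t, ∑ t', pairF L κ δ t t' x y *
        (weight L κ δ a c w x t * weight L κ δ a c w y t' * T t t' x)) y
      (∑ t, ∑ t', pairRes L κ δ y t t' *
        (weight L κ δ a c w y t * weight L κ δ a c w y t' * T t t' y)) :=
    HasRes.sum fun t _ => HasRes.sum fun t' _ => (hasRes_pairF hy.1 t t').mul_continuousAt
      (((hw t).mul continuousAt_const).mul (hTc t t'))
  set R := ∑ t, ∑ t', pairRes L κ δ y t t' *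
        (weight L κ δ a c w y t * weight L κ δ a c w y t' * T t t' y) with hR
  -- Exchanging the signs t and t' reverses `pairRes` and, at x = y, preserves the remaining
  -- factors.
  have hanti : R = -R := by
    conv_lhs => rw [hR, Finset.sum_comm]
    rw [hR, ← Finset.sum_neg_distrib]
    refine Finset.sum_congr rfl fun t _ => ?_
    rw [← Finset.sum_neg_distrib]
    refine Finset.sum_congr rfl fun t' _ => ?_
    rw [pairRes_swap, hTs]
    ring
  have hR0 : R = 0 := by linear_combination (1 / 2 : ℂ) * hanti
  rwa [hR0] at hres

/-! ### Poles at the variables of the other family -/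

/-- When x + δ = v, the effects on y of v and of x with sign + combine to a factor that does not see
the sign of y. It can be pulled out of the splitting sum, leaving one without x and v. -/
lemma crossF_mul_pairF {x v y : ℂ} (hv : x + δ = v) (hxy : brPM L κ x y ≠ 0)
    (hyv : CrossRegular L κ δ y v) (t : SignType) :
    crossF L κ δ t y v * pairF L κ δ .pos t x y = brPM L κ y v / brPM L κ y x := by
  have key : ∀ y, brPM L κ x y ≠ 0 → CrossRegular L κ δ y v →
      crossF L κ δ .pos y v * pairF L κ δ .pos .pos x y = brPM L κ y v / brPM L κ y x := by
    intro y hxy hyv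
    obtain ⟨h1, h2⟩ := mul_ne_zero_iff.mp hxy
    obtain ⟨h3, h4⟩ := mul_ne_zero_iff.mp hyv.1
    have e1 : x + y + 2 * δ = y + δ + v := by linear_combination hv
    have e2 : y + δ - v = y - x := by linear_combination hv
    simp only [crossF, pairF, brPM] at *
    rw [e2] at h4
    rw [e1, e2, add_comm y x]
    field_simp
  cases t
  · simp only [crossF, pairF, one_mul]
    rw [hv, brPM_swap L κ v y, brPM_swap L κ x y, neg_div_neg_eq]
  · have h1 : pairF L κ δ .pos .neg x y = pairF L κ δ .pos .pos x (-y) := by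
      rw [pairF_comm, pairF_comm L κ δ .pos]
      exact pairF_neg_left L κ δ .pos .pos y x
    have h2 : crossF L κ δ .neg y v = crossF L κ δ .pos (-y) v := crossF_neg_left L κ δ .pos y v
    rw [h1, h2, key (-y) (by rwa [brPM_neg_right]), brPM_neg_left, brPM_neg_left]
    refine ⟨?_, ?_⟩
    · rw [← brPM_neg_left]
      convert! hyv.2 using 2
      ring
    · rw [← brPM_neg_left]
      convert! hyv.1 using 2
      ring
  · exact key y hxy hyv

/-- The pole of the splitting sum where `x + δ` meets a variable `v` of the other family; both
may move. -/
lemma hasRes_splitSum_cross (a : Fin 8 → ℂ) {c : ℂ} {m n : ℕ} {z : Fin m → ℂ} {w : Fin n → ℂ}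
    {x v : ℂ → ℂ} {t₀ x₀ v₀ : ℂ} (hxc : ContinuousAt x t₀) (hvc : ContinuousAt v t₀)
    (hx₀ : x t₀ = x₀) (hv₀ : v t₀ = v₀) (hxv : x₀ + δ = v₀)
    (hpole : HasRes (fun t => (br L κ (x t + δ - v t))⁻¹) t₀ 1)
    (hδ2 : 2 * δ ∉ L.lattice)
    (hx : Regular L κ δ x₀) (hv : br L κ (2 * v₀) ≠ 0)
    (hxw : ∀ k, CrossRegular L κ δ x₀ (w k)) (hxz : ∀ j, brPM L κ x₀ (z j) ≠ 0)
    (hz : Generic L κ δ z) (hzw : ∀ i k, CrossRegular L κ δ (z i) (w k))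
    (hzv : ∀ i, CrossRegular L κ δ (z i) v₀)
    (hc1 : br L κ (2 * c + δ) ≠ 0) (hc2 : br L κ (2 * c - δ) ≠ 0) :
    HasRes (fun t => splitSum L κ δ a (fun _ => c) (Fin.cons (x t) z : Fin (m + 1) → ℂ)
      (Fin.cons (v t) w : Fin (n + 1) → ℂ)) t₀
      (br L κ (2 * x₀ + δ) * br L κ (-δ) / br L κ (2 * v₀) *
        (Aplus L κ δ a x₀ * (∏ k, crossF L κ δ .pos x₀ (w k)) *
        ((∏ j, brPM L κ (z j) v₀ / brPM L κ (z j) x₀) *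
          splitSum L κ δ a (fun _ => c) z w))) := by
  have hwt : ∀ s, ContinuousAt (fun t => weight L κ δ a c w (x t) s) t₀ := fun s =>
    continuousAt_weight (a := fun _ => a) (c := fun _ => c) (w := fun _ => w)
      continuousAt_const continuousAt_const hxc continuousAt_const (by rwa [hx₀]) hc1 hc2
      (by rwa [hx₀]) s
  have hB : ∀ s, ContinuousAt (fun t => pairSum L κ δ z (fun i t' =>
      weight L κ δ a c (Fin.cons (v t) w : Fin (n + 1) → ℂ) (z i) t' *
        pairF L κ δ s t' (x t) (z i))) t₀ := fun s =>
    continuousAt_pairSum_pairF hxc (by rwa [hx₀]) hz (fun i t' =>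
      continuousAt_weight (a := fun _ => a) (c := fun _ => c) (x := fun _ => z i)
      (w := fun t => (Fin.cons (v t) w : Fin (n + 1) → ℂ))
      continuousAt_const continuousAt_const continuousAt_const
      (continuousAt_cons hvc continuousAt_const) (hz.1 i) hc1 hc2
      (fun k => Fin.cases (by simpa [hv₀] using hzv i) (fun k => hzw i k) k) t') s
  have hv2 : br L κ (x t₀ + δ + v t₀) ≠ 0 := by
    rw [hx₀, hv₀, hxv, ← two_mul]
    exact hv
  have hpos : HasRes (fun t => crossF L κ δ .pos (x t) (v t)) t₀
      (br L κ (2 * x₀ + δ) * br L κ (-δ) / br L κ (2 * v₀)) := by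
    refine hpole.of_eq_mul (g := fun t => brPM L κ (x t) (v t) / br L κ (x t + δ + v t))
      ((continuousAt_brPM hxc hvc).div₀
      (continuousAt_br ((hxc.add continuousAt_const).add hvc)) hv2) (fun t => ?_) ?_
    · simp only [crossF]
      conv_lhs => rw [brPM.eq_1 L κ (x t + δ)]
      simp only [div_eq_mul_inv, mul_inv]
      ring
    · have e1 : x₀ + v₀ = 2 * x₀ + δ := by linear_combination -hxv
      have e2 : x₀ - v₀ = -δ := by linear_combination hxv
      have e3 : x₀ + δ + v₀ = 2 * v₀ := by linear_combination hxv
      simp only [hx₀, hv₀, brPM, e1, e2, e3, one_mul]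
  have hneg : ContinuousAt (fun t => crossF L κ δ .neg (x t) (v t)) t₀ := by
    refine (continuousAt_brPM hxc hvc).div₀
      (continuousAt_brPM (hxc.sub continuousAt_const) hvc) ?_
    rw [hx₀, hv₀, brPM_ne_zero_iff]
    refine ⟨fun h => br_ne_zero_iff.mp hx.1 ?_, fun h => hδ2 ?_⟩
    · convert! h using 1
      linear_combination hxv
    · convert! neg_mem h using 1
      linear_combination hxv
  -- Only sign + puts [x + δ - v] into the denominator.
  have hcr : ∀ s, HasRes (fun t => crossF L κ δ s (x t) (v t)) t₀
      (if s = .pos then br L κ (2 * x₀ + δ) * br L κ (-δ) / br L κ (2 * v₀) else 0) := by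
    intro s
    cases s
    · exact hasRes_of_continuousAt continuousAt_const
    · exact hasRes_of_continuousAt hneg
    · exact hpos
  have hval : pairSum L κ δ z (fun i t' =>
      weight L κ δ a c (Fin.cons v₀ w : Fin (n + 1) → ℂ) (z i) t' *
        pairF L κ δ .pos t' x₀ (z i)) =
      (∏ j, brPM L κ (z j) v₀ / brPM L κ (z j) x₀) * splitSum L κ δ a (fun _ => c) z w := by
    rw [splitSum_eq_pairSum, ← pairSum_const_mul]
    congr 1
    funext i t'
    rw [weight_cons, mul_assoc, crossF_mul_pairF hxv (hxz i) (hzv i)]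
    ring
  have hres := HasRes.sum (s := Finset.univ) fun s _ =>
    (hcr s).mul_continuousAt ((hwt s).mul (hB s))
  simp only [ite_mul, zero_mul, Finset.sum_ite_eq', Finset.mem_univ, if_true, Pi.mul_apply,
    hx₀, hv₀,
    hval] at hres
  refine Tendsto.congr (fun t => ?_) hres
  simp only [splitSum_succ]
  congr 1
  refine Finset.sum_congr rfl fun s _ => ?_
  rw [weight_cons, ← mul_assoc, mul_comm (crossF _ _ _ _ _ _)]

/-! ### The splitting sum has only removable singularities in the regular domain -/

lemma splitSum_cons_comp_perm (a : Fin 8 → ℂ) (c : ℂ) {m n : ℕ} (σ : Equiv.Perm (Fin m)) (x : ℂ)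
    (z : Fin m → ℂ) (w : Fin n → ℂ) :
    splitSum L κ δ a (fun _ => c) (Fin.cons x (z ∘ σ) : Fin (m + 1) → ℂ) w =
      splitSum L κ δ a (fun _ => c) (Fin.cons x z : Fin (m + 1) → ℂ) w := by
  rw [splitSum_succ, splitSum_succ]
  refine Finset.sum_congr rfl fun t _ => ?_
  rw [← pairSum_comp_perm L κ δ σ z]
  rfl

lemma Generic.comp_perm {m : ℕ} {z : Fin m → ℂ} (h : Generic L κ δ z) (σ : Equiv.Perm (Fin m)) :
    Generic L κ δ (z ∘ σ) :=
  ⟨fun i => h.1 (σ i), fun i j hij => h.2 (σ i) (σ j) (σ.injective.ne hij)⟩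

lemma exists_perm_eq_cons {m : ℕ} (z : Fin (m + 1) → ℂ) (j : Fin (m + 1)) :
    ∃ (σ : Equiv.Perm (Fin (m + 1))) (z' : Fin m → ℂ), z ∘ σ = Fin.cons (z j) z' := by
  refine ⟨Equiv.swap 0 j, Fin.tail (z ∘ Equiv.swap 0 j), ?_⟩
  conv_lhs => rw [← Fin.cons_self_tail (z ∘ Equiv.swap 0 j)]
  simp

/-- For an even elliptic function, a removable singularity is removable along its whole orbit. -/
lemma HasRes.of_mem_lattice {f : ℂ → ℂ} {y x₀ : ℂ} (hf : HasRes f y 0)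
    (heven : ∀ x, f (-x) = f x) (hper : ∀ ω ∈ L.lattice, ∀ x, f (x + ω) = f x)
    (h : x₀ - y ∈ L.lattice ∨ x₀ + y ∈ L.lattice) : HasRes f x₀ 0 := by
  have key : ∀ y, HasRes f y 0 → x₀ - y ∈ L.lattice → HasRes f x₀ 0 := by
    intro y hf h
    have h1 := hf.comp_add (-(x₀ - y))
    rw [funext (hper _ (neg_mem h))] at h1
    convert! h1 using 1
    ring
  rcases h with h | h
  · exact key y hf h
  · have h1 := hf.comp_neg
    rw [funext heven, neg_zero] at h1
    exact key (-y) h1 (by rwa [sub_neg_eq_add])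

lemma brPM_ne_zero_of_sub_mem {x x' y : ℂ} (h : x - x' ∈ L.lattice) (hx : brPM L κ x y ≠ 0) :
    brPM L κ x' y ≠ 0 := by
  rw [brPM_ne_zero_iff] at hx ⊢
  refine ⟨fun h' => hx.1 ?_, fun h' => hx.2 ?_⟩ <;>
  · convert! add_mem h h' using 1
    ring

lemma CrossRegular.of_sub_mem {x x' y : ℂ} (h : x - x' ∈ L.lattice)
    (hx : CrossRegular L κ δ x y) : CrossRegular L κ δ x' y :=
  ⟨brPM_ne_zero_of_sub_mem (by convert! h using 1; ring) hx.1,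
    brPM_ne_zero_of_sub_mem (by convert! h using 1; ring) hx.2⟩

lemma CrossRegular.neg {x y : ℂ} (hx : CrossRegular L κ δ x y) : CrossRegular L κ δ (-x) y := by
  refine ⟨?_, ?_⟩
  · rw [← brPM_neg_left]
    convert! hx.2 using 2
    ring
  · rw [← brPM_neg_left]
    convert! hx.1 using 2
    ring

section OneVariable

variable {m n : ℕ} {z : Fin m → ℂ} {w : Fin n → ℂ} {x₀ : ℂ} {a : Fin 8 → ℂ} {c : ℂ}

/-- Away from the other family, poles can occur only where x ≡ ±z_j, 2x ± δ ∈ Ω or 2x ∈ Ω.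
Genericity of z and δ ∉ Ω keep these cases apart, so each pole is simple. Evenness and periodicity
move it to the point where its residue was computed. -/
lemma hasRes_splitSum_of_regular (hδ1 : δ ∉ L.lattice) (hδ2 : 2 * δ ∉ L.lattice)
    (hbal : ∑ p, a p = (4 - 2 * ((m + 1 : ℕ) : ℂ) + 2 * (n : ℂ)) * δ)
    (hc1 : br L κ (2 * c + δ) ≠ 0) (hc2 : br L κ (2 * c - δ) ≠ 0)
    (hz : Generic L κ δ z) (hzw : ∀ i k, CrossRegular L κ δ (z i) (w k))
    (hxw : ∀ k, CrossRegular L κ δ x₀ (w k)) :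
    HasRes (fun x =>
      splitSum L κ δ a (fun _ => c) (Fin.cons x z : Fin (m + 1) → ℂ) w) x₀ 0 := by
  have heven : ∀ x, splitSum L κ δ a (fun _ => c) (Fin.cons (-x) z : Fin (m + 1) → ℂ) w =
      splitSum L κ δ a (fun _ => c) (Fin.cons x z : Fin (m + 1) → ℂ) w := fun x =>
    splitSum_cons_neg L κ δ a c x z w
  have hper : ∀ ω ∈ L.lattice, ∀ x,
      splitSum L κ δ a (fun _ => c) (Fin.cons (x + ω) z : Fin (m + 1) → ℂ) w =
      splitSum L κ δ a (fun _ => c) (Fin.cons x z : Fin (m + 1) → ℂ) w := fun ω hω x =>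
    splitSum_cons_add_period L κ δ hω a c hbal x z w
  by_cases hx : ∀ j, brPM L κ x₀ (z j) ≠ 0
  · have hhalf : ∀ y, 2 * y + δ ∈ L.lattice → (∀ j, brPM L κ y (z j) ≠ 0) →
        (∀ k, CrossRegular L κ δ y (w k)) → HasRes (fun x =>
        splitSum L κ δ a (fun _ => c) (Fin.cons x z : Fin (m + 1) → ℂ) w) y 0 := by
      intro y hy hyz hyw
      obtain ⟨r, ω, hω, hr⟩ := exists_half_period hy
      have hsub : y - (1 / 2) * (om L r - δ) ∈ L.lattice := by
        convert! hω using 1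
        rw [hr]
        ring
      exact (hasRes_splitSum_half_period a r hδ1 hδ2 hbal rfl
        (fun j => brPM_ne_zero_of_sub_mem hsub (hyz j)) (fun k => (hyw k).of_sub_mem hsub)
        hz hc1 hc2).of_mem_lattice heven hper (Or.inl hsub)
    by_cases h1 : 2 * x₀ + δ ∈ L.lattice
    · exact hhalf x₀ h1 hx hxw
    by_cases h2 : 2 * x₀ - δ ∈ L.lattice
    · refine (hhalf (-x₀) ?_ (fun j => by rw [brPM_neg_left]; exact hx j)
        fun k => (hxw k).neg).of_mem_lattice heven hper (Or.inr (by simp))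
      convert! neg_mem h2 using 1
      ring
    rw [← br_ne_zero_iff (κ := κ)] at h1 h2
    by_cases h0 : 2 * x₀ ∈ L.lattice
    · obtain ⟨l, hl⟩ := exists_hasRes_splitSum_half (w := w) a h0 h1 h2 hx hxw hz hc1 hc2
      rwa [hl.eq_zero_of_even rfl heven (hper _ h0)] at hl
    · exact hasRes_of_continuousAt
        (continuousAt_splitSum_cons a ⟨br_ne_zero_iff.mpr h0, h1, h2⟩ hx hxw hz hzw hc1 hc2)
  · push Not at hx
    obtain ⟨j, hj⟩ := hx
    have hmem : x₀ - z j ∈ L.lattice ∨ x₀ + z j ∈ L.lattice := by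
      rcases mul_eq_zero.mp hj with h | h
      · exact Or.inr ((br_eq_zero_iff L κ).mp h)
      · exact Or.inl ((br_eq_zero_iff L κ).mp h)
    refine HasRes.of_mem_lattice ?_ heven hper hmem
    obtain - | m := m
    · exact j.elim0
    obtain ⟨σ, z', hσ⟩ := exists_perm_eq_cons z j
    have h := hasRes_splitSum_diagonal a (y := z j) (z := z') (w := w) (hσ ▸ hz.comp_perm σ)
      (fun k => hzw j k) hc1 hc2
    rw [← hσ] at h
    simpa only [splitSum_cons_comp_perm] using h

end OneVariable

/-! ### The duality -/

/-- Nonvanishing of the denominators that appear in residues at the variables `w`. -/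
def StronglyGeneric (L : PeriodPair) (κ δ : ℂ) {n : ℕ} (w : Fin n → ℂ) : Prop :=
  Generic L κ δ w ∧
    (∀ k, 2 * w k + 2 * δ ∉ L.lattice ∧ 2 * w k - 2 * δ ∉ L.lattice ∧
      2 * w k + 3 * δ ∉ L.lattice ∧ 2 * w k - 3 * δ ∉ L.lattice) ∧
    ∀ k l, k ≠ l → brPM L κ (w k + 2 * δ) (w l) ≠ 0 ∧ brPM L κ (w k - 2 * δ) (w l) ≠ 0

lemma StronglyGeneric.comp_perm {n : ℕ} {w : Fin n → ℂ} (h : StronglyGeneric L κ δ w)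
    (σ : Equiv.Perm (Fin n)) : StronglyGeneric L κ δ (w ∘ σ) :=
  ⟨h.1.comp_perm σ, fun k => h.2.1 (σ k), fun k l hkl => h.2.2 (σ k) (σ l) (σ.injective.ne hkl)⟩

lemma StronglyGeneric.cons_neg {n : ℕ} {v : ℂ} {w : Fin n → ℂ}
    (h : StronglyGeneric L κ δ (Fin.cons v w : Fin (n + 1) → ℂ)) :
    StronglyGeneric L κ δ (Fin.cons (-v) w : Fin (n + 1) → ℂ) := by
  obtain ⟨h1, h2, h3⟩ := h
  obtain ⟨hv, hvw, hw⟩ := generic_cons_iff.mp h1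
  refine ⟨generic_cons hv.neg (fun j => by rw [brPM_neg_left]; exact hvw j) hw, fun k => ?_,
    fun k l hkl => ?_⟩
  · refine Fin.cases ?_ (fun k => h2 k.succ) k
    obtain ⟨g1, g2, g3, g4⟩ := h2 0
    simp only [Fin.cons_zero] at *
    refine ⟨fun h => g2 ?_, fun h => g1 ?_, fun h => g4 ?_, fun h => g3 ?_⟩ <;>
    · convert! neg_mem h using 1
      ring
  · revert hkl
    refine Fin.cases ?_ (fun k => ?_) k <;> refine Fin.cases ?_ (fun l => ?_) l <;> intro hkl
    · exact absurd rfl hkl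
    · obtain ⟨g1, g2⟩ := h3 0 l.succ hkl
      simp only [Fin.cons_zero, Fin.cons_succ] at *
      rw [← brPM_neg_left] at g1 g2
      refine ⟨?_, ?_⟩
      · convert! g2 using 2
        ring
      · convert! g1 using 2
        ring
    · simpa only [Fin.cons_zero, Fin.cons_succ, brPM_neg_right] using h3 k.succ 0 hkl
    · exact h3 k.succ l.succ hkl

lemma dualParam_sum (a : Fin 8 → ℂ) : ∑ p, dualParam δ a p = 8 * δ - ∑ p, a p := by
  simp only [dualParam, Fin.sum_univ_eight]
  simp
  ring

lemma dualParam_zero {a : Fin 8 → ℂ} (ha7 : a 7 = a 0 + δ) : dualParam δ a 0 = -a 0 := by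
  simp [dualParam, ha7]

/-- Up to exchanging the indices 0 and 7, -v + b_p is -(x + a_p), and the eight signs cancel. This
matches the numerators of the two residues. -/
lemma prod_br_dualParam (a : Fin 8 → ℂ) {x v : ℂ} (h : x + δ = v) :
    ∏ p, br L κ (-v + dualParam δ a p) = ∏ p, br L κ (x + a p) := by
  have h1 : ∀ u, br L κ (-v + (δ - u)) = -br L κ (x + u) := fun u => by
    rw [← br_neg]
    congr 1
    linear_combination h
  simp only [dualParam, Fin.prod_univ_eight]
  simp [h1]
  ring

/-- The factor `∏ₚ [a₀ + aₚ]ₖ`, for `1 ≤ p ≤ 6`. -/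
def dualityFactor (L : PeriodPair) (κ δ : ℂ) (a : Fin 8 → ℂ) (k : ℕ) : ℂ :=
  ∏ p ∈ Finset.Icc (1 : Fin 8) 6, brPoch L κ δ (a 0 + a p) k

/-- The difference of the two sides of the duality has a removable singularity where `x + δ` meets
a variable of the other family, provided that the duality holds with both variables removed. -/
lemma hasRes_duality_cross {a : Fin 8 → ℂ} {c c' C : ℂ} {m n : ℕ} {z : Fin m → ℂ} {w : Fin n → ℂ}
    {v : ℂ} (hδ2 : 2 * δ ∉ L.lattice)
    (hw : StronglyGeneric L κ δ (Fin.cons v w : Fin (n + 1) → ℂ)) (hz : Generic L κ δ z)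
    (hzw : ∀ i k, CrossRegular L κ δ (z i) (w k)) (hzv : ∀ i, CrossRegular L κ δ (z i) v)
    (hc1 : br L κ (2 * c + δ) ≠ 0) (hc2 : br L κ (2 * c - δ) ≠ 0)
    (hc1' : br L κ (2 * c' + δ) ≠ 0) (hc2' : br L κ (2 * c' - δ) ≠ 0)
    (hC : splitSum L κ δ a (fun _ => c) z w =
      C * splitSum L κ δ (dualParam δ a) (fun _ => c') w z) :
    HasRes (fun x => splitSum L κ δ a (fun _ => c) (Fin.cons x z : Fin (m + 1) → ℂ)
        (Fin.cons v w : Fin (n + 1) → ℂ) -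
      C * splitSum L κ δ (dualParam δ a) (fun _ => c') (Fin.cons v w : Fin (n + 1) → ℂ)
        (Fin.cons x z : Fin (m + 1) → ℂ)) (v - δ) 0 := by
  obtain ⟨h1, h2, h3⟩ := hw
  obtain ⟨hv, hvw, hw⟩ := generic_cons_iff.mp h1
  obtain ⟨-, g2, -, g4⟩ := h2 0
  have h3' : ∀ k, brPM L κ (v - 2 * δ) (w k) ≠ 0 := fun k =>
    (h3 0 k.succ (Fin.succ_ne_zero k).symm).2
  simp only [Fin.cons_zero] at g2 g4
  obtain ⟨x₀, hx₀⟩ : ∃ x₀, x₀ = v - δ := ⟨_, rfl⟩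
  have hxv : x₀ + δ = v := by rw [hx₀]; ring
  have hvx : -v + δ = -x₀ := by rw [hx₀]; ring
  have hvz : ∀ i, CrossRegular L κ δ v (z i) := fun i => (hzv i).symm
  -- At x₀ = v - δ the relevant arguments are 2v - 2δ, 2v - δ and 2v - 3δ, which is why
  -- `StronglyGeneric` asks for more than `Generic`.
  have hx : Regular L κ δ x₀ := by
    refine ⟨br_ne_zero_iff.mpr ?_, ?_, br_ne_zero_iff.mpr ?_⟩
    · convert! g2 using 2
      rw [hx₀]
      ring
    · convert! hv.2.2 using 2
      rw [hx₀]
      ring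
    · convert! g4 using 2
      rw [hx₀]
      ring
  have hxw : ∀ k, CrossRegular L κ δ x₀ (w k) := fun k => by
    refine ⟨by rw [hxv]; exact hvw k, ?_⟩
    convert! h3' k using 2
    rw [hx₀]
    ring
  have hxz : ∀ j, brPM L κ x₀ (z j) ≠ 0 := fun j => by
    rw [hx₀]
    exact (hvz j).2
  rw [← hx₀]
  have hpole : ∀ α β : ℂ, α = 1 → β = -x₀ → HasRes (fun t => (br L κ (α * t + β))⁻¹) x₀ 1 := by
    rintro _ _ rfl rfl
    simpa using hasRes_inv_br_zero (L := L) (κ := κ) (α := 1) (β := -x₀) (x₀ := x₀) one_ne_zero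
      (by ring)
  have hL := hasRes_splitSum_cross a (x := fun x => x) (v := fun _ => v) (t₀ := x₀) (x₀ := x₀)
    (v₀ := v) (z := z) (w := w) continuousAt_id continuousAt_const rfl rfl hxv
    (by
      convert! hpole 1 (δ - v) rfl (by rw [← hxv]; ring) using 4
      ring_nf) hδ2 hx hv.1 hxw hxz hz hzw hzv hc1 hc2
  -- On the right side v belongs to the summed family and x to the other. By evenness both can be
  -- negated, and -v + δ = -x₀ has the required shape, now with the second variable moving.
  have hR := hasRes_splitSum_cross (dualParam δ a) (x := fun _ => -v) (v := fun x => -x) (t₀ := x₀)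
    (x₀ := -v) (v₀ := -x₀) (z := w) (w := z) continuousAt_const continuousAt_neg rfl rfl hvx
    (by
      convert! hpole 1 (δ - v) rfl (by rw [← hxv]; ring) using 4
      ring_nf) hδ2 hv.neg hx.neg.1 (fun k => (hvz k).neg)
    (fun j => by rw [brPM_neg_left]; exact hvw j) hw (fun i k => (hzw k i).symm)
    (fun i => (hxw i).neg.symm) hc1' hc2'
  simp only [splitSum_cons_neg, splitSum_cons_neg_right] at hR
  have hfin := hL.sub (hR.const_mul C)
  convert! hfin using 1
  rw [hC]
  -- The cross factors of one residue are the factors pulled out of the splitting sum in the other.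
  have e1 : ∏ k, crossF L κ δ .pos x₀ (w k) =
      ∏ j, brPM L κ (w j) (-x₀) / brPM L κ (w j) (-v) := by
    refine Finset.prod_congr rfl fun k _ => ?_
    rw [crossF, hxv, brPM_neg_right, brPM_neg_right, brPM_swap, brPM_swap L κ v, neg_div_neg_eq]
  have e2 : ∏ k, crossF L κ δ .pos (-v) (z k) =
      ∏ j, brPM L κ (z j) v / brPM L κ (z j) x₀ := by
    refine Finset.prod_congr rfl fun k _ => ?_
    rw [crossF, hvx, brPM_neg_left, brPM_neg_left, brPM_swap, brPM_swap L κ x₀, neg_div_neg_eq]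
  rw [e1, e2, Aplus, Aplus, prod_br_dualParam a hxv]
  have e3 : br L κ (2 * -v + δ) = -br L κ (2 * x₀ + δ) := by
    rw [← br_neg]
    congr 1
    linear_combination 2 * hxv
  have e4 : br L κ (2 * -v) = -br L κ (2 * v) := by rw [← br_neg]; congr 1; ring
  have e5 : br L κ (2 * -x₀) = -br L κ (2 * x₀) := by rw [← br_neg]; congr 1; ring
  rw [e3, e4, e5]
  have n1 := hx.1
  have n2 := hx.2.1
  have n3 := hv.1
  field_simp
  ring

/-! ### The difference of the two sides is constant -/

/-- The conditions on the parameters, for families of `m` and `n` variables. -/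
structure Admissible (L : PeriodPair) (κ δ : ℂ) (m n : ℕ) (a : Fin 8 → ℂ) : Prop where
  balance : ∑ p, a p = (4 - 2 * (m : ℂ) + 2 * (n : ℂ)) * δ
  last_eq : a 7 = a 0 + δ
  add_ne : br L κ (2 * a 0 + δ) ≠ 0
  sub_ne : br L κ (2 * a 0 - δ) ≠ 0

/-- The duality for families of `m` and `n` variables. -/
def Duality (L : PeriodPair) (κ δ : ℂ) (m n : ℕ) : Prop :=
  ∀ a, Admissible L κ δ m n a → ∀ (z : Fin m → ℂ) (w : Fin n → ℂ), Generic L κ δ z →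
    Generic L κ δ w → (∀ i k, CrossRegular L κ δ (z i) (w k)) →
    splitSum L κ δ a (fun _ => a 0) z w = dualityFactor L κ δ a (m - n) *
      splitSum L κ δ (dualParam δ a) (fun _ => dualParam δ a 0) w z

lemma Admissible.dual_add_ne {m n : ℕ} {a : Fin 8 → ℂ} (ha : Admissible L κ δ m n a) :
    br L κ (2 * dualParam δ a 0 + δ) ≠ 0 := by
  have h := ha.sub_ne
  rw [← neg_ne_zero, ← br_neg] at h
  rw [dualParam_zero ha.last_eq]
  convert! h using 2
  ring

lemma Admissible.dual_sub_ne {m n : ℕ} {a : Fin 8 → ℂ} (ha : Admissible L κ δ m n a) :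
    br L κ (2 * dualParam δ a 0 - δ) ≠ 0 := by
  have h := ha.add_ne
  rw [← neg_ne_zero, ← br_neg] at h
  rw [dualParam_zero ha.last_eq]
  convert! h using 2
  ring

/-- The difference of the two sides of the duality, as a function of the first variable. -/
def dualityDiff (L : PeriodPair) (κ δ : ℂ) (a : Fin 8 → ℂ) {m n : ℕ} (z : Fin m → ℂ)
    (w : Fin n → ℂ) (x : ℂ) : ℂ :=
  splitSum L κ δ a (fun _ => a 0) (Fin.cons x z : Fin (m + 1) → ℂ) w -
    dualityFactor L κ δ a (m + 1 - n) *
      splitSum L κ δ (dualParam δ a) (fun _ => dualParam δ a 0) w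
        (Fin.cons x z : Fin (m + 1) → ℂ)

section Constancy

variable {a : Fin 8 → ℂ} {m n : ℕ} {z : Fin m → ℂ} {w : Fin n → ℂ}

lemma continuousAt_dualityDiff (ha : Admissible L κ δ (m + 1) n a) {x₀ : ℂ}
    (hx : Regular L κ δ x₀) (hxz : ∀ j, brPM L κ x₀ (z j) ≠ 0)
    (hxw : ∀ k, CrossRegular L κ δ x₀ (w k)) (hz : Generic L κ δ z) (hw : Generic L κ δ w)
    (hzw : ∀ i k, CrossRegular L κ δ (z i) (w k)) :
    ContinuousAt (dualityDiff L κ δ a z w) x₀ :=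
  (continuousAt_splitSum_cons a hx hxz hxw hz hzw ha.add_ne ha.sub_ne).sub
    (continuousAt_const.mul (continuousAt_splitSum_cons_right _ (fun k => (hxw k).symm) hw
      (fun k i => (hzw i k).symm) ha.dual_add_ne ha.dual_sub_ne))

/-- Away from the points ±w_k ± δ modulo Ω, the left sum is removable and the right sum continuous.
At those points the w_k concerned is moved to the front, and the residues match by the smaller
duality. Evenness and periodicity reduce the four sign choices to v - δ with v = ±w_k. -/
lemma hasRes_dualityDiff (hδ1 : δ ∉ L.lattice) (hδ2 : 2 * δ ∉ L.lattice)
    (ih : ∀ n', n = n' + 1 → Duality L κ δ m n')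
    (ha : Admissible L κ δ (m + 1) n a) (hz : Generic L κ δ z) (hw : StronglyGeneric L κ δ w)
    (hzw : ∀ i k, CrossRegular L κ δ (z i) (w k))
    (heven : ∀ x, dualityDiff L κ δ a z w (-x) = dualityDiff L κ δ a z w x)
    (hper : ∀ ω ∈ L.lattice, ∀ x, dualityDiff L κ δ a z w (x + ω) = dualityDiff L κ δ a z w x)
    (x₀ : ℂ) : HasRes (dualityDiff L κ δ a z w) x₀ 0 := by
  by_cases hxw : ∀ k, CrossRegular L κ δ x₀ (w k)
  · have h1 := hasRes_splitSum_of_regular hδ1 hδ2 ha.balance ha.add_ne ha.sub_ne hz hzw hxw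
    have h2 := hasRes_of_continuousAt (continuousAt_splitSum_cons_right (dualParam δ a)
      (fun k => (hxw k).symm) hw.1 (fun k i => (hzw i k).symm) ha.dual_add_ne ha.dual_sub_ne)
    have h3 := h1.sub (h2.const_mul (dualityFactor L κ δ a (m + 1 - n)))
    rwa [mul_zero, sub_zero] at h3
  · push Not at hxw
    obtain ⟨k, hk⟩ := hxw
    obtain - | n := n
    · exact k.elim0
    obtain ⟨σ, w', hσ⟩ := exists_perm_eq_cons w k
    have hw' : StronglyGeneric L κ δ (Fin.cons (w k) w' : Fin (n + 1) → ℂ) := hσ ▸ hw.comp_perm σ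
    have hzw' : ∀ i l, CrossRegular L κ δ (z i) (w' l) := fun i l => by
      have := hzw i (σ l.succ)
      rwa [← Function.comp_apply (f := w), hσ, Fin.cons_succ] at this
    have hC : splitSum L κ δ a (fun _ => a 0) z w' = dualityFactor L κ δ a (m + 1 - (n + 1)) *
        splitSum L κ δ (dualParam δ a) (fun _ => dualParam δ a 0) w' z := by
      -- Removing a variable from each family does not change the difference of sizes, so the factor
      -- is the same in the smaller duality.
      rw [Nat.add_sub_add_right]
      refine ih n rfl a ⟨?_, ha.last_eq, ha.add_ne, ha.sub_ne⟩ z w' hz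
        (generic_cons_iff.mp hw'.1).2.2 hzw'
      rw [ha.balance]
      push_cast
      ring
    have key : ∀ v, StronglyGeneric L κ δ (Fin.cons v w' : Fin (n + 1) → ℂ) →
        (∀ i, CrossRegular L κ δ (z i) v) → (v = w k ∨ v = -w k) →
        HasRes (dualityDiff L κ δ a z w) (v - δ) 0 := by
      intro v hvw hzv hv
      have h := hasRes_duality_cross hδ2 hvw hz hzw' hzv ha.add_ne ha.sub_ne ha.dual_add_ne
        ha.dual_sub_ne hC
      suffices heq : dualityDiff L κ δ a z w = fun x =>
          splitSum L κ δ a (fun _ => a 0) (Fin.cons x z : Fin (m + 1) → ℂ)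
            (Fin.cons v w' : Fin (n + 1) → ℂ) - dualityFactor L κ δ a (m + 1 - (n + 1)) *
          splitSum L κ δ (dualParam δ a) (fun _ => dualParam δ a 0)
            (Fin.cons v w' : Fin (n + 1) → ℂ) (Fin.cons x z : Fin (m + 1) → ℂ) by
        rwa [heq]
      funext x
      rw [dualityDiff, ← splitSum_comp_perm_right L κ δ a _ σ, ← splitSum_comp_perm L κ δ _ _ σ w,
        hσ]
      rcases hv with rfl | rfl
      · rfl
      · rw [splitSum_cons_neg, splitSum_cons_neg_right]
    have hp := key (w k) hw' (fun i => hzw i k) (Or.inl rfl)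
    have hm := key (-w k) hw'.cons_neg (fun i => ((hzw i k).symm.neg).symm) (Or.inr rfl)
    rw [CrossRegular, brPM_ne_zero_iff, brPM_ne_zero_iff] at hk
    by_cases h1 : x₀ + δ + w k ∈ L.lattice
    · refine hm.of_mem_lattice heven hper (Or.inl ?_)
      convert! h1 using 1
      ring
    by_cases h2 : x₀ + δ - w k ∈ L.lattice
    · refine hp.of_mem_lattice heven hper (Or.inl ?_)
      convert! h2 using 1
      ring
    by_cases h3 : x₀ - δ + w k ∈ L.lattice
    · refine hp.of_mem_lattice heven hper (Or.inr ?_)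
      convert! h3 using 1
      ring
    by_cases h4 : x₀ - δ - w k ∈ L.lattice
    · refine hm.of_mem_lattice heven hper (Or.inr ?_)
      convert! h4 using 1
      ring
    exact absurd ⟨⟨h1, h2⟩, h3, h4⟩ hk

lemma exists_const_dualityDiff (hδ1 : δ ∉ L.lattice) (hδ2 : 2 * δ ∉ L.lattice)
    (ih : ∀ n', n = n' + 1 → Duality L κ δ m n')
    (ha : Admissible L κ δ (m + 1) n a) (hz : Generic L κ δ z) (hw : StronglyGeneric L κ δ w)
    (hzw : ∀ i k, CrossRegular L κ δ (z i) (w k)) :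
    ∃ C, ∀ x, ContinuousAt (dualityDiff L κ δ a z w) x → dualityDiff L κ δ a z w x = C := by
  have heven : ∀ x, dualityDiff L κ δ a z w (-x) = dualityDiff L κ δ a z w x := fun x => by
    rw [dualityDiff, splitSum_cons_neg, splitSum_cons_neg_right, dualityDiff]
  have hper : ∀ ω ∈ L.lattice, ∀ x,
      dualityDiff L κ δ a z w (x + ω) = dualityDiff L κ δ a z w x := fun ω hω x => by
    rw [dualityDiff, splitSum_cons_add_period L κ δ hω _ _ ha.balance,
      splitSum_cons_add_period_right L κ δ hω, dualityDiff]
  exact exists_const_of_elliptic L ((meromorphic_splitSum_cons a _ z w).sub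
    ((meromorphic_const _).mul (meromorphic_splitSum_cons_right _ _ w z))) hper
    (hasRes_dualityDiff hδ1 hδ2 ih ha hz hw hzw heven hper)

end Constancy

/-! ### Evaluation at `a₀` -/

/-- The parameters `(a₀ + δ, a₁, …, a₆, a₀ + 2 δ)`. -/
def shiftParam (δ : ℂ) (a : Fin 8 → ℂ) : Fin 8 → ℂ :=
  ![a 0 + δ, a 1, a 2, a 3, a 4, a 5, a 6, a 7 + δ]

lemma prod_eq_mul_prod_Icc (f : Fin 8 → ℂ) :
    ∏ p, f p = f 0 * f 7 * ∏ p ∈ Finset.Icc (1 : Fin 8) 6, f p := by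
  have h : Finset.Icc (1 : Fin 8) 6 = {1, 2, 3, 4, 5, 6} := by decide
  rw [h, Fin.prod_univ_eight]
  simp
  ring

lemma shiftParam_zero (a : Fin 8 → ℂ) : shiftParam δ a 0 = a 0 + δ := rfl

lemma shiftParam_seven (a : Fin 8 → ℂ) : shiftParam δ a 7 = a 7 + δ := rfl

lemma shiftParam_of_mem {a : Fin 8 → ℂ} {p : Fin 8} (hp : p ∈ Finset.Icc (1 : Fin 8) 6) :
    shiftParam δ a p = a p := by
  fin_cases p <;> first | rfl | exact absurd hp (by decide)

/-- For sign + the interaction replaces [x + a_0] by [x + a_0 + 2δ], turning the pair a_0, a_0 + δ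
into a_0 + δ, a_0 + 2δ. For sign 0 it moves [x ± a_0] to [x ± (a_0 + δ)], so c shifts along with
a_0. -/
lemma coef_mul_pairF {a : Fin 8 → ℂ} (ha7 : a 7 = a 0 + δ) (h1 : br L κ (2 * a 0 + δ) ≠ 0)
    (h2 : br L κ (2 * a 0 - δ) ≠ 0) (h3 : br L κ (2 * a 0 + 3 * δ) ≠ 0) {x : ℂ}
    (hx : brPM L κ (a 0) x ≠ 0) (t : SignType) :
    coef L κ δ a (a 0) t x * pairF L κ δ .pos t (a 0) x =
      coef L κ δ (shiftParam δ a) (a 0 + δ) t x := by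
  have key : ∀ x, brPM L κ (a 0) x ≠ 0 →
      coef L κ δ a (a 0) .pos x * pairF L κ δ .pos .pos (a 0) x =
      coef L κ δ (shiftParam δ a) (a 0 + δ) .pos x := by
    intro x hx
    have h := (mul_ne_zero_iff.mp hx).1
    simp only [coef, pairF, Aplus, Fin.prod_univ_eight, shiftParam]
    simp only [Matrix.cons_val, ha7]
    have e1 : x + (a 0 + δ + δ) = a 0 + x + 2 * δ := by ring
    rw [e1, add_comm x (a 0)]
    field_simp
  cases t
  · simp only [coef, pairF, Azero, Finset.sum_mul]
    refine Finset.sum_congr rfl fun r _ => ?_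
    have hh := brPM_half_ne_zero h1 h2 r
    have hh' := brPM_half_ne_zero (L := L) (κ := κ) (δ := δ) (x := a 0 + δ)
      (by convert! h3 using 2; ring) (by convert! h1 using 2; ring) r
    obtain ⟨h, hdef⟩ : ∃ h, h = (1 / 2) * (om L r - δ) := ⟨_, rfl⟩
    obtain ⟨η, hη⟩ : ∃ η, η = quasiPeriod L κ (om L r) := ⟨_, rfl⟩
    rw [← hdef] at hh hh'
    simp only [AzeroTerm]
    rw [← hdef, ← hη]
    have hsum : ∑ p, shiftParam δ a p = ∑ p, a p + 2 * δ := by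
      simp only [shiftParam, Fin.sum_univ_eight, Matrix.cons_val]
      ring
    -- The reflection h + δ = -h + ω_r cancels numerator brackets against [h ± c]; the resulting
    -- multiplier accounts for the change of Σa.
    have e1 : h + (a 0 + δ) = -(h - a 0) + om L r := by rw [hdef]; ring
    have e2 : h + (a 0 + δ + δ) = -(h - (a 0 + δ)) + om L r := by rw [hdef]; ring
    have e3 : e (η * (-(h - (a 0 + δ)) + om L r / 2)) =
        e (η * δ) * e (η * (-(h - a 0) + om L r / 2)) := by
      rw [← e_add]
      congr 1
      ring
    have e4 : e ((δ - om L r / 2 - 1 / 2 * ∑ p, a p) * η) =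
        e (η * δ) * e ((δ - om L r / 2 - 1 / 2 * ∑ p, shiftParam δ a p) * η) := by
      rw [← e_add, hsum]
      congr 1
      ring
    have hb1 : br L κ (h + (a 0 + δ)) = signChar L (om L r) *
        e (η * (-(h - a 0) + om L r / 2)) * -br L κ (h - a 0) := by
      rw [e1, br_add_period L κ (om_mem r), br_neg, ← hη]
    have hb2 : br L κ (h + (a 0 + δ + δ)) = signChar L (om L r) *
        (e (η * δ) * e (η * (-(h - a 0) + om L r / 2))) * -br L κ (h - (a 0 + δ)) := by
      rw [e2, br_add_period L κ (om_mem r), br_neg, ← hη, e3]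
    have e5 : ∏ p, br L κ (h + a p) = br L κ (h + a 0) * br L κ (h + (a 0 + δ)) *
        ∏ p ∈ Finset.Icc (1 : Fin 8) 6, br L κ (h + a p) := by
      rw [prod_eq_mul_prod_Icc, ha7]
    have e6 : ∏ p, br L κ (h + shiftParam δ a p) =
        br L κ (h + (a 0 + δ)) * br L κ (h + (a 0 + δ + δ)) *
        ∏ p ∈ Finset.Icc (1 : Fin 8) 6, br L κ (h + a p) := by
      rw [prod_eq_mul_prod_Icc, shiftParam_zero, shiftParam_seven, ha7]
      congr 1
    rw [e4, e5, e6, hb2, brPM_swap L κ x (a 0), brPM_swap L κ x (a 0 + δ)]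
    generalize ∏ p ∈ Finset.Icc (1 : Fin 8) 6, br L κ (h + a p) = P
    have n1 := mul_ne_zero_iff.mp hh
    have n2 := mul_ne_zero_iff.mp hh'
    have n3 : br L κ (h + (a 0 + δ)) = signChar L (om L r) *
        e (η * (-(h - a 0) + om L r / 2)) * -br L κ (h - a 0) := hb1
    rw [brPM.eq_1 L κ h (a 0), brPM.eq_1 L κ h (a 0 + δ)]
    obtain ⟨u1, u2⟩ := n1
    obtain ⟨u3, u4⟩ := n2
    generalize e ((δ - om L r / 2 - 1 / 2 * ∑ p, shiftParam δ a p) * η) = q0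
    generalize e (η * δ) = q1
    generalize e (η * (-(h - a 0) + om L r / 2)) = q2 at *
    generalize br L κ (h + (a 0 + δ)) = B at *
    generalize br L κ (h - a 0) = B' at *
    generalize br L κ (h - (a 0 + δ)) = B'' at *
    generalize brPM L κ (a 0) x = s at *
    -- Regularity of x is not assumed; if this denominator vanishes, both sides are 0 by the
    -- convention for division.
    rcases eq_or_ne (brPM L κ h x) 0 with h0 | h0
    · simp [h0]
    · field_simp
      rw [hb1]
      ring
  · have e1 : pairF L κ δ .pos .neg (a 0) x = pairF L κ δ .pos .pos (a 0) (-x) := by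
      rw [pairF_comm, pairF_comm L κ δ .pos]
      exact pairF_neg_left L κ δ .pos .pos x (a 0)
    have e2 : ∀ (a : Fin 8 → ℂ) (c : ℂ), coef L κ δ a c .neg x = coef L κ δ a c .pos (-x) :=
      fun a c => coef_neg L κ δ a c .pos x
    rw [e1, e2, e2]
    exact key (-x) (by rwa [brPM_neg_right])
  · exact key x hx

/-- This is `coef_mul_pairF` for b' = `dualParam δ (shiftParam δ a)`. Shifting b' gives the dual of
a, and since b'_0 + δ = -a_0, the leftover interactions combine by `crossF_mul_pairF`. -/
lemma coef_mul_crossF {a : Fin 8 → ℂ} (ha7 : a 7 = a 0 + δ) (h1 : br L κ (2 * a 0 + δ) ≠ 0)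
    (h2 : br L κ (2 * a 0 - δ) ≠ 0) (h3 : br L κ (2 * a 0 + 3 * δ) ≠ 0) {y : ℂ}
    (hy : CrossRegular L κ δ (a 0) y) (t : SignType) :
    coef L κ δ (dualParam δ a) (dualParam δ a 0) t y * crossF L κ δ t y (a 0) =
      crossF L κ δ .pos (a 0) y *
        coef L κ δ (dualParam δ (shiftParam δ a)) (dualParam δ (shiftParam δ a) 0) t y := by
  set b' := dualParam δ (shiftParam δ a) with hb'
  have hb0 : b' 0 = -(a 0 + δ) := by
    rw [hb', dualParam_zero (by rw [shiftParam_zero, shiftParam_seven, ha7]), shiftParam_zero]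
  have hb7 : b' 7 = b' 0 + δ := by
    rw [hb0, hb']
    simp [dualParam, shiftParam]
  have hsh : shiftParam δ b' = dualParam δ a := by
    funext p
    rw [hb']
    fin_cases p <;> simp [shiftParam, dualParam] <;> ring
  have hc : b' 0 + δ = dualParam δ a 0 := by rw [dualParam_zero ha7, hb0]; ring
  have hne : brPM L κ (b' 0) y ≠ 0 := by
    rw [hb0, brPM_neg_left]
    exact hy.1
  have h1' : br L κ (2 * b' 0 + δ) ≠ 0 := by
    rw [← neg_ne_zero, ← br_neg]
    convert! h1 using 2
    rw [hb0]
    ring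
  have h2' : br L κ (2 * b' 0 - δ) ≠ 0 := by
    rw [← neg_ne_zero, ← br_neg]
    convert! h3 using 2
    rw [hb0]
    ring
  have h3' : br L κ (2 * b' 0 + 3 * δ) ≠ 0 := by
    rw [← neg_ne_zero, ← br_neg]
    convert! h2 using 2
    rw [hb0]
    ring
  have hmain := coef_mul_pairF hb7 h1' h2' h3' hne t
  rw [hsh, hc] at hmain
  rw [← hmain, mul_assoc, mul_comm (pairF _ _ _ _ _ _ _), ← crossF_neg_right]
  rw [crossF_mul_pairF (x := b' 0) (v := -a 0) (by rw [hb0]; ring) hne]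
  · rw [hb0, brPM_neg_right, brPM_neg_right, crossF, brPM_swap L κ y, brPM_swap L κ y,
      neg_div_neg_eq]
    ring
  · exact hy.neg.symm

section Evaluation

variable {a : Fin 8 → ℂ} {m n : ℕ} {z : Fin m → ℂ} {w : Fin n → ℂ}

/-- At `x = a₀` the splitting sum reduces to one with a variable less. -/
lemma splitSum_cons_param_zero (ha7 : a 7 = a 0 + δ) (h0 : br L κ (2 * a 0) ≠ 0)
    (h1 : br L κ (2 * a 0 + δ) ≠ 0) (h2 : br L κ (2 * a 0 - δ) ≠ 0)
    (h3 : br L κ (2 * a 0 + 3 * δ) ≠ 0) (hz : ∀ j, brPM L κ (a 0) (z j) ≠ 0) :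
    splitSum L κ δ a (fun _ => a 0) (Fin.cons (a 0) z : Fin (m + 1) → ℂ) w =
      (∏ p ∈ Finset.Icc (1 : Fin 8) 6, br L κ (a 0 + a p)) *
        (∏ k, crossF L κ δ .pos (a 0) (w k)) *
        splitSum L κ δ (shiftParam δ a) (fun _ => shiftParam δ a 0) z w := by
  -- At x = a_0 the factor [x - a_0] kills A⁻ and [x ± c] with c = a_0 kills A⁰.
  rw [splitSum_succ, Finset.sum_eq_single SignType.pos]
  · congr 1
    -- The factors p = 0 and p = 7 are [2a_0] and [2a_0 + δ], the denominator of A⁺.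
    · rw [weight, coef, Aplus, prod_eq_mul_prod_Icc, ha7, ← add_assoc, ← two_mul,
        mul_div_right_comm, div_self (mul_ne_zero h0 h1), one_mul]
    · rw [splitSum_eq_pairSum]
      congr 1
      funext i t'
      rw [weight, mul_right_comm, coef_mul_pairF ha7 h1 h2 h3 (hz i), weight, shiftParam_zero]
  · intro t _ ht
    have hc : coef L κ δ a (a 0) t (a 0) = 0 := by
      cases t
      · simp [coef, Azero, AzeroTerm, brPM, br_zero]
      · simp [coef, Aminus, prod_eq_mul_prod_Icc, br_zero]
      · exact absurd rfl ht
    rw [weight, hc, zero_mul, zero_mul]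
  · intro h
    exact absurd (Finset.mem_univ _) h

lemma splitSum_dualParam_cons (ha7 : a 7 = a 0 + δ) (h1 : br L κ (2 * a 0 + δ) ≠ 0)
    (h2 : br L κ (2 * a 0 - δ) ≠ 0) (h3 : br L κ (2 * a 0 + 3 * δ) ≠ 0)
    (hw : ∀ k, CrossRegular L κ δ (a 0) (w k)) :
    splitSum L κ δ (dualParam δ a) (fun _ => dualParam δ a 0) w
        (Fin.cons (a 0) z : Fin (m + 1) → ℂ) =
      (∏ k, crossF L κ δ .pos (a 0) (w k)) *
        splitSum L κ δ (dualParam δ (shiftParam δ a))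
          (fun _ => dualParam δ (shiftParam δ a) 0) w z := by
  rw [splitSum_eq_pairSum, splitSum_eq_pairSum, ← pairSum_const_mul]
  congr 1
  funext k t
  rw [weight_cons, weight, mul_right_comm, coef_mul_crossF ha7 h1 h2 h3 (hw k), weight, mul_assoc]

/-- The shift adds 2δ to Σa, matching one variable fewer. The new condition on 2a_0 + δ is that on
2a_0 + 3δ. -/
lemma Admissible.shiftParam (ha : Admissible L κ δ (m + 1) n a)
    (h3 : br L κ (2 * a 0 + 3 * δ) ≠ 0) : Admissible L κ δ m n (shiftParam δ a) := by
  refine ⟨?_, by rw [shiftParam_zero, shiftParam_seven, ha.last_eq], ?_, ?_⟩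
  · have h : ∑ p, EllipticBC.shiftParam δ a p = ∑ p, a p + 2 * δ := by
      simp only [EllipticBC.shiftParam, Fin.sum_univ_eight, Matrix.cons_val]
      ring
    rw [h, ha.balance]
    push_cast
    ring
  · rw [shiftParam_zero]
    convert! h3 using 2
    ring
  · rw [shiftParam_zero]
    convert! ha.add_ne using 2
    ring

lemma dualParam_dualParam (a : Fin 8 → ℂ) : dualParam δ (dualParam δ a) = a := by
  funext p
  fin_cases p <;> simp [dualParam]

lemma dualParam_of_mem {p : Fin 8} (hp : p ∈ Finset.Icc (1 : Fin 8) 6) :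
    dualParam δ a p = δ - a p := by
  fin_cases p <;> first | rfl | exact absurd hp (by decide)

lemma Admissible.dualParam (ha : Admissible L κ δ m (m + 1) a) :
    Admissible L κ δ (m + 1) m (dualParam δ a) := by
  refine ⟨?_, ?_, ha.dual_add_ne, ha.dual_sub_ne⟩
  · rw [dualParam_sum, ha.balance]
    push_cast
    ring
  · rw [dualParam_zero ha.last_eq]
    simp [EllipticBC.dualParam]
    ring

lemma dualityFactor_succ (a : Fin 8 → ℂ) (k : ℕ) :
    dualityFactor L κ δ a (k + 1) = (∏ p ∈ Finset.Icc (1 : Fin 8) 6, br L κ (a 0 + a p)) *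
      dualityFactor L κ δ (shiftParam δ a) k := by
  rw [dualityFactor, dualityFactor, ← Finset.prod_mul_distrib]
  refine Finset.prod_congr rfl fun p hp => ?_
  rw [brPoch, Finset.prod_range_succ', brPoch, mul_comm, shiftParam_zero, shiftParam_of_mem hp]
  congr 1
  · simp
  · refine Finset.prod_congr rfl fun i _ => ?_
    congr 1
    push_cast
    ring

/-- Evaluation at a_0 leaves the identity for m and n variables with shifted parameters. If n = m +
1 this is outside the range n ≤ m, and it is obtained from the duality for n and m variables at the
dual parameters, dualization being an involution. -/
lemma dualityDiff_param_zero (ih : n ≤ m → Duality L κ δ m n)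
    (ih' : n = m + 1 → Duality L κ δ n m) (hn : n ≤ m + 1) (ha : Admissible L κ δ (m + 1) n a)
    (h0 : br L κ (2 * a 0) ≠ 0) (h3 : br L κ (2 * a 0 + 3 * δ) ≠ 0)
    (haz : ∀ j, brPM L κ (a 0) (z j) ≠ 0) (haw : ∀ k, CrossRegular L κ δ (a 0) (w k))
    (hz : Generic L κ δ z) (hw : Generic L κ δ w) (hzw : ∀ i k, CrossRegular L κ δ (z i) (w k)) :
    dualityDiff L κ δ a z w (a 0) = 0 := by
  have ha' := ha.shiftParam h3
  rw [dualityDiff, splitSum_cons_param_zero ha.last_eq h0 ha.add_ne ha.sub_ne h3 haz,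
    splitSum_dualParam_cons ha.last_eq ha.add_ne ha.sub_ne h3 haw]
  rcases Nat.lt_or_ge m n with h | h
  · obtain rfl : n = m + 1 := by omega
    have hd := ih' rfl _ ha'.dualParam w z hw hz fun k i => (hzw i k).symm
    rw [dualParam_dualParam, Nat.add_sub_cancel_left] at hd
    -- The dual factors are -[a_0 + a_p], and the six signs cancel.
    have h1 : dualityFactor L κ δ (dualParam δ (shiftParam δ a)) 1 =
        ∏ p ∈ Finset.Icc (1 : Fin 8) 6, br L κ (a 0 + a p) := by
      have hs : ∀ p ∈ Finset.Icc (1 : Fin 8) 6,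
          brPoch L κ δ (dualParam δ (shiftParam δ a) 0 + dualParam δ (shiftParam δ a) p) 1 =
            -br L κ (a 0 + a p) := by
        intro p hp
        rw [brPoch, Finset.prod_range_one, dualParam_zero ha'.last_eq, dualParam_of_mem hp,
          shiftParam_zero, shiftParam_of_mem hp, ← br_neg]
        congr 1
        push_cast
        ring
      rw [dualityFactor, Finset.prod_congr rfl hs, Finset.prod_neg]
      simp [show (Finset.Icc (1 : Fin 8) 6).card = 6 from rfl]
      norm_num
    rw [hd, h1, Nat.sub_self]
    simp only [dualityFactor, brPoch, Finset.range_zero, Finset.prod_empty, Finset.prod_const_one]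
    ring
  · rw [ih h _ ha' z w hz hw hzw, Nat.succ_sub h, dualityFactor_succ]
    ring

end Evaluation

/-! ### Generic parameters, and the general case -/

/-- The difference is continuous at both x and a_0, so its value at x is its value at a_0, namely 0.
-/
lemma duality_of_generic {a : Fin 8 → ℂ} {m n : ℕ} {x : ℂ} {z : Fin m → ℂ} {w : Fin n → ℂ}
    (hδ1 : δ ∉ L.lattice) (hδ2 : 2 * δ ∉ L.lattice)
    (ih₀ : ∀ n', n = n' + 1 → Duality L κ δ m n') (ih : n ≤ m → Duality L κ δ m n)
    (ih' : n = m + 1 → Duality L κ δ n m) (hn : n ≤ m + 1) (ha : Admissible L κ δ (m + 1) n a)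
    (h0 : br L κ (2 * a 0) ≠ 0) (h3 : br L κ (2 * a 0 + 3 * δ) ≠ 0)
    (haz : ∀ j, brPM L κ (a 0) (z j) ≠ 0) (haw : ∀ k, CrossRegular L κ δ (a 0) (w k))
    (hz : Generic L κ δ (Fin.cons x z : Fin (m + 1) → ℂ)) (hw : StronglyGeneric L κ δ w)
    (hxw : ∀ k, CrossRegular L κ δ x (w k)) (hzw : ∀ i k, CrossRegular L κ δ (z i) (w k)) :
    splitSum L κ δ a (fun _ => a 0) (Fin.cons x z : Fin (m + 1) → ℂ) w =
      dualityFactor L κ δ a (m + 1 - n) * splitSum L κ δ (dualParam δ a)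
        (fun _ => dualParam δ a 0) w (Fin.cons x z : Fin (m + 1) → ℂ) := by
  obtain ⟨hx, hxz, hz'⟩ := generic_cons_iff.mp hz
  obtain ⟨C, hC⟩ := exists_const_dualityDiff hδ1 hδ2 ih₀ ha hz' hw hzw
  have hC0 := hC _ (continuousAt_dualityDiff ha ⟨h0, ha.add_ne, ha.sub_ne⟩ haz haw hz' hw.1 hzw)
  rw [dualityDiff_param_zero ih ih' hn ha h0 h3 haz haw hz' hw.1 hzw] at hC0
  have hx0 := hC _ (continuousAt_dualityDiff ha hx hxz hxw hz' hw.1 hzw)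
  rw [← hC0] at hx0
  exact sub_eq_zero.mp hx0

/-- A line that is not constant meets the lattice in a discrete set. -/
lemma eventually_notMem_lattice {f : ℂ → ℂ} (α β : ℂ) (hβ : β ≠ 0) (hf : ∀ t, f t = α + β * t) :
    ∀ᶠ t in 𝓝[≠] (0 : ℂ), f t ∉ L.lattice := by
  simp only [hf]
  by_cases hα : α ∈ L.lattice
  · have hmap : Tendsto (fun t : ℂ => β * t) (𝓝[≠] 0) (𝓝[≠] 0) := by
      refine tendsto_nhdsWithin_of_tendsto_nhds_of_eventually_within _ ?_ ?_
      · have := (continuous_const_mul β).tendsto 0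
        rw [mul_zero] at this
        exact this.mono_left nhdsWithin_le_nhds
      · filter_upwards [self_mem_nhdsWithin] with x hx
        exact mul_ne_zero hβ hx
    filter_upwards [((tendsto_br_div_zero L 0).comp hmap).eventually_ne one_ne_zero] with t ht h
    refine ht ?_
    have h1 : β * t ∈ L.lattice := by
      convert! sub_mem h hα using 1
      ring
    rw [Function.comp_apply, (br_eq_zero_iff L 0).mpr h1, zero_div]
  · have hc : ContinuousAt (fun t => α + β * t) 0 := by fun_prop
    have hmem : (L.lattice : Set ℂ)ᶜ ∈ 𝓝 (α + β * 0) := by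
      rw [mul_zero, add_zero]
      exact L.isClosed_lattice.isOpen_compl.mem_nhds hα
    exact nhdsWithin_le_nhds (hc.preimage_mem_nhds hmem)

lemma eventually_brPM_ne_zero {f g : ℂ → ℂ} (α β α' β' : ℂ) (h : β + β' ≠ 0) (h' : β - β' ≠ 0)
    (hf : ∀ t, f t = α + β * t) (hg : ∀ t, g t = α' + β' * t) :
    ∀ᶠ t in 𝓝[≠] (0 : ℂ), brPM L κ (f t) (g t) ≠ 0 := by
  filter_upwards [eventually_notMem_lattice (L := L) (f := fun t => f t + g t) (α + α') _ h
      fun t => by rw [hf, hg]; ring,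
    eventually_notMem_lattice (L := L) (f := fun t => f t - g t) (α - α') _ h'
      fun t => by rw [hf, hg]; ring] with t h1 h2
  exact brPM_ne_zero_iff.mpr ⟨h1, h2⟩

lemma eventually_crossRegular {f g : ℂ → ℂ} (α β α' β' : ℂ) (h : β + β' ≠ 0) (h' : β - β' ≠ 0)
    (hf : ∀ t, f t = α + β * t) (hg : ∀ t, g t = α' + β' * t) :
    ∀ᶠ t in 𝓝[≠] (0 : ℂ), CrossRegular L κ δ (f t) (g t) :=
  (eventually_brPM_ne_zero (α + δ) β α' β' h h' (fun t => by rw [hf]; ring) hg).and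
    (eventually_brPM_ne_zero (α - δ) β α' β' h h' (fun t => by rw [hf]; ring) hg)

/-- Each forbidden condition puts an affine function of t into the lattice, with slope 2s_k or s_k ±
s_l. Nonzero slopes make the exceptions isolated. -/
lemma eventually_stronglyGeneric {n : ℕ} (w s : Fin n → ℂ) (h0 : ∀ k, s k ≠ 0)
    (h1 : ∀ k l, k ≠ l → s k + s l ≠ 0) (h2 : ∀ k l, k ≠ l → s k - s l ≠ 0) :
    ∀ᶠ t in 𝓝[≠] (0 : ℂ), StronglyGeneric L κ δ fun k => w k + s k * t := by
  have h : ∀ k c, ∀ᶠ t in 𝓝[≠] (0 : ℂ), 2 * (w k + s k * t) + c ∉ L.lattice := fun k c =>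
    eventually_notMem_lattice (2 * w k + c) (2 * s k) (mul_ne_zero two_ne_zero (h0 k))
      fun t => by ring
  have hp : ∀ k l c, k ≠ l →
      ∀ᶠ t in 𝓝[≠] (0 : ℂ), brPM L κ (w k + s k * t + c) (w l + s l * t) ≠ 0 := fun k l c hkl =>
    eventually_brPM_ne_zero (w k + c) (s k) (w l) (s l) (h1 k l hkl) (h2 k l hkl)
      (fun t => by ring) fun t => rfl
  refine (Filter.Eventually.and ?_ ?_).and (Filter.Eventually.and ?_ ?_)
  · refine Filter.eventually_all.mpr fun k => ?_
    filter_upwards [h k 0, h k δ, h k (-δ)] with t g1 g2 g3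
    simp only [br_ne_zero_iff, sub_eq_add_neg]
    exact ⟨by simpa using g1, g2, g3⟩
  · simp only [Filter.eventually_all]
    intro k l hkl
    simpa using hp k l 0 hkl
  · refine Filter.eventually_all.mpr fun k => ?_
    filter_upwards [h k (2 * δ), h k (-(2 * δ)), h k (3 * δ), h k (-(3 * δ))] with t g1 g2 g3 g4
    simp only [sub_eq_add_neg]
    exact ⟨g1, g2, g3, g4⟩
  · simp only [Filter.eventually_all]
    intro k l hkl
    filter_upwards [hp k l (2 * δ) hkl, hp k l (-(2 * δ)) hkl] with t g1 g2
    simp only [sub_eq_add_neg]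
    exact ⟨g1, g2⟩

lemma continuous_dualParam : Continuous (dualParam δ) := by
  refine continuous_pi fun p => ?_
  fin_cases p <;> simp only [dualParam] <;> exact continuous_const.sub (continuous_apply _)

lemma continuous_dualityFactor (k : ℕ) : Continuous fun a => dualityFactor L κ δ a k :=
  continuous_finsetProd _ fun p _ => continuous_finsetProd _ fun i _ =>
    (continuous_br L κ).comp (by fun_prop)

/-- Both sides are continuous at the given point in a and w. The identity holds near it on a
punctured line through the point, where the extra genericity is available, and passes to the limit.
-/
lemma duality_succ {m n : ℕ} (hδ1 : δ ∉ L.lattice) (hδ2 : 2 * δ ∉ L.lattice)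
    (ih₀ : ∀ n', n = n' + 1 → Duality L κ δ m n') (ih : n ≤ m → Duality L κ δ m n)
    (ih' : n = m + 1 → Duality L κ δ n m) (hn : n ≤ m + 1) : Duality L κ δ (m + 1) n := by
  intro a ha z w hz hw hzw
  obtain ⟨x, z, rfl⟩ : ∃ x z', z = Fin.cons x z' := ⟨z 0, Fin.tail z, (Fin.cons_self_tail z).symm⟩
  -- This direction preserves both Σa and a_7 - a_0 while moving a_0.
  set d : Fin 8 → ℂ := ![1, -2, 0, 0, 0, 0, 0, 1] with hd
  -- The speeds 2, 3, … are nonzero and distinct, no two sum to 0, and none is ±1. Hence the w_k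
  -- separate from each other, from the fixed z and x, and from a_0, which moves at speed 1.
  set s : Fin n → ℂ := fun k => ((k.val + 2 : ℕ) : ℂ) with hs
  set A : ℂ → Fin 8 → ℂ := fun t p => a p + d p * t with hA
  set W : ℂ → Fin n → ℂ := fun t k => w k + s k * t with hW
  have hA0 : A 0 = a := by simp [hA]
  have hW0 : W 0 = w := by simp [hW]
  have hAc : Continuous A := by fun_prop
  have hWc : Continuous W := by fun_prop
  have s0 : ∀ k, s k ≠ 0 := fun k => Nat.cast_ne_zero.mpr (by omega)
  have s1 : ∀ k l, s k + s l ≠ 0 := fun k l => by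
    simp only [hs]
    rw [← Nat.cast_add]
    exact Nat.cast_ne_zero.mpr (by omega)
  have s2 : ∀ k l, k ≠ l → s k - s l ≠ 0 := fun k l hkl => by
    refine sub_ne_zero.mpr fun h => hkl (Fin.ext ?_)
    have := Nat.cast_injective h
    omega
  have s3 : ∀ k, 1 + s k ≠ 0 := fun k => by
    simp only [hs]
    rw [← Nat.cast_one, ← Nat.cast_add]
    exact Nat.cast_ne_zero.mpr (by omega)
  have s4 : ∀ k, 1 - s k ≠ 0 := fun k => by
    refine sub_ne_zero.mpr fun h => ?_
    rw [← Nat.cast_one] at h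
    have := Nat.cast_injective h
    omega
  have hA0t : ∀ t, A t 0 = a 0 + 1 * t := fun t => rfl
  have hA0' : ∀ c, ∀ᶠ t in 𝓝[≠] (0 : ℂ), 2 * A t 0 + c ∉ L.lattice := fun c =>
    eventually_notMem_lattice (2 * a 0 + c) 2 two_ne_zero fun t => by rw [hA0t]; ring
  have hcross : ∀ y, ∀ᶠ t in 𝓝[≠] (0 : ℂ), ∀ k, CrossRegular L κ δ y (W t k) := fun y =>
    Filter.eventually_all.mpr fun k => eventually_crossRegular (f := fun _ => y) y 0 (w k) (s k)
      (by simpa using s0 k) (by simpa using s0 k) (fun t => by ring) fun t => rfl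
  have hadm : ∀ᶠ t in 𝓝[≠] (0 : ℂ), Admissible L κ δ (m + 1) n (A t) := by
    filter_upwards [hA0' δ, hA0' (-δ)] with t h1 h2
    refine ⟨?_, ?_, br_ne_zero_iff.mpr h1, br_ne_zero_iff.mpr (by rwa [sub_eq_add_neg])⟩
    · rw [← ha.balance]
      simp only [hA, Finset.sum_add_distrib, ← Finset.sum_mul]
      rw [show ∑ p, d p = 0 by simp [hd, Fin.sum_univ_eight]; norm_num, zero_mul, add_zero]
    · have h7 : A t 7 = a 7 + 1 * t := rfl
      rw [h7, hA0t, ha.last_eq]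
      ring
  have heq : ∀ᶠ t in 𝓝[≠] (0 : ℂ),
      splitSum L κ δ (A t) (fun _ => A t 0) (Fin.cons x z : Fin (m + 1) → ℂ) (W t) =
        dualityFactor L κ δ (A t) (m + 1 - n) * splitSum L κ δ (dualParam δ (A t))
          (fun _ => dualParam δ (A t) 0) (W t) (Fin.cons x z : Fin (m + 1) → ℂ) := by
    have haz : ∀ᶠ t in 𝓝[≠] (0 : ℂ), ∀ j, brPM L κ (A t 0) (z j) ≠ 0 :=
      Filter.eventually_all.mpr fun j => eventually_brPM_ne_zero (g := fun _ => z j) (a 0) 1 (z j) 0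
        (by simp) (by simp) hA0t fun t => by ring
    have haw : ∀ᶠ t in 𝓝[≠] (0 : ℂ), ∀ k, CrossRegular L κ δ (A t 0) (W t k) :=
      Filter.eventually_all.mpr fun k => eventually_crossRegular (a 0) 1 (w k) (s k) (s3 k) (s4 k)
        hA0t fun t => rfl
    filter_upwards [hadm, hA0' 0, hA0' (3 * δ), haz, haw, hcross x,
      Filter.eventually_all.mpr fun i => hcross (z i),
      eventually_stronglyGeneric (L := L) (κ := κ) (δ := δ) w s s0 (fun k l _ => s1 k l) s2]
      with t g1 g2 g3 g4 g5 g6 g7 g8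
    exact duality_of_generic hδ1 hδ2 ih₀ ih ih' hn g1 (br_ne_zero_iff.mpr (by simpa using g2))
      (br_ne_zero_iff.mpr g3) g4 g5 hz g8 g6 g7
  have hl : ContinuousAt (fun t => splitSum L κ δ (A t) (fun _ => A t 0)
      (Fin.cons x z : Fin (m + 1) → ℂ) (W t)) 0 :=
    continuousAt_splitSum (a := A) (c := fun t => A t 0) (z := fun _ => Fin.cons x z) (w := W)
      hAc.continuousAt ((continuous_apply 0).comp hAc).continuousAt continuousAt_const
      hWc.continuousAt hz (by rw [hA0]; exact ha.add_ne) (by rw [hA0]; exact ha.sub_ne)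
      (by rw [hW0]; exact hzw)
  have hr : ContinuousAt (fun t => dualityFactor L κ δ (A t) (m + 1 - n) *
      splitSum L κ δ (dualParam δ (A t)) (fun _ => dualParam δ (A t) 0) (W t)
        (Fin.cons x z : Fin (m + 1) → ℂ)) 0 :=
    ((continuous_dualityFactor (m + 1 - n)).comp hAc).continuousAt.mul
      (continuousAt_splitSum (a := fun t => dualParam δ (A t)) (c := fun t => dualParam δ (A t) 0)
      (z := W) (w := fun _ => Fin.cons x z) (continuous_dualParam.comp hAc).continuousAt
      ((continuous_apply 0).comp (continuous_dualParam.comp hAc)).continuousAt hWc.continuousAt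
      continuousAt_const (by rw [hW0]; exact hw) (by rw [hA0]; exact ha.dual_add_ne)
      (by rw [hA0]; exact ha.dual_sub_ne) (by rw [hW0]; exact fun k i => (hzw i k).symm))
  have h := tendsto_nhds_unique
    ((hl.tendsto.mono_left nhdsWithin_le_nhds).congr' heq)
    (hr.tendsto.mono_left (nhdsWithin_le_nhds (s := {0}ᶜ)))
  rwa [hA0, hW0] at h

lemma duality (hδ1 : δ ∉ L.lattice) (hδ2 : 2 * δ ∉ L.lattice) :
    ∀ k m n : ℕ, m + n = k → n ≤ m → Duality L κ δ m n := by
  intro k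
  induction k using Nat.strong_induction_on with
  | _ k ih =>
    intro m n hk hn
    obtain - | m := m
    · obtain rfl : n = 0 := by omega
      intro a _ z w _ _ _
      rw [splitSum_zero, splitSum_zero]
      simp [dualityFactor, brPoch]
    -- The three smaller cases are (m, n - 1) for the residues, (m, n) for the evaluation if n ≤ m,
    -- and (n, m) for the evaluation if n = m + 1. All have a smaller total.
    · exact duality_succ hδ1 hδ2 (fun n' h => ih (m + n') (by omega) m n' rfl (by omega))
        (fun h => ih (m + n) (by omega) m n rfl h)
        (fun h => ih (n + m) (by omega) n m rfl (by omega)) hn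

end

end EllipticBC

theorem mainTheorem9 (L : PeriodPair) (κ δ : ℂ) (hδ0 : δ ≠ 0)
    (hδ : ∀ n : ℤ, (n : ℂ) * δ ∈ L.lattice → (n : ℂ) * δ = 0)
    (M N : ℕ) (hMN : N ≤ M) (a : Fin 8 → ℂ)
    (hbal : ∑ p, a p = (4 - 2 * (M : ℂ) + 2 * (N : ℂ)) * δ) (ha7 : a 7 = a 0 + δ)
    (ha0 : EllipticBC.br L κ (2 * a 0 + δ) ≠ 0 ∧ EllipticBC.br L κ (2 * a 0 - δ) ≠ 0)
    (z : Fin M → ℂ) (w : Fin N → ℂ)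
    (hz : EllipticBC.Generic L κ δ z) (hw : EllipticBC.Generic L κ δ w)
    (hzw : ∀ i k, EllipticBC.brPM L κ (z i + δ) (w k) ≠ 0 ∧
      EllipticBC.brPM L κ (z i - δ) (w k) ≠ 0) :
    EllipticBC.splitSum L κ δ a (fun _ => a 0) z w =
      (∏ p ∈ Finset.Icc (1 : Fin 8) 6, EllipticBC.brPoch L κ δ (a 0 + a p) (M - N)) *
        EllipticBC.splitSum L κ δ (EllipticBC.dualParam δ a)
          (fun _ => EllipticBC.dualParam δ a 0) w z := by
  refine EllipticBC.duality (fun h => hδ0 ?_) (fun h => hδ0 ?_) (M + N) M N rfl hMN a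
    ⟨hbal, ha7, ha0.1, ha0.2⟩ z w hz hw hzw
  · simpa using hδ 1 (by simpa using h)
  · simpa using hδ 2 (by simpa using h)
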